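/- Let $d\ge 3$ be an integer. Let $S^1$ be the circle of length $2\pi$ with angular coordinate $\theta$, let $S^{d-1}\subset\mathbb R^d$ be the unit sphere with its round metric, and equip $M=S^1\times S^{d-1}$ with the product metric. For $\rho\in\mathbb Z_{>0}$ let $\boldsymbol T_\rho\subset C^\infty(S^1)$ be the span of $1$ and of $\cos(m\theta),\ \sin(m\theta)$ for $1\le m\le\rho$. For $\nu\in\mathbb Z_{>0}$ let $\boldsymbol V_\nu(d)=\bigoplus_{n=0}^{\nu}\mathcal Y_{n,d}\subset C^\infty(S^{d-1})$, where $\mathcal Y_{n,d}$ is the space of spherical harmonics of degree $n$, that is, of restrictions to $S^{d-1}$ of harmonic homogeneous polynomials of degree $n$ in $d$ real variables. Let $\boldsymbol T_\rho\otimes\boldsymbol V_\nu(d)\subset C^\infty(M)$ be the span of the functions $(\theta,x)\mapsto u(\theta)v(x)$ with $u\in\boldsymbol T_\rho$, $v\in\boldsymbol V_\nu(d)$. For a finite-dimensional subspace $\boldsymbol V\subset C^\infty(M)$, $\boldsymbol V\neq0$, with the $L^2(M)$ inner product, let $S(\boldsymbol V)$ be its unit sphere, and let $$\mu(M,\boldsymbol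 V)=\frac{1}{\mathrm{area}(S(\boldsymbol V))}\int_{S(\boldsymbol V)}\#\{p\in M:\ d_pv=0\}\,dS(v)\in[0,\infty]$$ be the expected number of critical points of a random function in $\boldsymbol V$. Then there is a constant $K_d>0$, depending only on $d$, such that $$\mu\bigl(S^1\times S^{d-1},\boldsymbol T_\rho\otimes\boldsymbol V_\nu(d)\bigr)\sim K_d\,\dim\bigl(\boldsymbol T_\rho\otimes\boldsymbol V_\nu(d)\bigr)\quad\text{as }\rho,\nu\to\infty,$$ i.e. the ratio of $\mu$ to the dimension converges to $K_d$ when $\rho$ and $\nu$ tend to infinity jointly and independently of each other. -/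

import Mathlib

open MeasureTheory Filter Topology
open scoped Manifold ContDiff ENNReal

noncomputable section

namespace CriticalPoints

section General

variable {E : Type*} [NormedAddCommGroup E] [NormedSpace ℝ E]
  {H : Type*} [TopologicalSpace H] (I : ModelWithCorners ℝ E H)
  (M : Type*) [TopologicalSpace M] [ChartedSpace H M]

/-- The real vector space `C^∞(M)` of smooth real functions on `M`. -/
abbrev Smooth : Type _ := C^∞⟮I, M; 𝓘(ℝ, ℝ), ℝ⟯

variable {I M}

/-- The set of critical points of a smooth function: the points where its differential vanishes. -/
def critSet (f : Smooth I M) : Set M :=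
  {p | mfderiv I 𝓘(ℝ, ℝ) f p = 0}

section L2

variable [CompactSpace M] [MeasurableSpace M] [OpensMeasurableSpace M]
  (vol : Measure M) [IsFiniteMeasure vol]

theorem integrable_mul (f g : Smooth I M) : Integrable (fun p => f p * g p) vol :=
  (f.contMDiff.continuous.mul g.contMDiff.continuous).integrable_of_hasCompactSupport
    (HasCompactSupport.of_compactSpace _)

variable [vol.IsOpenPosMeasure]

/-- The `L²` inner product `(f, g) = ∫_M f g dvol` on `C^∞(M)`. -/
@[reducible]
def l2Core : InnerProductSpace.Core ℝ (Smooth I M) where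
  inner f g := ∫ p, f p * g p ∂vol
  conj_inner_symm f g := by
    simp only [conj_trivial, mul_comm]
  re_inner_nonneg f := integral_nonneg fun p => mul_self_nonneg (f p)
  add_left f g h := by
    simp only [ContMDiffMap.coe_add, Pi.add_apply, add_mul]
    exact integral_add (integrable_mul vol f h) (integrable_mul vol g h)
  smul_left f g r := by
    simp only [ContMDiffMap.coe_smul, Pi.smul_apply, smul_eq_mul, mul_assoc, conj_trivial]
    exact integral_const_mul r _
  definite f hf := by
    have h0 : (fun p => f p * f p) =ᵐ[vol] 0 :=
      (integral_eq_zero_iff_of_nonneg (fun p => mul_self_nonneg (f p))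
        (integrable_mul vol f f)).1 hf
    have h1 : (fun p => f p * f p) = 0 :=
      Measure.eq_of_ae_eq h0 (f.contMDiff.continuous.mul f.contMDiff.continuous)
        continuous_const
    ext p
    exact mul_self_eq_zero.1 (congrFun h1 p)

/-- The norm of the `L²` inner product on `C^∞(M)`. -/
@[reducible]
def l2Norm : NormedAddCommGroup (Smooth I M) :=
  (l2Core (I := I) vol).toNormedAddCommGroup

/-- `C^∞(M)` as an inner product space with the `L²` inner product. -/
@[reducible]
def l2Inner : @InnerProductSpace ℝ (Smooth I M) _ (l2Norm vol).toSeminormedAddCommGroup :=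
  InnerProductSpace.ofCore (l2Core (I := I) vol).toCore

/-- The expected number of critical points of a random function in a finite-dimensional space
`V ⊆ C^∞(M)`: the average, with respect to the area measure, of the number of critical points
(possibly infinite) over the unit sphere of `V` for the `L²` inner product. -/
def expectedCrit (V : Submodule ℝ (Smooth I M)) [FiniteDimensional ℝ V] : ℝ≥0∞ :=
  letI : NormedAddCommGroup (Smooth I M) := l2Norm vol
  letI : InnerProductSpace ℝ (Smooth I M) := l2Inner vol
  letI : MeasurableSpace V := borel V
  haveI : BorelSpace V := ⟨rfl⟩
  letI area : Measure (Metric.sphere (0 : V) 1) := (volume : Measure V).toSphere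
  (∫⁻ v, ((critSet (v : V).1).encard : ℝ≥0∞) ∂area) / area Set.univ

end L2

end General

section Product

variable {E₁ : Type*} [NormedAddCommGroup E₁] [NormedSpace ℝ E₁]
  {H₁ : Type*} [TopologicalSpace H₁] {I₁ : ModelWithCorners ℝ E₁ H₁}
  {M₁ : Type*} [TopologicalSpace M₁] [ChartedSpace H₁ M₁]
  {E₂ : Type*} [NormedAddCommGroup E₂] [NormedSpace ℝ E₂]
  {H₂ : Type*} [TopologicalSpace H₂] {I₂ : ModelWithCorners ℝ E₂ H₂}
  {M₂ : Type*} [TopologicalSpace M₂] [ChartedSpace H₂ M₂]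

/-- The bilinear map `(u, v) ↦ ((x, y) ↦ u x * v y)`. -/
def extMul : Smooth I₁ M₁ →ₗ[ℝ] Smooth I₂ M₂ →ₗ[ℝ] Smooth (I₁.prod I₂) (M₁ × M₂) :=
  LinearMap.mk₂ ℝ
    (fun u v => ⟨fun p => u p.1 * v p.2,
      (u.contMDiff.comp contMDiff_fst).mul (v.contMDiff.comp contMDiff_snd)⟩)
    (fun u u' v => by ext p; exact add_mul (u p.1) (u' p.1) (v p.2))
    (fun c u v => by ext p; exact mul_assoc c (u p.1) (v p.2))
    (fun u v v' => by ext p; exact mul_add (u p.1) (v p.2) (v' p.2))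
    (fun c u v => by ext p; exact mul_left_comm (u p.1) c (v p.2))

/-- `U ⊗ V` as a space of functions on `M₁ × M₂`: the span of the products `u(x) v(y)`. -/
def tensor (U : Submodule ℝ (Smooth I₁ M₁)) (V : Submodule ℝ (Smooth I₂ M₂)) :
    Submodule ℝ (Smooth (I₁.prod I₂) (M₁ × M₂)) :=
  Submodule.map₂ extMul U V

instance tensor_finite (U : Submodule ℝ (Smooth I₁ M₁)) (V : Submodule ℝ (Smooth I₂ M₂))
    [FiniteDimensional ℝ U] [FiniteDimensional ℝ V] : FiniteDimensional ℝ (tensor U V) :=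
  Module.Finite.iff_fg.2
    (Submodule.FG.map₂ _ (Module.Finite.iff_fg.1 ‹_›) (Module.Finite.iff_fg.1 ‹_›))

end Product

section TheCircle

instance : MeasurableSpace Circle := borel Circle

instance : BorelSpace Circle := ⟨rfl⟩

/-- The arc length measure `dθ` on the unit circle, of total mass `2π`. -/
def arcLength : Measure Circle :=
  (volume.restrict (Set.Ioc (-Real.pi) Real.pi)).map Circle.exp

instance : IsFiniteMeasure arcLength := by
  unfold arcLength
  infer_instance

instance : arcLength.IsOpenPosMeasure where
  open_pos U hU hne := by
    have hc : Continuous (Circle.exp : ℝ → Circle) := Circle.exp.continuous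
    rw [arcLength, Measure.map_apply hc.measurable hU.measurableSet,
      Measure.restrict_apply (hU.preimage hc).measurableSet]
    obtain ⟨z, hz⟩ := hne
    have hmem : (z : ℂ).arg ∈ closure (Set.Ioo (-Real.pi) Real.pi) := by
      rw [closure_Ioo (by linarith [Real.pi_pos])]
      exact ⟨(Complex.neg_pi_lt_arg _).le, Complex.arg_le_pi _⟩
    obtain ⟨t, ht, ht'⟩ := mem_closure_iff.1 hmem _ (hU.preimage hc)
      (by simpa [Circle.exp_arg] using hz)
    refine (lt_of_lt_of_le (((hU.preimage hc).inter isOpen_Ioo).measure_pos volume ⟨t, ht, ht'⟩)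
      (measure_mono ?_)).ne'
    exact Set.inter_subset_inter_right _ Set.Ioo_subset_Ioc_self

theorem contMDiff_zpow (m : ℤ) : ContMDiff (𝓡 1) (𝓡 1) ∞ (fun z : Circle => z ^ m) := by
  have hpow : ∀ n : ℕ, ContMDiff (𝓡 1) (𝓡 1) ω (fun z : Circle => z ^ n) :=
    fun n => contMDiff_id.pow n
  refine ContMDiff.of_le (n := ω) ?_ le_top
  cases m with
  | ofNat n => simpa using hpow n
  | negSucc n => simpa [zpow_negSucc] using (hpow (n + 1)).inv

theorem contMDiff_coe : ContMDiff (𝓡 1) 𝓘(ℝ, ℂ) ∞ (fun z : Circle => (z : ℂ)) :=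
  haveI := finrank_real_complex_fact'
  contMDiff_coe_sphere (E := ℂ)

/-- With `z = exp (iθ)`: `cos (mθ) = Re (z ^ m)`. -/
def cosFun (m : ℤ) : Smooth (𝓡 1) Circle :=
  ⟨fun z => ((z ^ m : Circle) : ℂ).re,
    Complex.reCLM.contDiff.contMDiff.comp (contMDiff_coe.comp (contMDiff_zpow m))⟩

/-- With `z = exp (iθ)`: `sin (mθ) = Im (z ^ m)`. -/
def sinFun (m : ℤ) : Smooth (𝓡 1) Circle :=
  ⟨fun z => ((z ^ m : Circle) : ℂ).im,
    Complex.imCLM.contDiff.contMDiff.comp (contMDiff_coe.comp (contMDiff_zpow m))⟩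

theorem cosFun_exp (m : ℤ) (θ : ℝ) : cosFun m (Circle.exp θ) = Real.cos (m * θ) := by
  change ((Circle.exp θ ^ m : Circle) : ℂ).re = _
  rw [Circle.coe_zpow, Circle.coe_exp, ← Complex.exp_int_mul, ← mul_assoc]
  exact_mod_cast Complex.exp_ofReal_mul_I_re (m * θ)

theorem sinFun_exp (m : ℤ) (θ : ℝ) : sinFun m (Circle.exp θ) = Real.sin (m * θ) := by
  change ((Circle.exp θ ^ m : Circle) : ℂ).im = _
  rw [Circle.coe_zpow, Circle.coe_exp, ← Complex.exp_int_mul, ← mul_assoc]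
  exact_mod_cast Complex.exp_ofReal_mul_I_im (m * θ)

/-- The orthonormal trigonometric system: `(2π)^{-1/2}` for `m = 0`, `π^{-1/2} cos (mθ)` for
`m < 0` and `π^{-1/2} sin (mθ)` for `m > 0`. -/
def trigFun (m : ℤ) : Smooth (𝓡 1) Circle :=
  if m = 0 then (√(2 * Real.pi))⁻¹ • (1 : Smooth (𝓡 1) Circle)
  else if m < 0 then (√Real.pi)⁻¹ • cosFun m
  else (√Real.pi)⁻¹ • sinFun m

/-- `T_ρ`: the trigonometric polynomials of degree at most `ρ`. -/
def trigPoly (ρ : ℕ) : Submodule ℝ (Smooth (𝓡 1) Circle) :=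
  Submodule.span ℝ (trigFun '' Set.Icc (-(ρ : ℤ)) ρ)

instance (ρ : ℕ) : FiniteDimensional ℝ (trigPoly ρ) :=
  FiniteDimensional.span_of_finite ℝ ((Set.finite_Icc _ _).image _)

end TheCircle

section TheSphere

/-- The unit sphere `S^k` in `ℝ^{k+1}`. -/
abbrev Sph (k : ℕ) : Type := Metric.sphere (0 : EuclideanSpace ℝ (Fin (k + 1))) 1

/-- The area measure of the round metric on `S^k`. -/
def sphArea (k : ℕ) : Measure (Sph k) :=
  (volume : Measure (EuclideanSpace ℝ (Fin (k + 1)))).toSphere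

instance (k : ℕ) : IsFiniteMeasure (sphArea k) := by
  unfold sphArea
  infer_instance

instance (k : ℕ) : (sphArea k).IsOpenPosMeasure := by
  unfold sphArea
  infer_instance

theorem contMDiff_eval (k : ℕ) (p : MvPolynomial (Fin (k + 1)) ℝ) :
    ContMDiff (𝓡 k) 𝓘(ℝ, ℝ) ∞ (fun x : Sph k => MvPolynomial.eval (fun i => x.1 i) p) := by
  have hcoe : ContMDiff (𝓡 k) 𝓘(ℝ, EuclideanSpace ℝ (Fin (k + 1))) ∞
      (Subtype.val : Sph k → EuclideanSpace ℝ (Fin (k + 1))) :=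
    haveI := Fact.mk (@finrank_euclideanSpace_fin ℝ _ (k + 1))
    contMDiff_coe_sphere
  have hp : ContDiff ℝ ∞
      (fun x : EuclideanSpace ℝ (Fin (k + 1)) => MvPolynomial.eval (fun i => x i) p) := by
    induction p using MvPolynomial.induction_on with
    | C a => simpa using contDiff_const
    | add p q hp hq => simpa using hp.add hq
    | mul_X p i hp =>
      simp only [map_mul, MvPolynomial.eval_X]
      exact hp.mul (by fun_prop)
  exact hp.contMDiff.comp hcoe

/-- The restriction of a real polynomial in `k + 1` variables to `S^k`. -/
def restrictSph (k : ℕ) : MvPolynomial (Fin (k + 1)) ℝ →ₗ[ℝ] Smooth (𝓡 k) (Sph k) where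
  toFun p := ⟨fun x => MvPolynomial.eval (fun i => x.1 i) p, contMDiff_eval k p⟩
  map_add' p q := by ext x; exact map_add (MvPolynomial.eval fun i => x.1 i) p q
  map_smul' c p := by ext x; exact MvPolynomial.smul_eval (fun i => x.1 i) p c

/-- The Laplacian `∑ ∂²/∂x_i²` on polynomials. -/
def polyLaplacian (k : ℕ) :
    MvPolynomial (Fin (k + 1)) ℝ →ₗ[ℝ] MvPolynomial (Fin (k + 1)) ℝ :=
  ∑ i, (MvPolynomial.pderiv i).toLinearMap ∘ₗ (MvPolynomial.pderiv i).toLinearMap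

/-- The spherical harmonics of degree `n` on `S^k`: the restrictions of the homogeneous harmonic
polynomials of degree `n`. -/
def sphHarm (k n : ℕ) : Submodule ℝ (Smooth (𝓡 k) (Sph k)) :=
  (MvPolynomial.homogeneousSubmodule (Fin (k + 1)) ℝ n ⊓
    LinearMap.ker (polyLaplacian k)).map (restrictSph k)

instance (k n : ℕ) : FiniteDimensional ℝ (sphHarm k n) := by
  have : FiniteDimensional ℝ (MvPolynomial.homogeneousSubmodule (Fin (k + 1)) ℝ n) :=
    Module.Finite.iff_fg.2 (MvPolynomial.homogeneousSubmodule_fg _ _ n)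
  have : FiniteDimensional ℝ ↥(MvPolynomial.homogeneousSubmodule (Fin (k + 1)) ℝ n ⊓
      LinearMap.ker (polyLaplacian k)) :=
    Submodule.finiteDimensional_of_le inf_le_left
  exact Module.Finite.map _ _

/-- The sum of the spaces of spherical harmonics of degrees `0, …, ν` on `S^k`. -/
def sphPoly (k ν : ℕ) : Submodule ℝ (Smooth (𝓡 k) (Sph k)) :=
  ⨆ n : Fin (ν + 1), sphHarm k n

instance (k ν : ℕ) : FiniteDimensional ℝ (sphPoly k ν) := by
  unfold sphPoly
  infer_instance

end TheSphere

end CriticalPoints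

end

/-! Write `k = d - 1` and `M = S¹ × S^k`. The number of critical points is constant along rays of
the function space, so its mean over the unit sphere is its mean over a standard Gaussian vector of
coefficients in an orthonormal basis (`lintegral_toSphere_div`, `expectedCrit_eq_meanCrit`).
Rotations of the two factors act transitively on `M` and preserve distance, volume and function
space. Hence the mean count in a ball does not depend on its centre, and averaging over centres
relates it to the total count (`meanCrit_univ_mul`).

In a small ball, a Kac–Rice formula in the stereographic chart shows that the mean count divided by
the chart volume of the ball tends to a density given by the covariance of gradient and Hessian at
the centre (`kacRice`, `tendsto_meanCrit_div`). So the total count is this density times the limit,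
for shrinking balls, of `vol M` times the ratio of chart volume to volume. That limit involves only
`M` and the chart. It is never computed: one function space shows that it exists, and uniqueness of
limits makes it the same for all of them (`exists_expectedCrit_eq_mul`).

The reproducing kernel of each factor is a polynomial `Z` in the inner product, so all covariances
of derivatives up to order two are expressed through `Z(1)`, `Z'(1)`, `Z''(1)`
(`isotropicJet_of_kernel`). For the sphere, `Z` satisfies a Jacobi differential equation, which
gives `Z'(1)/Z(1)` and `Z''(1)/Z'(1)` (`derivatives_of_reproducing`); for the circle, sums of
Chebyshev polynomials give the same formulas with `k = 1`.

After normalization the covariance of the Hessian converges as `ρ` and `ν` tend to infinity, and the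
mean of `|det|` is continuous in the covariance and positive and finite at the limit
(`tendsto_gaussAbsDet`, `gaussAbsDet_isoCov_pos`). The remaining scalar in the density is of order
`ρ ν^k`, and so is the dimension `(2ρ + 1) dim V_ν`, because `dim V_ν ~ 2 ν^k / k!`. -/

namespace CriticalPoints

/-! ### The area formula with multiplicities -/

section AreaFormula

theorem encard_iUnion_eq_tsum {α : Type*} {s : ℕ → Set α}
    (hs : Pairwise (Function.onFun Disjoint s)) :
    ((⋃ n, s n).encard : ℝ≥0∞) = ∑' n, ((s n).encard : ℝ≥0∞) := by
  -- Cardinality is counting measure for the σ-algebra of all subsets.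
  let _ : MeasurableSpace α := ⊤
  have h : ∀ t : Set α, (t.encard : ℝ≥0∞) = Measure.count t := fun t =>
    (Measure.count_apply (MeasurableSpace.measurableSet_top)).symm
  simp only [h]
  exact measure_iUnion hs fun _ => MeasurableSpace.measurableSet_top

variable {E : Type*} [NormedAddCommGroup E] [NormedSpace ℝ E] [FiniteDimensional ℝ E]
  [MeasurableSpace E] [BorelSpace E] (μ : Measure E) [μ.IsAddHaarMeasure]

theorem encard_fiber_of_injOn {α β : Type*} {φ : α → β} {A : Set α} (h : Set.InjOn φ A) (c : β) :
    ({p ∈ A | φ p = c}.encard : ℝ≥0∞) = (φ '' A).indicator 1 c := by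
  by_cases hc : c ∈ φ '' A
  · obtain ⟨a, ha, rfl⟩ := hc
    have : {p ∈ A | φ p = φ a} = {a} := by
      ext p
      constructor
      · rintro ⟨hp, hpa⟩
        exact h hp ha hpa
      · rintro rfl
        exact ⟨ha, rfl⟩
    rw [this, Set.indicator_of_mem (Set.mem_image_of_mem _ ha)]
    simp
  · have : {p ∈ A | φ p = c} = ∅ := by
      ext p
      simp only [Set.mem_ofPred_eq, Set.mem_empty_iff_false, iff_false]
      rintro ⟨hp, rfl⟩
      exact hc (Set.mem_image_of_mem _ hp)
    rw [this, Set.indicator_of_notMem hc]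
    simp

/-- The area formula, with multiplicities, for a continuously differentiable map. -/
theorem lintegral_encard_fiber_mul {φ : E → E} {φ' : E → E →L[ℝ] E} {U D : Set E}
    (hU : IsOpen U) (hD : MeasurableSet D) (hDU : D ⊆ U)
    (hφ : ∀ p ∈ U, HasStrictFDerivAt φ (φ' p) p) (hc : ContinuousOn φ' U)
    {g : E → ℝ≥0∞} (hg : Measurable g) :
    ∫⁻ c, ({p ∈ D | φ p = c}.encard : ℝ≥0∞) * g c ∂μ =
      ∫⁻ p in D, ENNReal.ofReal |(φ' p).det| * g (φ p) ∂μ := by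
  have hdet : ContinuousOn (fun p => (φ' p).det) U :=
    ContinuousLinearMap.continuous_det.comp_continuousOn hc
  -- The regular points. The image of the other points is null by Sard's lemma, so only `R`
  -- contributes to either side.
  set R : Set E := U ∩ (fun p => (φ' p).det) ⁻¹' {0}ᶜ with hR
  have hRo : IsOpen R := hdet.isOpen_inter_preimage hU isOpen_compl_singleton
  have hloc : ∀ p ∈ R, ∃ O ∈ 𝓝 p, IsOpen O ∧ Set.InjOn φ O := by
    intro p hp
    have hp' : (φ' p).det ≠ 0 := hp.2
    set e := (φ' p).toContinuousLinearEquivOfDetNeZero hp'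
    have he : HasStrictFDerivAt φ (e : E →L[ℝ] E) p := by
      simpa [e] using hφ p hp.1
    refine ⟨(he.toOpenPartialHomeomorph φ).source, ?_, (he.toOpenPartialHomeomorph φ).open_source, ?_⟩
    · exact (he.toOpenPartialHomeomorph φ).open_source.mem_nhds
        he.mem_toOpenPartialHomeomorph_source
    · simpa using (he.toOpenPartialHomeomorph φ).injOn
  choose! O hO hOo hOi using hloc
  obtain ⟨t, htR, htc, hcov⟩ := TopologicalSpace.countable_cover_nhdsWithin
    (f := O) (s := R) fun x hx => mem_nhdsWithin_of_mem_nhds (hO x hx)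
  rcases t.eq_empty_or_nonempty with rfl | htne
  · have hRe : R = ∅ := by simpa using hcov
    have hz : ∀ p ∈ D, (φ' p).det = 0 := by
      intro p hp
      by_contra h
      have : p ∈ R := ⟨hDU hp, h⟩
      simp [hRe] at this
    have hs : μ (φ '' D) = 0 := addHaar_image_eq_zero_of_det_fderivWithin_eq_zero μ
      (fun x hx => (hφ x (hDU hx)).hasFDerivAt.hasFDerivWithinAt) hz
    rw [setLIntegral_congr_fun (g := fun _ => 0) hD (fun p hp => by simp [hz p hp]), lintegral_zero,
      lintegral_eq_zero_of_ae_eq_zero]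
    filter_upwards [measure_eq_zero_iff_ae_notMem.1 hs] with c hc
    have : {p ∈ D | φ p = c} = ∅ := by
      ext p
      simp only [Set.mem_ofPred_eq, Set.mem_empty_iff_false, iff_false]
      rintro ⟨hp, rfl⟩
      exact hc (Set.mem_image_of_mem _ hp)
    simp [this]
  obtain ⟨x, hx⟩ := htc.exists_eq_range htne
  have hxR : ∀ n, x n ∈ R := fun n => htR (hx ▸ Set.mem_range_self n)
  -- Disjoint pieces of the regular part on which `φ` is injective: on each the count is the
  -- indicator of the image and the ordinary change of variables applies.
  set A : ℕ → Set E := fun n => (D ∩ R) ∩ disjointed (fun n => O (x n)) n with hA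
  have hAm : ∀ n, MeasurableSet (A n) := fun n =>
    (hD.inter hRo.measurableSet).inter
      (MeasurableSet.disjointed (fun i => (hOo _ (hxR i)).measurableSet) n)
  have hAd : Pairwise (Function.onFun Disjoint A) := fun i j hij =>
    (disjoint_disjointed _ hij).mono Set.inter_subset_right Set.inter_subset_right
  have hAU : ⋃ n, A n = D ∩ R := by
    rw [hA, ← Set.inter_iUnion, iUnion_disjointed, Set.inter_eq_left]
    intro p hp
    have := hcov hp.2
    rw [hx] at this
    simpa using this
  have hAi : ∀ n, Set.InjOn φ (A n) := fun n =>
    (hOi _ (hxR n)).mono (Set.inter_subset_right.trans (disjointed_subset _ _))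
  have hs : μ (φ '' (D \ R)) = 0 := by
    refine addHaar_image_eq_zero_of_det_fderivWithin_eq_zero μ
      (fun x hx => (hφ x (hDU hx.1)).hasFDerivAt.hasFDerivWithinAt) fun p hp => ?_
    by_contra h
    exact hp.2 ⟨hDU hp.1, h⟩
  have hcount : ∀ᵐ c ∂μ, ({p ∈ D | φ p = c}.encard : ℝ≥0∞) * g c =
      ∑' n, (φ '' A n).indicator g c := by
    filter_upwards [measure_eq_zero_iff_ae_notMem.1 hs] with c hc
    have h1 : {p ∈ D | φ p = c} = ⋃ n, {p ∈ A n | φ p = c} := by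
      ext p
      have hmem : p ∈ D ∩ R ↔ ∃ n, p ∈ A n := by rw [← hAU, Set.mem_iUnion]
      simp only [Set.mem_ofPred_eq, Set.mem_iUnion, exists_and_right, ← hmem]
      constructor
      · rintro ⟨hp, rfl⟩
        refine ⟨⟨hp, ?_⟩, rfl⟩
        by_contra h
        exact hc (Set.mem_image_of_mem _ ⟨hp, h⟩)
      · rintro ⟨hp, rfl⟩
        exact ⟨hp.1, rfl⟩
    rw [h1, encard_iUnion_eq_tsum, ← ENNReal.tsum_mul_right]
    · congr 1
      ext n
      rw [encard_fiber_of_injOn (hAi n)]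
      by_cases h : c ∈ φ '' A n <;> simp [h]
    · intro i j hij
      exact (hAd hij).mono (Set.sep_subset _ _) (Set.sep_subset _ _)
  have himg : ∀ n, MeasurableSet (φ '' A n) := fun n =>
    measurable_image_of_fderivWithin (hAm n)
      (fun p hp => (hφ p (hDU hp.1.1)).hasFDerivAt.hasFDerivWithinAt) (hAi n)
  rw [lintegral_congr_ae hcount, lintegral_tsum fun n => (hg.indicator (himg n)).aemeasurable]
  have h2 : ∫⁻ p in D, ENNReal.ofReal |(φ' p).det| * g (φ p) ∂μ =
      ∫⁻ p in D ∩ R, ENNReal.ofReal |(φ' p).det| * g (φ p) ∂μ := by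
    rw [← lintegral_inter_add_sdiff _ _ hRo.measurableSet]
    convert add_zero _
    rw [setLIntegral_congr_fun (g := fun _ => 0) (hD.diff hRo.measurableSet), lintegral_zero]
    intro p hp
    have : (φ' p).det = 0 := by
      by_contra h
      exact hp.2 ⟨hDU hp.1, h⟩
    simp [this]
  rw [h2, ← hAU, lintegral_iUnion hAm hAd]
  congr 1
  ext n
  rw [lintegral_indicator (himg n), lintegral_image_eq_lintegral_abs_det_fderiv_mul μ (hAm n)
    (fun p hp => (hφ p (hDU hp.1.1)).hasFDerivAt.hasFDerivWithinAt) (hAi n)]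

end AreaFormula

/-! ### Measurability of fibre counts -/

section Counting

/-- The number of points in the fibres of a closed set over a compact metric space is a measurable
function of the base point. -/
theorem measurable_encard_fiber {X M : Type*} [TopologicalSpace X] [MeasurableSpace X]
    [OpensMeasurableSpace X] [MetricSpace M] [CompactSpace M] {Z : Set (X × M)} (hZ : IsClosed Z) :
    Measurable fun x => ({q | (x, q) ∈ Z}.encard : ℝ≥0∞) := by
  -- A fibre has at least `j` points iff for some `n` it contains a `j`-tuple with mutual distances
  -- at least `1 / (n + 1)`. For fixed `n` these tuples form a closed set, and projection along a
  -- compact factor is a closed map.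
  have key : ∀ j : ℕ, MeasurableSet {x | (j : ℕ∞) ≤ {q | (x, q) ∈ Z}.encard} := by
    intro j
    have : {x | (j : ℕ∞) ≤ {q | (x, q) ∈ Z}.encard} =
        ⋃ n : ℕ, Prod.fst '' {y : X × (Fin j → M) | (∀ i, (y.1, y.2 i) ∈ Z) ∧
          ∀ i l, i ≠ l → (1 / (n + 1 : ℝ)) ≤ dist (y.2 i) (y.2 l)} := by
      ext x
      simp only [Set.mem_ofPred_eq, Set.mem_iUnion, Set.mem_image, Prod.exists, exists_and_right,
        exists_eq_right]
      constructor
      · intro h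
        obtain ⟨t, ht, htj⟩ := Set.exists_subset_encard_eq h
        have htf : t.Finite := Set.finite_of_encard_eq_coe htj
        have e : Fin j ≃ t := by
          haveI := htf.fintype
          refine (Fintype.equivFinOfCardEq ?_).symm
          rw [Set.encard_eq_coe_toFinset_card] at htj
          rw [← Set.toFinset_card]
          exact_mod_cast htj
        have hpos : ∃ n : ℕ, ∀ i l, i ≠ l → (1 / (n + 1 : ℝ)) ≤ dist (e i : M) (e l) := by
          have h1 : ∀ p : Fin j × Fin j, ∀ᶠ n : ℕ in atTop,
              p.1 ≠ p.2 → (1 / (n + 1 : ℝ)) ≤ dist (e p.1 : M) (e p.2) := by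
            intro p
            by_cases hp : p.1 = p.2
            · simp [hp]
            · have : 0 < dist (e p.1 : M) (e p.2) := by
                rw [dist_pos]
                intro h
                exact hp (e.injective (Subtype.ext h))
              filter_upwards [(tendsto_one_div_add_atTop_nhds_zero_nat (𝕜 := ℝ)).eventually
                (gt_mem_nhds this)] with n hn _
              exact hn.le
          obtain ⟨n, hn⟩ := (eventually_all.2 h1).exists
          exact ⟨n, fun i l => hn (i, l)⟩
        obtain ⟨n, hn⟩ := hpos
        exact ⟨n, fun i => e i, fun i => ht (e i).2, hn⟩
      · rintro ⟨n, y, hy, hd⟩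
        have hinj : Function.Injective y := by
          intro i l h
          by_contra hil
          have := hd i l hil
          rw [h, dist_self] at this
          have : (0 : ℝ) < 1 / (n + 1 : ℝ) := by positivity
          linarith
        have : (Set.range y).encard = j := by
          rw [← Set.image_univ, hinj.encard_image]
          simp
        rw [← this]
        exact Set.encard_mono (by rintro _ ⟨i, rfl⟩; exact hy i)
    rw [this]
    refine MeasurableSet.iUnion fun n => IsClosed.measurableSet ?_
    refine isClosedMap_fst_of_compactSpace _ ?_
    simp only [Set.ofPred_and, Set.ofPred_forall]
    refine IsClosed.inter (isClosed_iInter fun i => hZ.preimage (by fun_prop))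
      (isClosed_iInter fun i => isClosed_iInter fun l => isClosed_iInter fun _ =>
        isClosed_le (by fun_prop) (by fun_prop))
  have h1 : Measurable fun x => ({q | (x, q) ∈ Z}.encard) := by
    refine measurable_to_countable' fun a => ?_
    induction a using ENat.recTopCoe with
    | top =>
      have : (fun x => {q | (x, q) ∈ Z}.encard) ⁻¹' {⊤} =
          ⋂ j : ℕ, {x | (j : ℕ∞) ≤ {q | (x, q) ∈ Z}.encard} := by
        ext x
        simp only [Set.mem_preimage, Set.mem_singleton_iff, Set.mem_iInter, Set.mem_ofPred_eq]
        rw [ENat.eq_top_iff_forall_ge]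
      rw [this]
      exact MeasurableSet.iInter key
    | coe j =>
      have : (fun x => {q | (x, q) ∈ Z}.encard) ⁻¹' {(j : ℕ∞)} =
          {x | (j : ℕ∞) ≤ {q | (x, q) ∈ Z}.encard} \
            {x | ((j + 1 : ℕ) : ℕ∞) ≤ {q | (x, q) ∈ Z}.encard} := by
        ext x
        simp only [Set.mem_preimage, Set.mem_singleton_iff, Set.mem_sdiff, Set.mem_ofPred_eq, not_le]
        rw [Nat.cast_add, Nat.cast_one, ENat.lt_add_one_iff (ENat.natCast_ne_top j), le_antisymm_iff,
          and_comm]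
      rw [this]
      exact (key j).diff (key (j + 1))
  exact (Measurable.of_discrete (f := fun n : ℕ∞ => (n : ℝ≥0∞))).comp h1

end Counting

/-! ### Bounds for determinants and Gaussian moments -/

section Bounds

/-- The determinant is bounded on the compact unit ball of operators and homogeneous of degree
`finrank ℝ E`. -/
theorem exists_abs_det_le (E : Type*) [NormedAddCommGroup E] [NormedSpace ℝ E]
    [FiniteDimensional ℝ E] :
    ∃ C : ℝ, 0 ≤ C ∧ ∀ A : E →L[ℝ] E, |A.det| ≤ C * ‖A‖ ^ Module.finrank ℝ E := by
  have : ProperSpace (E →L[ℝ] E) := FiniteDimensional.proper ℝ _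
  obtain ⟨C, hC⟩ := (isCompact_closedBall (0 : E →L[ℝ] E) 1).exists_bound_of_continuousOn
    (f := fun A => A.det) ContinuousLinearMap.continuous_det.continuousOn
  have hC0 : 0 ≤ C := (norm_nonneg _).trans (hC 0 (by simp))
  refine ⟨C, hC0, fun A => ?_⟩
  rcases eq_or_ne A 0 with rfl | hA
  · rcases Nat.eq_zero_or_pos (Module.finrank ℝ E) with h | h
    · have h1 := hC 0 (by simp)
      simpa [h] using h1
    · have h0 : (0 : E →L[ℝ] E).det = 0 := by
        have := LinearMap.det_zero (M := E) (A := ℝ)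
        rw [zero_pow h.ne'] at this
        simpa [ContinuousLinearMap.det] using this
      simp [h0, h.ne']
  · have hn : ‖A‖ ≠ 0 := norm_ne_zero_iff.2 hA
    have h1 := hC (‖A‖⁻¹ • A) (by simp [norm_smul, hn])
    have h2 : (‖A‖⁻¹ • A).det = ‖A‖⁻¹ ^ Module.finrank ℝ E * A.det := by
      simp [ContinuousLinearMap.det, LinearMap.det_smul]
    rw [h2, Real.norm_eq_abs, abs_mul, abs_of_nonneg (by positivity), inv_pow,
      inv_mul_le_iff₀ (by positivity)] at h1
    linarith

/-- Half of the exponent absorbs the power: `‖v‖ ^ n ≤ n! exp ‖v‖`, and completing the square gives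
`‖v‖ ≤ 1 / (2b) + b ‖v‖² / 2`. -/
theorem integrable_norm_pow_mul_exp {V : Type*} [NormedAddCommGroup V] [InnerProductSpace ℝ V]
    [FiniteDimensional ℝ V] [MeasurableSpace V] [BorelSpace V] (n : ℕ) {b : ℝ} (hb : 0 < b) :
    Integrable (fun v : V => ‖v‖ ^ n * Real.exp (-b * ‖v‖ ^ 2)) := by
  have h0 : Integrable (fun v : V => Real.exp (-(b / 2) * ‖v‖ ^ 2)) := by
    refine Integrable.of_integral_ne_zero ?_
    rw [GaussianFourier.integral_rexp_neg_mul_sq_norm (by positivity)]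
    positivity
  refine (h0.const_mul (n.factorial * Real.exp (1 / (2 * b)))).mono' (by fun_prop)
    (Eventually.of_forall fun v => ?_)
  have h1 : ‖v‖ ^ n ≤ n.factorial * Real.exp ‖v‖ := by
    have := Real.pow_div_factorial_le_exp ‖v‖ (norm_nonneg v) n
    rwa [div_le_iff₀ (by positivity), mul_comm] at this
  have h2 : ‖v‖ ≤ 1 / (2 * b) + b / 2 * ‖v‖ ^ 2 := by
    have : 1 / (2 * b) + b / 2 * ‖v‖ ^ 2 - ‖v‖ = (b * ‖v‖ - 1) ^ 2 / (2 * b) := by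
      field_simp; ring
    have : 0 ≤ (b * ‖v‖ - 1) ^ 2 / (2 * b) := by positivity
    linarith
  rw [Real.norm_eq_abs, abs_of_nonneg (by positivity)]
  calc ‖v‖ ^ n * Real.exp (-b * ‖v‖ ^ 2)
      ≤ (n.factorial * Real.exp (1 / (2 * b) + b / 2 * ‖v‖ ^ 2)) * Real.exp (-b * ‖v‖ ^ 2) := by
        gcongr
        exact h1.trans (by gcongr)
    _ = n.factorial * Real.exp (1 / (2 * b)) * Real.exp (-(b / 2) * ‖v‖ ^ 2) := by
        rw [mul_assoc, mul_assoc, ← Real.exp_add, ← Real.exp_add]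
        ring_nf

end Bounds

/-! ### The Kac–Rice formula at a point -/

section KacRice

variable {ι : Type*} [Fintype ι]

/-- The density of the centred Gaussian measure on `ι → ℝ` with independent coordinates of
variances `σ i`. -/
noncomputable def diagDensity (σ : ι → ℝ) (c : ι → ℝ) : ℝ :=
  (∏ i, (√(2 * Real.pi * σ i))⁻¹) * Real.exp (-(∑ i, c i ^ 2 / σ i) / 2)

theorem continuous_diagDensity (σ : ι → ℝ) : Continuous (diagDensity σ) := by
  unfold diagDensity
  fun_prop

theorem diagDensity_nonneg (σ c : ι → ℝ) : 0 ≤ diagDensity σ c := by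
  unfold diagDensity
  positivity

theorem lintegral_diagDensity {σ : ι → ℝ} (hσ : ∀ i, 0 < σ i) :
    ∫⁻ c, ENNReal.ofReal (diagDensity σ c) = 1 := by
  have h : ∀ c, diagDensity σ c =
      ∏ i, ProbabilityTheory.gaussianPDFReal 0 (σ i).toNNReal (c i) := by
    intro c
    simp only [ProbabilityTheory.gaussianPDFReal, diagDensity, sub_zero, Finset.prod_mul_distrib,
      ← Real.exp_sum, Real.coe_toNNReal _ (hσ _).le]
    congr 2
    rw [neg_div, Finset.sum_div, ← Finset.sum_neg_distrib]
    refine Finset.sum_congr rfl fun i _ => ?_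
    rw [neg_div, div_div, mul_comm (σ i)]
  have hi : ∫ c, diagDensity σ c = 1 := by
    simp_rw [h]
    rw [integral_fintype_prod_volume_eq_prod
      (f := fun i x => ProbabilityTheory.gaussianPDFReal 0 (σ i).toNNReal x)]
    refine Finset.prod_eq_one fun i _ => ProbabilityTheory.integral_gaussianPDFReal_eq_one 0 ?_
    simpa using hσ i
  rw [← ofReal_integral_eq_lintegral_ofReal (Integrable.of_integral_ne_zero (by simp [hi]))
    (Eventually.of_forall fun c => diagDensity_nonneg σ c), hi, ENNReal.ofReal_one]

variable {V : Type*} [NormedAddCommGroup V] [InnerProductSpace ℝ V]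

/-- Local solution of the linear equation `G p (v + J c) = 0` for `c`. -/
theorem exists_local_solution {G : (ι → ℝ) → V →L[ℝ] (ι → ℝ)} (hG : ContDiff ℝ 1 G)
    {J : (ι → ℝ) →L[ℝ] V} (hJ1 : ∀ c, G 0 (J c) = c)
    (hJ3 : ∀ h c, fderiv ℝ G 0 h (J c) = 0) :
    ∃ S : (ι → ℝ) → V →L[ℝ] (ι → ℝ), ∃ δ > 0, ContDiffOn ℝ 1 S (Metric.ball 0 δ) ∧
      (∀ v, S 0 v = - G 0 v) ∧ (∀ h v, fderiv ℝ S 0 h v = - fderiv ℝ G 0 h v) ∧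
      ∀ p ∈ Metric.ball 0 δ, ∀ v c, G p (v + J c) = 0 ↔ S p v = c := by
  -- `A 0` is the identity by `hJ1`, so `A p` stays invertible near `0` and the solution is `c = -(A
  -- p)⁻¹ (G p v)`.
  set A : (ι → ℝ) → (ι → ℝ) →L[ℝ] (ι → ℝ) := fun p => (G p).comp J with hA
  have hAc : ContDiff ℝ 1 A := hG.clm_comp contDiff_const
  have hA0 : A 0 = ContinuousLinearMap.id ℝ _ := by
    ext1 c
    exact hJ1 c
  have hinv0 : (A 0).IsInvertible := by
    rw [hA0]
    exact ⟨ContinuousLinearEquiv.refl ℝ _, rfl⟩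
  set S : (ι → ℝ) → V →L[ℝ] (ι → ℝ) := fun p => -((A p).inverse.comp (G p)) with hS
  have hSc : ContDiffAt ℝ 1 S 0 := by
    refine ContDiffAt.neg (ContDiffAt.clm_comp ?_ hG.contDiffAt)
    exact (ContinuousLinearMap.IsInvertible.contDiffAt_map_inverse hinv0).comp _ hAc.contDiffAt
  have hinv : ∀ᶠ p in 𝓝 0, (A p).IsInvertible := by
    have h1 : {B : (ι → ℝ) →L[ℝ] (ι → ℝ) | B.IsInvertible} ∈ 𝓝 (A 0) := by
      obtain ⟨e, he⟩ := hinv0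
      rw [← he]
      refine mem_of_superset (ContinuousLinearEquiv.nhds e) ?_
      rintro _ ⟨e', rfl⟩
      exact ⟨e', rfl⟩
    exact hAc.continuous.continuousAt.eventually h1
  have hS0 : ∀ v, S 0 v = - G 0 v := by
    intro v
    simp [hS, hA0]
  have hSon : ∀ᶠ p in 𝓝 0, ContDiffAt ℝ 1 S p := hSc.eventually (by simp)
  obtain ⟨δ, hδ, hδ'⟩ := Metric.eventually_nhds_iff_ball.1 (hinv.and hSon)
  refine ⟨S, δ, hδ, fun p hp => (hδ' p hp).2.contDiffWithinAt, hS0, ?_, ?_⟩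
  · intro h v
    -- Differentiate this identity at `0`: the term with the derivative of `A` vanishes by `hJ3`,
    -- and `A 0` is the identity.
    have hAS : (fun p => A p (S p v)) =ᶠ[𝓝 0] fun p => - G p v := by
      filter_upwards [hinv] with p hp
      simp [hS, hp.self_apply_inverse]
    have hSd := (hSc.differentiableAt one_ne_zero).hasFDerivAt
    have hGd := (hG.differentiable one_ne_zero 0).hasFDerivAt
    have hAd : HasFDerivAt A ((ContinuousLinearMap.compL ℝ _ _ _).flip J ∘L fderiv ℝ G 0) 0 :=
      ((ContinuousLinearMap.compL ℝ (ι → ℝ) V (ι → ℝ)).flip J).hasFDerivAt.comp 0 hGd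
    have h1 : HasFDerivAt (fun p => A p (S p v)) _ 0 :=
      hAd.clm_apply (hSd.clm_apply (hasFDerivAt_const v 0))
    have h2 : HasFDerivAt (fun p => - G p v) _ 0 := (hGd.clm_apply (hasFDerivAt_const v 0)).neg
    have h3 := (hAS.hasFDerivAt_iff.1 h1).unique h2
    have h4 := congrArg (fun T : (ι → ℝ) →L[ℝ] (ι → ℝ) => T h) h3
    simpa [hA0, hJ3] using h4
  · intro p hp v c
    have hi := (hδ' p hp).1
    have h1 : G p (v + J c) = 0 ↔ A p c = - G p v := by
      rw [map_add, add_comm, ← eq_neg_iff_add_eq_zero]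
      rfl
    rw [h1]
    constructor
    · intro h
      simp only [hS, neg_apply, ContinuousLinearMap.comp_apply]
      rw [← map_neg, ← h, hi.inverse_apply_self]
    · rintro rfl
      simp [hS, hi.self_apply_inverse]

variable [FiniteDimensional ℝ V] [MeasurableSpace V] [BorelSpace V]

/-- Every shift by `J c` leaves the integral unchanged, and `χ` has total mass one. In `kacRice`
this introduces an integration over `c` without splitting `V` along the range of `J`. -/
theorem lintegral_translate_average {E : Type*} [NormedAddCommGroup E] [NormedSpace ℝ E]
    [FiniteDimensional ℝ E] [MeasureSpace E] [BorelSpace E] [SFinite (volume : Measure E)]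
    (J : E →L[ℝ] V) {χ : E → ℝ≥0∞} (hχ : Measurable χ) (h1 : ∫⁻ c, χ c = 1)
    {F : V → ℝ≥0∞} (hF : Measurable F) :
    ∫⁻ v, F v = ∫⁻ v, ∫⁻ c, F (v + J c) * χ c := by
  rw [lintegral_lintegral_swap]
  · have h : ∀ c, ∫⁻ v, F (v + J c) * χ c = (∫⁻ v, F v) * χ c := fun c => by
      rw [lintegral_mul_const _ (by fun_prop), lintegral_add_right_eq_self]
    simp_rw [h]
    rw [lintegral_const_mul _ hχ, h1, mul_one]
  · refine Measurable.aemeasurable ?_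
    exact (hF.comp (by fun_prop)).mul (hχ.comp measurable_snd)

/-- A Kac–Rice formula near the origin for the zeros of a linear family of vector fields. -/
theorem kacRice {G : (ι → ℝ) → V →L[ℝ] (ι → ℝ)} (hG : ContDiff ℝ 1 G) {σ : ι → ℝ}
    (hσ : ∀ i, 0 < σ i) {J : (ι → ℝ) →L[ℝ] V} (hJ1 : ∀ c, G 0 (J c) = c)
    (hJ2 : ∀ c v, inner ℝ (J c) v = ∑ i, c i * G 0 v i / σ i)
    (hJ3 : ∀ h c, fderiv ℝ G 0 h (J c) = 0) :
    ∃ δ > 0, ∃ κ : (ι → ℝ) → ℝ≥0∞,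
      Tendsto κ (𝓝 0) (𝓝 (∫⁻ v, ENNReal.ofReal ((∏ i, (√(2 * Real.pi * σ i))⁻¹) *
        |((fderiv ℝ G 0).flip v).det| * Real.exp (-‖v‖ ^ 2 / 2)))) ∧
      ∀ D ⊆ Metric.ball 0 δ, MeasurableSet D →
        Measurable (fun v => ({p ∈ D | G p v = 0}.encard : ℝ≥0∞)) →
        ∫⁻ v, ({p ∈ D | G p v = 0}.encard : ℝ≥0∞) * ENNReal.ofReal (Real.exp (-‖v‖ ^ 2 / 2)) =
          ∫⁻ p in D, κ p := by
  -- `J` is the right inverse of `G 0` of least norm, since by `hJ2` its range is orthogonal to the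
  -- kernel of `G 0`. For fixed `v` the zeros of `G · (v + J c)` near the origin are the solutions
  -- of `S p v = c`; averaging over `c` and applying the area formula to `p ↦ S p v` produces a
  -- density in `p`.
  obtain ⟨S, δ, hδ, hSc, hS0, hS0', hSsol⟩ := exists_local_solution hG hJ1 hJ3
  have hJn : ∀ c, ‖J c‖ ^ 2 = ∑ i, c i ^ 2 / σ i := by
    intro c
    rw [← real_inner_self_eq_norm_sq, hJ2]
    simp only [hJ1, sq]
  set U : Set (ι → ℝ) := Metric.ball 0 δ with hU
  have hUo : IsOpen U := Metric.isOpen_ball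
  have hSd : ∀ p ∈ U, HasStrictFDerivAt S (fderiv ℝ S p) p := fun p hp =>
    ((hSc p hp).contDiffAt (hUo.mem_nhds hp)).hasStrictFDerivAt one_ne_zero
  have hSd' : ContinuousOn (fderiv ℝ S) U := hSc.continuousOn_fderiv_of_isOpen hUo le_rfl
  have hScont : ContinuousOn S U := hSc.continuousOn
  set f : V → (ι → ℝ) → ℝ := fun v p => |((fderiv ℝ S p).flip v).det| *
    (Real.exp (-‖v + J (S p v)‖ ^ 2 / 2) * diagDensity σ (S p v)) with hf
  have hf0 : ∀ v p, 0 ≤ f v p := fun v p =>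
    mul_nonneg (abs_nonneg _) (mul_nonneg (Real.exp_nonneg _) (diagDensity_nonneg _ _))
  have hfcont : ContinuousOn (fun x : V × (ι → ℝ) => f x.1 x.2) (Set.univ ×ˢ U) := by
    have h1 : ContinuousOn (fun x : V × (ι → ℝ) => fderiv ℝ S x.2) (Set.univ ×ˢ U) :=
      hSd'.comp continuousOn_snd fun x hx => hx.2
    have h2 : ContinuousOn (fun x : V × (ι → ℝ) => S x.2 x.1) (Set.univ ×ˢ U) :=
      (hScont.comp continuousOn_snd fun x hx => hx.2).clm_apply continuousOn_fst
    have h3 : ContinuousOn (fun x : V × (ι → ℝ) => (fderiv ℝ S x.2).flip x.1) (Set.univ ×ˢ U) :=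
      ((ContinuousLinearMap.flipₗᵢ ℝ (ι → ℝ) V (ι → ℝ)).continuous.comp_continuousOn
        h1).clm_apply continuousOn_fst
    refine ((ContinuousLinearMap.continuous_det.comp_continuousOn h3).abs).mul (ContinuousOn.mul ?_
      ((continuous_diagDensity σ).comp_continuousOn h2))
    have h4 : ContinuousOn (fun x : V × (ι → ℝ) => x.1 + J (S x.2 x.1)) (Set.univ ×ˢ U) :=
      continuousOn_fst.add (J.continuous.comp_continuousOn h2)
    exact Real.continuous_exp.comp_continuousOn (((h4.norm.pow 2).neg).div_const 2)
  refine ⟨δ, hδ, fun p => ∫⁻ v, ENNReal.ofReal (f v p), ?_, ?_⟩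
  · obtain ⟨C, hC0, hC⟩ := exists_abs_det_le (ι → ℝ)
    obtain ⟨B, hB⟩ : ∃ B, ∀ᶠ p in 𝓝 0, ‖fderiv ℝ S p‖ ≤ B := by
      have hc : ContinuousAt (fderiv ℝ S) 0 :=
        hSd'.continuousAt (Metric.ball_mem_nhds _ hδ)
      refine ⟨‖fderiv ℝ S 0‖ + 1, ?_⟩
      have hn : Tendsto (fun p => ‖fderiv ℝ S p‖) (𝓝 0) (𝓝 ‖fderiv ℝ S 0‖) :=
        Filter.Tendsto.norm (E := (ι → ℝ) →L[ℝ] V →L[ℝ] (ι → ℝ)) hc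
      exact (hn.eventually (gt_mem_nhds (lt_add_one _))).mono fun p hp => le_of_lt hp
    set n := Module.finrank ℝ (ι → ℝ)
    set P := ∏ i, (√(2 * Real.pi * σ i))⁻¹ with hP
    have hP0 : 0 ≤ P := by positivity
    have hB0 : 0 ≤ B := by
      obtain ⟨p, hp⟩ := hB.exists
      exact (norm_nonneg (fderiv ℝ S p)).trans hp
    have hlim : ∀ v, ENNReal.ofReal (P * |((fderiv ℝ G 0).flip v).det| *
        Real.exp (-‖v‖ ^ 2 / 2)) = ENNReal.ofReal (f v 0) := by
      intro v
      have h1 : (fderiv ℝ S 0).flip v = - (fderiv ℝ G 0).flip v := by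
        ext1 h
        exact hS0' h v
      have h2 : |((fderiv ℝ S 0).flip v).det| = |((fderiv ℝ G 0).flip v).det| := by
        rw [h1, ← neg_one_smul ℝ, ContinuousLinearMap.det, ContinuousLinearMap.toLinearMap_smul,
          LinearMap.det_smul, abs_mul, abs_pow]
        simp [ContinuousLinearMap.det]
      -- Pythagoras: `S 0 v = - G 0 v`, and `v - J (G 0 v)` is orthogonal to the range of `J`. This
      -- is why the shifts are weighted by `diagDensity σ`: at `p = 0` the product of the two
      -- weights is a constant times the Gaussian weight of `v`.
      have h3 : ‖v‖ ^ 2 = ‖v + J (S 0 v)‖ ^ 2 + ∑ i, (S 0 v) i ^ 2 / σ i := by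
        rw [← hJn, hS0, map_neg, ← sub_eq_add_neg, norm_sub_sq_real, norm_neg,
          real_inner_comm, hJ2, hJn]
        simp only [← sq]
        ring
      simp only [hf, diagDensity, h2]
      rw [h3, neg_add, add_div, Real.exp_add]
      congr 1
      ring
    simp_rw [hlim]
    -- Uniform domination: since `‖v‖² ≤ 2 ‖v + J c‖² + 2 ‖J c‖²`, the product of the two Gaussian
    -- weights is at most `P exp (-‖v‖² / 4)`, whatever `c = S p v` is.
    have hbound : ∀ᶠ p in 𝓝 (0 : ι → ℝ), ∀ v, f v p ≤
        C * B ^ n * P * (‖v‖ ^ n * Real.exp (-(1 / 4) * ‖v‖ ^ 2)) := by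
      filter_upwards [hB] with p hp v
      have h1 : |((fderiv ℝ S p).flip v).det| ≤ C * (B * ‖v‖) ^ n := by
        refine (hC _).trans ?_
        gcongr
        refine ((fderiv ℝ S p).flip.le_opNorm v).trans ?_
        rw [ContinuousLinearMap.opNorm_flip]
        gcongr
      have h2 : ‖v‖ ^ 2 ≤ 2 * ‖v + J (S p v)‖ ^ 2 + 2 * ∑ i, (S p v) i ^ 2 / σ i := by
        rw [← hJn]
        have : ‖v‖ ≤ ‖v + J (S p v)‖ + ‖J (S p v)‖ := by
          simpa using norm_sub_le (v + J (S p v)) (J (S p v))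
        nlinarith [sq_nonneg (‖v + J (S p v)‖ - ‖J (S p v)‖), norm_nonneg v]
      have h3 : Real.exp (-‖v + J (S p v)‖ ^ 2 / 2) * diagDensity σ (S p v) ≤
          P * Real.exp (-(1 / 4) * ‖v‖ ^ 2) := by
        rw [diagDensity, mul_left_comm, ← Real.exp_add]
        gcongr
        linarith
      calc f v p ≤ (C * (B * ‖v‖) ^ n) * (P * Real.exp (-(1 / 4) * ‖v‖ ^ 2)) := by
            simp only [hf]
            gcongr
            exact mul_nonneg (Real.exp_nonneg _) (diagDensity_nonneg _ _)
        _ = _ := by rw [mul_pow]; ring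
    refine tendsto_lintegral_filter_of_dominated_convergence
      (fun v => ENNReal.ofReal (C * B ^ n * P * (‖v‖ ^ n * Real.exp (-(1 / 4) * ‖v‖ ^ 2)))) ?_ ?_ ?_ ?_
    · filter_upwards [Metric.ball_mem_nhds 0 hδ] with p hp
      refine ENNReal.measurable_ofReal.comp (Continuous.measurable ?_)
      have : ContinuousOn (fun v => f v p) Set.univ :=
        hfcont.comp (f := fun v => (v, p)) (by fun_prop) fun v _ => ⟨trivial, hp⟩
      exact continuousOn_univ.1 this
    · filter_upwards [hbound] with p hp
      exact Eventually.of_forall fun v => ENNReal.ofReal_le_ofReal (hp v)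
    · exact ((integrable_norm_pow_mul_exp n (by norm_num)).const_mul _).lintegral_lt_top.ne
    · refine Eventually.of_forall fun v => ENNReal.tendsto_ofReal ?_
      have : ContinuousOn (fun p => f v p) U :=
        hfcont.comp (f := fun p => (v, p)) (by fun_prop) fun p hp => ⟨trivial, hp⟩
      exact this.continuousAt (Metric.ball_mem_nhds _ hδ)
  · intro D hD hDm hmeas
    have hw : Measurable fun v : V => ENNReal.ofReal (Real.exp (-‖v‖ ^ 2 / 2)) := by fun_prop
    have hχ : Measurable fun c => ENNReal.ofReal (diagDensity σ c) :=
      ENNReal.measurable_ofReal.comp (continuous_diagDensity σ).measurable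
    rw [lintegral_translate_average J hχ (lintegral_diagDensity hσ)
      (F := fun v => ({p ∈ D | G p v = 0}.encard : ℝ≥0∞) *
        ENNReal.ofReal (Real.exp (-‖v‖ ^ 2 / 2))) (hmeas.mul hw)]
    have hin : ∀ v, ∫⁻ c, (({p ∈ D | G p (v + J c) = 0}.encard : ℝ≥0∞) *
        ENNReal.ofReal (Real.exp (-‖v + J c‖ ^ 2 / 2))) * ENNReal.ofReal (diagDensity σ c) =
        ∫⁻ p in D, ENNReal.ofReal (f v p) := by
      intro v
      have hset : ∀ c, {p ∈ D | G p (v + J c) = 0} = {p ∈ D | S p v = c} := by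
        intro c
        ext p
        exact and_congr_right fun hp => hSsol p (hD hp) v c
      simp_rw [hset, mul_assoc]
      have hg : Measurable fun c => ENNReal.ofReal (Real.exp (-‖v + J c‖ ^ 2 / 2)) *
          ENNReal.ofReal (diagDensity σ c) := Measurable.mul (by fun_prop) hχ
      rw [lintegral_encard_fiber_mul volume (φ := fun p => S p v)
        (φ' := fun p => (fderiv ℝ S p).flip v) hUo hDm hD ?_ ?_ hg]
      · refine setLIntegral_congr_fun hDm fun p _ => ?_
        simp only [hf]
        rw [ENNReal.ofReal_mul (abs_nonneg _), ENNReal.ofReal_mul (Real.exp_nonneg _)]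
      · intro p hp
        have := (ContinuousLinearMap.apply ℝ (ι → ℝ) v).hasStrictFDerivAt.comp p (hSd p hp)
        exact this
      · exact ((ContinuousLinearMap.flipₗᵢ ℝ (ι → ℝ) V (ι → ℝ)).continuous.comp_continuousOn
          hSd').clm_apply continuousOn_const
    simp_rw [hin]
    rw [lintegral_lintegral_swap]
    have : (volume : Measure V).prod ((volume : Measure (ι → ℝ)).restrict D) =
        (volume.prod volume).restrict (Set.univ ×ˢ D) := by
      rw [← Measure.prod_restrict, Measure.restrict_univ]
    rw [this]
    exact ENNReal.measurable_ofReal.comp_aemeasurable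
      ((hfcont.mono (Set.prod_mono le_rfl hD)).aemeasurable (MeasurableSet.univ.prod hDm))

end KacRice

/-! ### The standard Gaussian measure and means over spheres -/

section StandardGaussian

open ProbabilityTheory

variable {V : Type*} [NormedAddCommGroup V] [InnerProductSpace ℝ V]

/-- The normalizing constant of the standard Gaussian density. -/
noncomputable def gaussConst (V : Type*) [NormedAddCommGroup V] [InnerProductSpace ℝ V] : ℝ :=
  ((2 * Real.pi) ^ ((Module.finrank ℝ V : ℝ) / 2))⁻¹

theorem gaussConst_pos : 0 < gaussConst V := by
  unfold gaussConst
  positivity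

variable [FiniteDimensional ℝ V] [MeasurableSpace V] [BorelSpace V]

theorem integrable_exp_neg_half_norm_sq : Integrable fun v : V => Real.exp (-‖v‖ ^ 2 / 2) := by
  have := integrable_norm_pow_mul_exp (V := V) 0 (b := 1 / 2) (by norm_num)
  refine this.congr (Eventually.of_forall fun v => ?_)
  simp only [pow_zero, one_mul]
  ring_nf

/-- Both measures are finite and have the same characteristic function. -/
theorem stdGaussian_eq_withDensity :
    stdGaussian V = volume.withDensity
      fun v => ENNReal.ofReal (gaussConst V * Real.exp (-‖v‖ ^ 2 / 2)) := by
  have hint : Integrable fun v : V => gaussConst V * Real.exp (-‖v‖ ^ 2 / 2) :=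
    integrable_exp_neg_half_norm_sq.const_mul _
  have : IsFiniteMeasure (volume.withDensity
      fun v : V => ENNReal.ofReal (gaussConst V * Real.exp (-‖v‖ ^ 2 / 2))) :=
    isFiniteMeasure_withDensity_ofReal hint.2
  apply Measure.ext_of_charFun
  ext t
  rw [charFun_stdGaussian, charFun_apply, integral_withDensity_eq_integral_toReal_smul
    (by fun_prop) (by simp)]
  have h1 : ∀ v : V, (ENNReal.ofReal (gaussConst V * Real.exp (-‖v‖ ^ 2 / 2))).toReal •
      Complex.exp (inner ℝ v t * Complex.I) = (gaussConst V : ℂ) *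
        Complex.exp (-(1 / 2 : ℂ) * ‖v‖ ^ 2 + Complex.I * inner ℝ t v) := by
    intro v
    rw [ENNReal.toReal_ofReal (mul_nonneg gaussConst_pos.le (Real.exp_nonneg _)),
      Complex.real_smul, Complex.ofReal_mul, mul_assoc, Complex.ofReal_exp, ← Complex.exp_add,
      real_inner_comm]
    push_cast
    ring_nf
  simp_rw [h1]
  rw [integral_const_mul, GaussianFourier.integral_cexp_neg_mul_sq_norm_add (by norm_num)]
  have h2 : (gaussConst V : ℂ) * ((Real.pi : ℂ) / (1 / 2)) ^ ((Module.finrank ℝ V : ℂ) / 2) = 1 := by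
    have : ((Real.pi : ℂ) / (1 / 2)) ^ ((Module.finrank ℝ V : ℂ) / 2) =
        (((2 * Real.pi) ^ ((Module.finrank ℝ V : ℝ) / 2) : ℝ) : ℂ) := by
      rw [Complex.ofReal_cpow (by positivity)]
      push_cast
      ring_nf
    rw [this, gaussConst, ← Complex.ofReal_mul, inv_mul_cancel₀ (by positivity), Complex.ofReal_one]
  rw [← mul_assoc, h2, one_mul]
  congr 1
  rw [Complex.I_sq]
  ring

theorem lintegral_stdGaussian (F : V → ℝ≥0∞) (hF : Measurable F) :
    ∫⁻ v, F v ∂stdGaussian V = ENNReal.ofReal (gaussConst V) *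
      ∫⁻ v, F v * ENNReal.ofReal (Real.exp (-‖v‖ ^ 2 / 2)) := by
  rw [stdGaussian_eq_withDensity, lintegral_withDensity_eq_lintegral_mul _ (by fun_prop) hF,
    ← lintegral_const_mul _ (by fun_prop)]
  refine lintegral_congr fun v => ?_
  rw [Pi.mul_apply, ENNReal.ofReal_mul gaussConst_pos.le]
  ring

instance : (stdGaussian V).IsOpenPosMeasure := by
  have : (volume : Measure V) ≪ stdGaussian V := by
    rw [stdGaussian_eq_withDensity]
    refine withDensity_absolutelyContinuous' (by fun_prop) (Eventually.of_forall fun v => ?_)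
    simp only [ne_eq, ENNReal.ofReal_eq_zero, not_le]
    exact mul_pos gaussConst_pos (Real.exp_pos _)
  exact this.isOpenPosMeasure

/-- The mean over the unit sphere of a function that is constant along rays is its mean for the
standard Gaussian measure. -/
theorem lintegral_toSphere_div [Nontrivial V] {F : V → ℝ≥0∞} (hF : Measurable F)
    (hhom : ∀ (r : ℝ) (v : V), 0 < r → F (r • v) = F v) :
    (∫⁻ v : Metric.sphere (0 : V) 1, F v ∂(volume : Measure V).toSphere) /
      (volume : Measure V).toSphere Set.univ = ∫⁻ v, F v ∂stdGaussian V := by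
  set n := Module.finrank ℝ V - 1
  -- The radial factor in polar coordinates. It need not be computed: the case `F = 1` shows that it
  -- is the inverse of the area of the sphere.
  set R : ℝ≥0∞ := ∫⁻ r : Set.Ioi (0 : ℝ), ENNReal.ofReal (gaussConst V * Real.exp (-(r : ℝ) ^ 2 / 2))
    ∂Measure.volumeIoiPow n with hR
  have key : ∀ F : V → ℝ≥0∞, Measurable F → (∀ (r : ℝ) (v : V), 0 < r → F (r • v) = F v) →
      ∫⁻ v, F v ∂stdGaussian V =
        (∫⁻ v : Metric.sphere (0 : V) 1, F v ∂(volume : Measure V).toSphere) * R := by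
    intro F hF hhom
    rw [lintegral_stdGaussian F hF, ← lintegral_const_mul _ (by fun_prop)]
    have h0 : ∀ f : V → ℝ≥0∞, ∫⁻ v, f v =
        ∫⁻ v : ({0}ᶜ : Set V), f v ∂(volume : Measure V).comap Subtype.val := fun f => by
      rw [lintegral_subtype_comap (measurableSet_singleton _).compl, restrict_compl_singleton]
    rw [h0]
    have hmp := (volume : Measure V).measurePreserving_homeomorphUnitSphereProd
    have h1 := hmp.lintegral_comp (f := fun x : Metric.sphere (0 : V) 1 × Set.Ioi (0 : ℝ) =>
      F x.1 * ENNReal.ofReal (gaussConst V * Real.exp (-(x.2 : ℝ) ^ 2 / 2)))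
      (by fun_prop)
    rw [lintegral_prod_mul (f := fun x : Metric.sphere (0 : V) 1 => F x)
      (g := fun r : Set.Ioi (0 : ℝ) => ENNReal.ofReal (gaussConst V * Real.exp (-(r : ℝ) ^ 2 / 2)))
      (by fun_prop) (by fun_prop)] at h1
    rw [← h1]
    refine lintegral_congr fun v => ?_
    have hv : (v : V) ≠ 0 := v.2
    have h2 : F ((homeomorphUnitSphereProd V v).1 : V) = F v := by
      rw [homeomorphUnitSphereProd_apply_fst_coe, hhom _ _ (by positivity)]
    rw [h2, homeomorphUnitSphereProd_apply_snd_coe, ENNReal.ofReal_mul gaussConst_pos.le]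
    ring
  have h1 := key (fun _ => 1) measurable_const (fun _ _ _ => rfl)
  simp only [lintegral_const, measure_univ, mul_one, one_mul] at h1
  have hRinv : R = ((volume : Measure V).toSphere Set.univ)⁻¹ :=
    ENNReal.eq_inv_of_mul_eq_one_left (by rw [mul_comm, ← h1])
  rw [key F hF hhom, hRinv, ENNReal.div_eq_inv_mul, mul_comm]

end StandardGaussian

/-! ### Kac–Rice for a standard Gaussian vector -/

section KacRiceGaussian

open ProbabilityTheory

variable {ι : Type*} [Fintype ι] {V : Type*} [NormedAddCommGroup V] [InnerProductSpace ℝ V]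
  [FiniteDimensional ℝ V] [MeasurableSpace V] [BorelSpace V]

theorem kacRice_stdGaussian {G : (ι → ℝ) → V →L[ℝ] (ι → ℝ)} (hG : ContDiff ℝ 1 G) {σ : ι → ℝ}
    (hσ : ∀ i, 0 < σ i) {J : (ι → ℝ) →L[ℝ] V} (hJ1 : ∀ c, G 0 (J c) = c)
    (hJ2 : ∀ c v, inner ℝ (J c) v = ∑ i, c i * G 0 v i / σ i)
    (hJ3 : ∀ h c, fderiv ℝ G 0 h (J c) = 0) :
    ∃ δ > 0, ∃ κ : (ι → ℝ) → ℝ≥0∞,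
      Tendsto κ (𝓝 0) (𝓝 (ENNReal.ofReal (∏ i, (√(2 * Real.pi * σ i))⁻¹) *
        ∫⁻ v, ENNReal.ofReal |((fderiv ℝ G 0).flip v).det| ∂stdGaussian V)) ∧
      ∀ D ⊆ Metric.ball 0 δ, MeasurableSet D →
        Measurable (fun v => ({p ∈ D | G p v = 0}.encard : ℝ≥0∞)) →
        ∫⁻ v, ({p ∈ D | G p v = 0}.encard : ℝ≥0∞) ∂stdGaussian V = ∫⁻ p in D, κ p := by
  obtain ⟨δ, hδ, κ, hκ, h⟩ := kacRice hG hσ hJ1 hJ2 hJ3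
  refine ⟨δ, hδ, fun p => ENNReal.ofReal (gaussConst V) * κ p, ?_, ?_⟩
  · have hdet : Measurable fun v : V => ENNReal.ofReal |((fderiv ℝ G 0).flip v).det| := by
      refine ENNReal.measurable_ofReal.comp (Continuous.measurable ?_)
      exact (ContinuousLinearMap.continuous_det.comp (ContinuousLinearMap.continuous _)).abs
    convert ENNReal.Tendsto.const_mul hκ (Or.inr ENNReal.ofReal_ne_top) using 2
    rw [lintegral_stdGaussian _ hdet, mul_left_comm]
    congr 1
    rw [← lintegral_const_mul _ (by fun_prop)]
    refine lintegral_congr fun v => ?_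
    rw [ENNReal.ofReal_mul (by positivity), ENNReal.ofReal_mul (by positivity), mul_assoc]
  · intro D hD hDm hmeas
    rw [lintegral_stdGaussian _ hmeas, h D hD hDm hmeas, lintegral_const_mul' _ _ (by simp)]

end KacRiceGaussian

/-! ### The mean absolute determinant of a Gaussian matrix -/

section GaussianDeterminant

open ProbabilityTheory
open scoped MatrixOrder

variable {ι : Type*}

/-- The square matrix with the entries of a vector indexed by pairs. -/
def toSquare (x : EuclideanSpace ℝ (ι × ι)) : Matrix ι ι ℝ := Matrix.of fun i j => x (i, j)

theorem continuous_toSquare : Continuous (toSquare (ι := ι)) :=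
  continuous_pi fun i => continuous_pi fun j => by
    change Continuous fun x : EuclideanSpace ℝ (ι × ι) => x (i, j)
    fun_prop

variable [Fintype ι]

theorem lintegral_norm_pow_stdGaussian_lt_top (n : ℕ) (c : ℝ) :
    ∫⁻ x, ENNReal.ofReal (c * ‖x‖ ^ n) ∂stdGaussian (EuclideanSpace ℝ (ι × ι)) < ⊤ := by
  have h : Integrable (fun x : EuclideanSpace ℝ (ι × ι) => ‖x‖ ^ n) (stdGaussian _) :=
    (IsGaussian.memLp_id (stdGaussian (EuclideanSpace ℝ (ι × ι))) n (by simp)).integrable_norm_pow'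
  exact (h.const_mul c).lintegral_lt_top

variable [DecidableEq ι]

theorem abs_det_toSquare_le (x : EuclideanSpace ℝ (ι × ι)) :
    |(toSquare x).det| ≤ (Fintype.card ι).factorial * ‖x‖ ^ Fintype.card ι := by
  have := Matrix.det_le (A := toSquare x) (abv := AbsoluteValue.abs) (x := ‖x‖)
    fun i j => by simpa [toSquare] using PiLp.norm_apply_le x (i, j)
  simpa using this

/-- The mean of `|det|` for the centred Gaussian matrix with covariance `C`. -/
noncomputable def gaussAbsDet (C : Matrix (ι × ι) (ι × ι) ℝ) : ℝ≥0∞ :=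
  ∫⁻ x, ENNReal.ofReal |(toSquare x).det| ∂multivariateGaussian 0 C

theorem measurable_abs_det_toSquare :
    Measurable fun x : EuclideanSpace ℝ (ι × ι) => ENNReal.ofReal |(toSquare x).det| :=
  ENNReal.measurable_ofReal.comp (continuous_toSquare.matrix_det.abs).measurable

/-- Writing the Gaussian vector as `√C` applied to a standard one moves the dependence on `C` from
the measure to the integrand. This also covers degenerate covariances, such as those of symmetric
matrices. -/
theorem gaussAbsDet_eq (C : Matrix (ι × ι) (ι × ι) ℝ) :
    gaussAbsDet C = ∫⁻ x, ENNReal.ofReal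
      |(toSquare (Matrix.toEuclideanCLM (𝕜 := ℝ) (CFC.sqrt C) x)).det|
        ∂stdGaussian (EuclideanSpace ℝ (ι × ι)) := by
  rw [gaussAbsDet, multivariateGaussian,
    lintegral_map measurable_abs_det_toSquare (by fun_prop)]
  simp

/-- The square root is continuous on positive semidefinite matrices, so the integrands of
`gaussAbsDet_eq` converge pointwise, dominated by a multiple of `‖x‖ ^ n`. -/
theorem tendsto_gaussAbsDet {α : Type*} {l : Filter α} [l.IsCountablyGenerated]
    {u : α → Matrix (ι × ι) (ι × ι) ℝ} {C : Matrix (ι × ι) (ι × ι) ℝ} (hC : C.PosSemidef)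
    (hu : ∀ᶠ a in l, (u a).PosSemidef) (h : Tendsto u l (𝓝 C)) :
    Tendsto (fun a => gaussAbsDet (u a)) l (𝓝 (gaussAbsDet C)) := by
  have hs : Tendsto (fun a => CFC.sqrt (u a)) l (𝓝 (CFC.sqrt C)) := by
    have hcont : ContinuousOn (CFC.sqrt : Matrix (ι × ι) (ι × ι) ℝ → _) {a | 0 ≤ a} := by
      open scoped Matrix.Norms.L2Operator in
      exact CFC.continuousOn_sqrt
    exact (hcont C hC.nonneg).tendsto.comp
      (tendsto_nhdsWithin_iff.2 ⟨h, hu.mono fun a ha => ha.nonneg⟩)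
  have hlin : Continuous fun A : Matrix (ι × ι) (ι × ι) ℝ => Matrix.toEuclideanCLM (𝕜 := ℝ) A :=
    (Matrix.toEuclideanCLM (n := ι × ι) (𝕜 := ℝ)).toAlgEquiv.toLinearMap.continuous_of_finiteDimensional
  have hT : Tendsto (fun a => Matrix.toEuclideanCLM (𝕜 := ℝ) (CFC.sqrt (u a))) l
      (𝓝 (Matrix.toEuclideanCLM (𝕜 := ℝ) (CFC.sqrt C))) := (hlin.tendsto _).comp hs
  simp only [gaussAbsDet_eq]
  set n := Fintype.card ι
  set B := ‖Matrix.toEuclideanCLM (𝕜 := ℝ) (CFC.sqrt C)‖ + 1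
  have hB : ∀ᶠ a in l, ‖Matrix.toEuclideanCLM (𝕜 := ℝ) (CFC.sqrt (u a))‖ ≤ B :=
    (hT.norm.eventually (gt_mem_nhds (lt_add_one _))).mono fun p hp => le_of_lt hp
  refine tendsto_lintegral_filter_of_dominated_convergence
    (fun x => ENNReal.ofReal ((n.factorial * B ^ n) * ‖x‖ ^ n)) ?_ ?_ ?_ ?_
  · exact Eventually.of_forall fun a => measurable_abs_det_toSquare.comp
      (Matrix.toEuclideanCLM (𝕜 := ℝ) (CFC.sqrt (u a))).continuous.measurable
  · filter_upwards [hB] with a ha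
    refine Eventually.of_forall fun x => ENNReal.ofReal_le_ofReal ?_
    refine (abs_det_toSquare_le _).trans ?_
    rw [mul_assoc, ← mul_pow]
    gcongr
    exact (ContinuousLinearMap.le_opNorm _ _).trans (by gcongr)
  · exact (lintegral_norm_pow_stdGaussian_lt_top _ _).ne
  · refine Eventually.of_forall fun x => ENNReal.tendsto_ofReal ?_
    have h1 : Tendsto (fun a => Matrix.toEuclideanCLM (𝕜 := ℝ) (CFC.sqrt (u a)) x) l
        (𝓝 (Matrix.toEuclideanCLM (𝕜 := ℝ) (CFC.sqrt C) x)) :=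
      ((ContinuousLinearMap.apply ℝ _ x).continuous.tendsto _).comp hT
    exact ((continuous_toSquare.matrix_det.abs).tendsto _).comp h1

theorem gaussAbsDet_lt_top (C : Matrix (ι × ι) (ι × ι) ℝ) : gaussAbsDet C < ⊤ := by
  rw [gaussAbsDet_eq]
  refine lt_of_le_of_lt (lintegral_mono fun x => ?_) (lintegral_norm_pow_stdGaussian_lt_top
    (Fintype.card ι) ((Fintype.card ι).factorial *
      ‖Matrix.toEuclideanCLM (𝕜 := ℝ) (CFC.sqrt C)‖ ^ Fintype.card ι))
  refine ENNReal.ofReal_le_ofReal ((abs_det_toSquare_le _).trans ?_)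
  rw [mul_assoc, ← mul_pow]
  gcongr
  exact ContinuousLinearMap.le_opNorm _ _

/-- The continuous integrand of `gaussAbsDet_eq` is nonzero at `√C y`, because `√C (√C y) = C y`,
hence on an open set, which has positive Gaussian measure. -/
theorem gaussAbsDet_pos {C : Matrix (ι × ι) (ι × ι) ℝ} (hC : C.PosSemidef)
    (y : EuclideanSpace ℝ (ι × ι)) (hy : (toSquare (Matrix.toEuclideanCLM (𝕜 := ℝ) C y)).det ≠ 0) :
    0 < gaussAbsDet C := by
  have hc : Continuous fun x : EuclideanSpace ℝ (ι × ι) =>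
      |(toSquare (Matrix.toEuclideanCLM (𝕜 := ℝ) (CFC.sqrt C) x)).det| :=
    ((continuous_toSquare.comp (ContinuousLinearMap.continuous _)).matrix_det).abs
  have ho : IsOpen (Function.support fun x => ENNReal.ofReal
      |(toSquare (Matrix.toEuclideanCLM (𝕜 := ℝ) (CFC.sqrt C) x)).det|) :=
    (ENNReal.continuous_ofReal.comp hc).isOpen_support
  rw [gaussAbsDet_eq, lintegral_pos_iff_support (by exact (ENNReal.continuous_ofReal.comp hc).measurable)]
  refine ho.measure_pos _ ⟨Matrix.toEuclideanCLM (𝕜 := ℝ) (CFC.sqrt C) y, ?_⟩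
  rw [Function.mem_support, ← ContinuousLinearMap.comp_apply, ← ContinuousLinearMap.mul_def,
    ← map_mul, CFC.sqrt_mul_sqrt_self _ hC.nonneg]
  simpa using hy

/-- The covariance matrix of `∑ n, ξ n • a n` for a standard Gaussian vector `ξ`. -/
def covMatrix {N τ : Type*} [Fintype N] (a : N → τ → ℝ) : Matrix τ τ ℝ :=
  Matrix.of fun s t => ∑ n, a n s * a n t

theorem covMatrix_posSemidef {N τ : Type*} [Fintype N] [Fintype τ] (a : N → τ → ℝ) :
    (covMatrix a).PosSemidef := by
  have : covMatrix a = (Matrix.of a).conjTranspose * Matrix.of a := by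
    ext s t
    simp [covMatrix, Matrix.mul_apply]
  rw [this]
  exact Matrix.posSemidef_conjTranspose_mul_self _

/-- Characteristic functions agree: pairing with `t` amounts to pairing `ξ` with a vector whose
squared norm is the quadratic form of `covMatrix a` at `t`. -/
theorem map_stdGaussian_eq_multivariateGaussian {N τ : Type*} [Fintype N] [Fintype τ]
    [DecidableEq τ] (a : N → τ → ℝ) :
    (stdGaussian (EuclideanSpace ℝ N)).map
      (fun ξ => (WithLp.toLp 2 fun s => ∑ n, ξ n * a n s : EuclideanSpace ℝ τ)) =
      multivariateGaussian 0 (covMatrix a) := by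
  have hm : Measurable fun ξ : EuclideanSpace ℝ N =>
      (WithLp.toLp 2 fun s => ∑ n, ξ n * a n s : EuclideanSpace ℝ τ) := by fun_prop
  have : IsProbabilityMeasure ((stdGaussian (EuclideanSpace ℝ N)).map
      (fun ξ => (WithLp.toLp 2 fun s => ∑ n, ξ n * a n s : EuclideanSpace ℝ τ))) :=
    Measure.isProbabilityMeasure_map hm.aemeasurable
  apply Measure.ext_of_charFun
  ext t
  rw [charFun_multivariateGaussian (covMatrix_posSemidef a), charFun_apply,
    integral_map hm.aemeasurable (by fun_prop)]
  have h1 : ∀ ξ : EuclideanSpace ℝ N,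
      inner ℝ (WithLp.toLp 2 fun s => ∑ n, ξ n * a n s : EuclideanSpace ℝ τ) t =
        inner ℝ ξ (WithLp.toLp 2 fun n => ∑ s, a n s * t s : EuclideanSpace ℝ N) := by
    intro ξ
    simp only [PiLp.inner_apply, RCLike.inner_apply, conj_trivial, Finset.sum_mul, Finset.mul_sum]
    rw [Finset.sum_comm]
    refine Finset.sum_congr rfl fun n _ => Finset.sum_congr rfl fun s _ => ?_
    ring
  simp_rw [h1]
  rw [← charFun_apply, charFun_stdGaussian]
  congr 1
  simp only [inner_zero_right, Complex.ofReal_zero, zero_mul, zero_sub, neg_div]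
  congr 2
  rw [← Complex.ofReal_pow]
  congr 1
  rw [EuclideanSpace.real_norm_sq_eq]
  simp only [covMatrix, dotProduct, Matrix.mulVec, Matrix.of_apply, sq, Finset.sum_mul,
    Finset.mul_sum]
  rw [Finset.sum_comm]
  refine Finset.sum_congr rfl fun s _ => ?_
  rw [Finset.sum_comm]
  refine Finset.sum_congr rfl fun n _ => Finset.sum_congr rfl fun s _ => ?_
  ring

end GaussianDeterminant

open ProbabilityTheory

/-! ### Coordinates in an orthonormal basis -/

section Mean

theorem mean_toSphere_eq {W : Type*} [NormedAddCommGroup W] [InnerProductSpace ℝ W]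
    (V : Submodule ℝ W) [FiniteDimensional ℝ V] [MeasurableSpace V] [BorelSpace V]
    {N : Type*} [Fintype N] [Nonempty N] {e : N → W} (he : Orthonormal ℝ e)
    (hspan : Submodule.span ℝ (Set.range e) = V) {F : W → ℝ≥0∞}
    (hF : Measurable fun ξ : EuclideanSpace ℝ N => F (∑ n, ξ n • e n))
    (hhom : ∀ (r : ℝ) (w : W), 0 < r → F (r • w) = F w) :
    (∫⁻ v : Metric.sphere (0 : V) 1, F (v : V).1 ∂(volume : Measure V).toSphere) /
      (volume : Measure V).toSphere Set.univ =
      ∫⁻ ξ, F (∑ n, ξ n • e n) ∂stdGaussian (EuclideanSpace ℝ N) := by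
  classical
  have hmem : ∀ n, e n ∈ V := fun n => hspan ▸ Submodule.subset_span (Set.mem_range_self n)
  set e' : N → V := fun n => ⟨e n, hmem n⟩ with he'
  have ho : Orthonormal ℝ e' := by
    rw [orthonormal_iff_ite] at he ⊢
    exact he
  have hs : ⊤ ≤ Submodule.span ℝ (Set.range e') := by
    rw [top_le_iff]
    apply Submodule.map_injective_of_injective V.injective_subtype
    rw [Submodule.map_span, ← Set.range_comp, Submodule.map_top, Submodule.range_subtype]
    exact hspan
  set b := OrthonormalBasis.mk ho hs with hb
  have hbe : ∀ ξ : EuclideanSpace ℝ N, ((b.repr.symm ξ : V) : W) = ∑ n, ξ n • e n := by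
    intro ξ
    rw [← b.sum_repr_symm ξ]
    simp [hb, he']
  have : Nontrivial V := by
    obtain ⟨n⟩ := ‹Nonempty N›
    exact ⟨e' n, 0, ho.ne_zero n⟩
  have hF' : Measurable fun v : V => F v := by
    have h1 : (fun v : V => F v) = (fun ξ : EuclideanSpace ℝ N => F (∑ n, ξ n • e n)) ∘ b.repr := by
      ext v
      simp only [Function.comp_apply, ← hbe, LinearIsometryEquiv.symm_apply_apply]
    rw [h1]
    exact hF.comp b.repr.continuous.measurable
  rw [lintegral_toSphere_div hF' fun r v hr => hhom r v hr]
  rw [← stdGaussian_map b.repr.symm, lintegral_map hF' b.repr.symm.continuous.measurable]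
  simp only [hbe]

end Mean

/-! ### Critical points on manifolds and in charts -/

section Manifold

variable {E : Type*} [NormedAddCommGroup E] [NormedSpace ℝ E]
  {H : Type*} [TopologicalSpace H] {I : ModelWithCorners ℝ E H}
  {M : Type*} [TopologicalSpace M] [ChartedSpace H M]

/-- Evaluation at a point, as a linear form on smooth functions. -/
noncomputable def evalLin (p : M) : Smooth I M →ₗ[ℝ] ℝ where
  toFun f := f p
  map_add' _ _ := rfl
  map_smul' _ _ := rfl

theorem sum_smooth_apply {N : Type*} (s : Finset N) (f : N → Smooth I M) (p : M) :
    (∑ n ∈ s, f n) p = ∑ n ∈ s, f n p :=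
  map_sum (evalLin p) f s

theorem critSet_smul {r : ℝ} (hr : 0 < r) (f : Smooth I M) : critSet (r • f) = critSet f := by
  ext q
  have h : ∀ (r : ℝ) (f : Smooth I M), q ∈ critSet f → q ∈ critSet (r • f) := by
    intro r f hf
    have hd : MDifferentiableAt I 𝓘(ℝ, ℝ) f q := f.contMDiff.mdifferentiable (by simp) q
    change mfderiv I 𝓘(ℝ, ℝ) (r • (f : M → ℝ)) q = 0
    have hf' : mfderiv I 𝓘(ℝ, ℝ) f q = 0 := hf
    rw [const_smul_mfderiv hd r, hf']
    exact smul_zero r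
  refine ⟨fun hq => ?_, h r f⟩
  have := h r⁻¹ _ hq
  rwa [smul_smul, inv_mul_cancel₀ hr.ne', one_smul] at this

/-- Precomposition with a diffeomorphism. -/
noncomputable def pullback (g : M ≃ₘ^∞⟮I, I⟯ M) (f : Smooth I M) : Smooth I M :=
  ⟨f ∘ g, f.contMDiff.comp g.contMDiff⟩

theorem mem_critSet_pullback (g : M ≃ₘ^∞⟮I, I⟯ M) (f : Smooth I M) (p : M) :
    p ∈ critSet (pullback g f) ↔ g p ∈ critSet f := by
  have h : ∀ (g : M ≃ₘ^∞⟮I, I⟯ M) (f : Smooth I M) (p : M),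
      g p ∈ critSet f → p ∈ critSet (pullback g f) := by
    intro g f p hp
    change mfderiv I 𝓘(ℝ, ℝ) (f ∘ g) p = 0
    rw [mfderiv_comp p (I' := I) (f.contMDiff.mdifferentiable (by simp) _)
      (g.mdifferentiable (by simp) p)]
    have hp' : mfderiv I 𝓘(ℝ, ℝ) f (g p) = 0 := hp
    rw [hp']
    exact ContinuousLinearMap.zero_comp _
  refine ⟨fun hp => ?_, h g f p⟩
  have h1 : pullback g.symm (pullback g f) = f := by
    ext x
    simp [pullback]
  have := h g.symm (pullback g f) (g p) (by simpa using hp)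
  rwa [h1] at this

variable [IsManifold I ∞ M]

theorem contDiffOn_comp_extChartAt_symm (f : Smooth I M) (p : M) :
    ContDiffOn ℝ ∞ (f ∘ (extChartAt I p).symm) (extChartAt I p).target :=
  contMDiffOn_iff_contDiffOn.1
    (f.contMDiff.comp_contMDiffOn (contMDiffOn_extChartAt_symm p))

variable [I.Boundaryless]

/-- Being a critical point can be checked in any chart. -/
theorem mem_critSet_iff_fderiv (f : Smooth I M) {p q : M} (hq : q ∈ (extChartAt I p).source) :
    q ∈ critSet f ↔ fderiv ℝ (f ∘ (extChartAt I p).symm) (extChartAt I p q) = 0 := by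
  have : IsManifold I 1 M := IsManifold.of_le (n := ∞) (by simp)
  have hq' : extChartAt I p q ∈ (extChartAt I p).target := (extChartAt I p).map_source hq
  have hd : DifferentiableAt ℝ (f ∘ (extChartAt I p).symm) (extChartAt I p q) :=
    ((contDiffOn_comp_extChartAt_symm f p).contDiffAt
      ((isOpen_extChartAt_target p).mem_nhds hq')).differentiableAt (by simp)
  have heq : f =ᶠ[𝓝 q] (f ∘ (extChartAt I p).symm) ∘ extChartAt I p := by
    filter_upwards [(isOpen_extChartAt_source p).mem_nhds hq] with x hx
    simp only [Function.comp_apply, (extChartAt I p).left_inv hx]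
  have hchain : mfderiv I 𝓘(ℝ, ℝ) f q =
      (fderiv ℝ (f ∘ (extChartAt I p).symm) (extChartAt I p q)).comp
        (mfderiv I 𝓘(ℝ, E) (extChartAt I p) q) := by
    rw [heq.mfderiv_eq, mfderiv_comp q (I' := 𝓘(ℝ, E)) hd.mdifferentiableAt
      (mdifferentiableAt_extChartAt (by simpa using hq)), mfderiv_eq_fderiv]
    rfl
  change mfderiv I 𝓘(ℝ, ℝ) f q = 0 ↔ _
  rw [hchain]
  constructor
  · intro h
    ext v
    obtain ⟨w, hw⟩ := (isInvertible_mfderiv_extChartAt hq).surjective v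
    have h1 : fderiv ℝ (f ∘ (extChartAt I p).symm) (extChartAt I p q)
        (mfderiv I 𝓘(ℝ, E) (extChartAt I p) q w) = 0 := DFunLike.congr_fun h w
    rw [hw] at h1
    exact h1
  · intro h
    rw [h]
    exact ContinuousLinearMap.zero_comp _

/-- In a chart the differential is linear in `ξ` and continuous in the pair, so being noncritical is
an open condition. Closedness is what `measurable_encard_fiber` needs. -/
theorem isClosed_setOf_mem_critSet {N : Type*} [Fintype N] (e : N → Smooth I M) :
    IsClosed {x : EuclideanSpace ℝ N × M | x.2 ∈ critSet (∑ n, x.1 n • e n)} := by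
  rw [← isOpen_compl_iff, isOpen_iff_mem_nhds]
  rintro ⟨ξ₀, q₀⟩ h₀
  set φ := extChartAt I q₀ with hφ
  set Φ : EuclideanSpace ℝ N × M → E →L[ℝ] ℝ := fun x =>
    ∑ n, x.1 n • fderiv ℝ (e n ∘ φ.symm) (φ x.2) with hΦ
  have hcrit : ∀ x : EuclideanSpace ℝ N × M, x.2 ∈ φ.source →
      (x.2 ∈ critSet (∑ n, x.1 n • e n) ↔ Φ x = 0) := by
    intro x hx
    rw [mem_critSet_iff_fderiv _ hx]
    have h1 : ((∑ n, x.1 n • e n : Smooth I M) : M → ℝ) ∘ φ.symm =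
        fun y => ∑ n, x.1 n • (e n ∘ φ.symm) y := by
      ext y
      simp [sum_smooth_apply]
    have hy : φ x.2 ∈ φ.target := φ.map_source hx
    rw [h1, fderiv_fun_sum]
    · rw [hΦ]
      simp only
      rw [Finset.sum_congr rfl fun n _ => ?_]
      refine fderiv_const_smul (f := e n ∘ φ.symm) ?_ (x.1 n)
      exact ((contDiffOn_comp_extChartAt_symm (e n) q₀).contDiffAt
        ((isOpen_extChartAt_target q₀).mem_nhds hy)).differentiableAt (by simp)
    · intro n _
      exact (((contDiffOn_comp_extChartAt_symm (e n) q₀).contDiffAt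
        ((isOpen_extChartAt_target q₀).mem_nhds hy)).differentiableAt (by simp)).fun_const_smul _
  have hcont : ContinuousAt Φ (ξ₀, q₀) := by
    refine tendsto_finsetSum _ fun n _ => ?_
    refine ContinuousAt.smul (f := fun x : EuclideanSpace ℝ N × M => x.1 n) (by fun_prop) ?_
    have hn : ContinuousAt (fderiv ℝ (e n ∘ φ.symm)) (φ q₀) :=
      ((contDiffOn_comp_extChartAt_symm (e n) q₀).continuousOn_fderiv_of_isOpen
        (isOpen_extChartAt_target q₀) (by simp)).continuousAt
        (extChartAt_target_mem_nhds q₀)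
    exact ContinuousAt.comp (f := fun x : EuclideanSpace ℝ N × M => φ x.2) hn
      (ContinuousAt.comp (g := φ) (continuousAt_extChartAt (I := I) q₀) continuousAt_snd)
  have h0 : Φ (ξ₀, q₀) ≠ 0 := fun h => h₀ ((hcrit (ξ₀, q₀) (mem_extChartAt_source q₀)).2 h)
  have hsrc : ∀ᶠ x in 𝓝 (ξ₀, q₀), x.2 ∈ φ.source :=
    continuousAt_snd.eventually (extChartAt_source_mem_nhds q₀)
  filter_upwards [hsrc, hcont.eventually_ne h0] with x hx hx0 hx1
  exact hx0 ((hcrit x hx).1 hx1)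

end Manifold

open ProbabilityTheory

/-! ### Homogeneous families of functions -/

section Homogeneous

variable {E : Type*} [NormedAddCommGroup E] [NormedSpace ℝ E]
  {H : Type*} [TopologicalSpace H] {I : ModelWithCorners ℝ E H}
  {M : Type*} [MetricSpace M] [ChartedSpace H M] {N : Type*}

section

variable [CompactSpace M] [MeasurableSpace M] [BorelSpace M]
  {vol : Measure M} [IsFiniteMeasure vol] [vol.IsOpenPosMeasure]

theorem orthonormal_l2 [DecidableEq N] {e : N → Smooth I M}
    (he : ∀ m n, ∫ p, e m p * e n p ∂vol = if m = n then 1 else 0) :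
    letI := l2Norm (I := I) vol
    letI := l2Inner (I := I) vol
    Orthonormal ℝ e := by
  let _ := l2Norm (I := I) vol
  let _ := l2Inner (I := I) vol
  rw [orthonormal_iff_ite]
  exact he

end

variable [Fintype N]

/-- The mean number of critical points in `B` of `∑ n, ξ n • e n` for a standard Gaussian
vector `ξ`. -/
noncomputable def meanCrit (e : N → Smooth I M) (B : Set M) : ℝ≥0∞ :=
  ∫⁻ ξ, ((critSet (∑ n, ξ n • e n) ∩ B).encard : ℝ≥0∞) ∂stdGaussian (EuclideanSpace ℝ N)

section

variable [I.Boundaryless] [IsManifold I ∞ M] [CompactSpace M]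

theorem measurable_encard_critSet_inter (e : N → Smooth I M) {B : Set M} (hB : IsClosed B) :
    Measurable fun ξ : EuclideanSpace ℝ N =>
      ((critSet (∑ n, ξ n • e n) ∩ B).encard : ℝ≥0∞) :=
  measurable_encard_fiber
    ((isClosed_setOf_mem_critSet e).inter (hB.preimage continuous_snd))

theorem measurable_encard_critSet_inter_closedBall [MeasurableSpace M] [OpensMeasurableSpace M]
    (e : N → Smooth I M) (r : ℝ) :
    Measurable fun x : EuclideanSpace ℝ N × M =>
      ((critSet (∑ n, x.1 n • e n) ∩ Metric.closedBall x.2 r).encard : ℝ≥0∞) := by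
  have : IsClosed {x : (EuclideanSpace ℝ N × M) × M |
      x.2 ∈ critSet (∑ n, x.1.1 n • e n) ∧ x.2 ∈ Metric.closedBall x.1.2 r} := by
    refine IsClosed.inter ((isClosed_setOf_mem_critSet e).preimage
      (f := fun x : (EuclideanSpace ℝ N × M) × M => (x.1.1, x.2)) (by fun_prop)) ?_
    exact isClosed_le (by fun_prop) continuous_const
  exact measurable_encard_fiber this

end

variable [CompactSpace M] [MeasurableSpace M] [BorelSpace M]
  {vol : Measure M} [IsFiniteMeasure vol] [vol.IsOpenPosMeasure]

theorem expectedCrit_eq_meanCrit [I.Boundaryless] [IsManifold I ∞ M] [DecidableEq N] [Nonempty N]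
    {e : N → Smooth I M}
    (he : ∀ m n, ∫ p, e m p * e n p ∂vol = if m = n then 1 else 0)
    (V : Submodule ℝ (Smooth I M)) [FiniteDimensional ℝ V]
    (hspan : Submodule.span ℝ (Set.range e) = V) :
    expectedCrit vol V = meanCrit e Set.univ := by
  let _ := l2Norm (I := I) vol
  let _ := l2Inner (I := I) vol
  let _ : MeasurableSpace V := borel V
  have : BorelSpace V := ⟨rfl⟩
  have h := mean_toSphere_eq V (orthonormal_l2 he) hspan
    (F := fun f => ((critSet f).encard : ℝ≥0∞))
    (by simpa using measurable_encard_critSet_inter e isClosed_univ)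
    (fun r f hr => by rw [critSet_smul hr])
  simp only [meanCrit, Set.inter_univ]
  exact h

/-- Pullback by a volume-preserving diffeomorphism keeps the `L²` norm, so on coefficients it acts
as a linear isometry, under which the standard Gaussian measure is invariant. -/
theorem exists_isometry_pullback [DecidableEq N] {e : N → Smooth I M}
    (he : ∀ m n, ∫ p, e m p * e n p ∂vol = if m = n then 1 else 0)
    (g : M ≃ₘ^∞⟮I, I⟯ M) (hg : MeasurePreserving g vol vol)
    (hV : ∀ n, pullback g (e n) ∈ Submodule.span ℝ (Set.range e)) :
    ∃ T : EuclideanSpace ℝ N ≃ₗᵢ[ℝ] EuclideanSpace ℝ N, ∀ ξ : EuclideanSpace ℝ N,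
      pullback g (∑ n, ξ n • e n) = ∑ n, T ξ n • e n := by
  let _ := l2Norm (I := I) vol
  let _ := l2Inner (I := I) vol
  have ho : Orthonormal ℝ e := orthonormal_l2 he
  have hlin : ∀ ξ : EuclideanSpace ℝ N,
      pullback g (∑ n, ξ n • e n) = ∑ n, ξ n • pullback g (e n) := by
    intro ξ
    ext p
    change (∑ n, ξ n • e n) (g p) = _
    rw [sum_smooth_apply, sum_smooth_apply]
    rfl
  have hrep : ∀ f ∈ Submodule.span ℝ (Set.range e), f = ∑ m, inner ℝ (e m) f • e m := by
    intro f hf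
    obtain ⟨c, rfl⟩ := (Submodule.mem_span_range_iff_exists_fun ℝ).1 hf
    simp only [ho.inner_right_fintype]
  set T₀ : EuclideanSpace ℝ N →ₗ[ℝ] EuclideanSpace ℝ N :=
    { toFun := fun ξ => WithLp.toLp 2 fun m => inner ℝ (e m) (∑ n, ξ n • pullback g (e n))
      map_add' := fun ξ η => by
        ext m
        simp [add_smul, Finset.sum_add_distrib, inner_add_right]
      map_smul' := fun c ξ => by
        ext m
        simp [mul_smul, ← Finset.smul_sum, inner_smul_right] } with hT₀
  have hT : ∀ ξ : EuclideanSpace ℝ N, pullback g (∑ n, ξ n • e n) = ∑ n, T₀ ξ n • e n := by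
    intro ξ
    have hm : ∑ n, ξ n • pullback g (e n) ∈ Submodule.span ℝ (Set.range e) :=
      Submodule.sum_mem _ fun n _ => Submodule.smul_mem _ _ (hV n)
    rw [hlin]
    exact hrep _ hm
  have hnorm : ∀ ξ : EuclideanSpace ℝ N, ‖ξ‖ ^ 2 = ‖∑ n, ξ n • e n‖ ^ 2 := by
    intro ξ
    rw [← real_inner_self_eq_norm_sq (∑ n, ξ n • e n), ho.inner_sum, EuclideanSpace.real_norm_sq_eq]
    simp [sq]
  have hpn : ∀ f : Smooth I M, ‖pullback g f‖ ^ 2 = ‖f‖ ^ 2 := by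
    intro f
    rw [← real_inner_self_eq_norm_sq, ← real_inner_self_eq_norm_sq]
    change ∫ p, f (g p) * f (g p) ∂vol = ∫ p, f p * f p ∂vol
    exact hg.integral_comp g.toHomeomorph.measurableEmbedding (fun p => f p * f p)
  have hTn : ∀ ξ, ‖T₀ ξ‖ = ‖ξ‖ := by
    intro ξ
    rw [← sq_eq_sq₀ (norm_nonneg _) (norm_nonneg _), hnorm, ← hT, hpn, ← hnorm]
  exact ⟨LinearIsometry.toLinearIsometryEquiv ⟨T₀, hTn⟩ rfl, hT⟩

theorem meanCrit_preimage [DecidableEq N] {e : N → Smooth I M}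
    (he : ∀ m n, ∫ p, e m p * e n p ∂vol = if m = n then 1 else 0)
    (g : M ≃ₘ^∞⟮I, I⟯ M) (hg : MeasurePreserving g vol vol)
    (hV : ∀ n, pullback g (e n) ∈ Submodule.span ℝ (Set.range e)) (B : Set M) :
    meanCrit e (g ⁻¹' B) = meanCrit e B := by
  obtain ⟨T, hT⟩ := exists_isometry_pullback he g hg hV
  have hmp : MeasurePreserving T (stdGaussian (EuclideanSpace ℝ N)) (stdGaussian _) :=
    ⟨T.continuous.measurable, stdGaussian_map T⟩
  unfold meanCrit
  rw [← hmp.lintegral_comp_emb T.toHomeomorph.measurableEmbedding]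
  refine lintegral_congr fun ξ => ?_
  rw [← hT]
  have : critSet (pullback g (∑ n, ξ n • e n)) ∩ g ⁻¹' B = g ⁻¹' (critSet (∑ n, ξ n • e n) ∩ B) := by
    ext p
    simp only [Set.mem_inter_iff, mem_critSet_pullback, Set.mem_preimage]
  rw [this, Set.encard_preimage_of_bijective (f := g) g.toEquiv.bijective]

/-- For a homogeneous family the mean number of critical points in a ball is proportional to the
volume of the ball. -/
theorem meanCrit_univ_mul [I.Boundaryless] [IsManifold I ∞ M] [DecidableEq N] {e : N → Smooth I M}
    (he : ∀ m n, ∫ p, e m p * e n p ∂vol = if m = n then 1 else 0) (p₀ : M)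
    (hom : ∀ p, ∃ g : M ≃ₘ^∞⟮I, I⟯ M, g p₀ = p ∧ Isometry g ∧ MeasurePreserving g vol vol ∧
      ∀ n, pullback g (e n) ∈ Submodule.span ℝ (Set.range e)) {r : ℝ} (hr : 0 < r) :
    meanCrit e Set.univ * vol (Metric.closedBall p₀ r) =
      vol Set.univ * meanCrit e (Metric.closedBall p₀ r) := by
  have hpre : ∀ (g : M ≃ₘ^∞⟮I, I⟯ M), Isometry g → g ⁻¹' Metric.closedBall (g p₀) r =
      Metric.closedBall p₀ r := fun g hg => hg.preimage_closedBall p₀ r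
  have h1 : ∀ p, meanCrit e (Metric.closedBall p r) = meanCrit e (Metric.closedBall p₀ r) := by
    intro p
    obtain ⟨g, rfl, hi, hm, hV⟩ := hom p
    rw [← meanCrit_preimage he g hm hV, hpre g hi]
  have h2 : ∀ p, vol (Metric.closedBall p r) = vol (Metric.closedBall p₀ r) := by
    intro p
    obtain ⟨g, rfl, hi, hm, hV⟩ := hom p
    rw [← hm.measure_preimage Metric.isClosed_closedBall.nullMeasurableSet, hpre g hi]
  -- Fubini: a point `q` of `S` is counted exactly for the centres in the ball of radius `r` about
  -- `q`, and all these balls have the same volume. For infinite `S`, finite subsets give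
  -- arbitrarily large lower bounds, as that volume is positive.
  have hcount : ∀ S : Set M, ∫⁻ p, ((S ∩ Metric.closedBall p r).encard : ℝ≥0∞) ∂vol =
      (S.encard : ℝ≥0∞) * vol (Metric.closedBall p₀ r) := by
    have hfin : ∀ F : Finset M, ∫⁻ p, (((F : Set M) ∩ Metric.closedBall p r).encard : ℝ≥0∞) ∂vol =
        (F.card : ℝ≥0∞) * vol (Metric.closedBall p₀ r) := by
      intro F
      have hF : ∀ p, (((F : Set M) ∩ Metric.closedBall p r).encard : ℝ≥0∞) =
          ∑ q ∈ F, (Metric.closedBall q r).indicator 1 p := by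
        classical
        intro p
        have : (F : Set M) ∩ Metric.closedBall p r = ↑(F.filter fun q => q ∈ Metric.closedBall p r) := by
          ext q
          simp
        rw [this, Set.encard_coe_eq_coe_finsetCard, ENat.toENNReal_coe, Finset.card_filter,
          Nat.cast_sum]
        refine Finset.sum_congr rfl fun q _ => ?_
        simp [Set.indicator_apply, Metric.mem_closedBall, dist_comm]
      simp_rw [hF]
      rw [lintegral_finsetSum _ fun q _ =>
        measurable_one.indicator Metric.isClosed_closedBall.measurableSet]
      simp [lintegral_indicator_one Metric.isClosed_closedBall.measurableSet, h2]
    intro S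
    by_cases hS : S.Finite
    · have := hfin hS.toFinset
      simpa [hS.encard_eq_coe_toFinset_card] using this
    · have hv : vol (Metric.closedBall p₀ r) ≠ 0 :=
        (Metric.measure_closedBall_pos vol p₀ hr).ne'
      rw [Set.Infinite.encard_eq hS, ENat.toENNReal_top, ENNReal.top_mul hv, eq_top_iff]
      have hle : ∀ n : ℕ, (n : ℝ≥0∞) * vol (Metric.closedBall p₀ r) ≤
          ∫⁻ p, ((S ∩ Metric.closedBall p r).encard : ℝ≥0∞) ∂vol := by
        intro n
        obtain ⟨F, hFS, hFn⟩ := Set.Infinite.exists_subset_card_eq hS n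
        rw [← hFn, ← hfin F]
        refine lintegral_mono fun p => ?_
        exact ENat.toENNReal_le.2 (Set.encard_mono (Set.inter_subset_inter_left _ hFS))
      refine le_of_tendsto' (x := atTop) (f := fun n : ℕ => (n : ℝ≥0∞) *
        vol (Metric.closedBall p₀ r)) ?_ hle
      have := ENNReal.Tendsto.mul_const (b := vol (Metric.closedBall p₀ r))
        ENNReal.tendsto_nat_nhds_top (Or.inl ENNReal.top_ne_zero)
      rwa [ENNReal.top_mul hv] at this
  calc meanCrit e Set.univ * vol (Metric.closedBall p₀ r)
      = ∫⁻ ξ, ∫⁻ p, ((critSet (∑ n, ξ n • e n) ∩ Metric.closedBall p r).encard : ℝ≥0∞) ∂vol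
          ∂stdGaussian (EuclideanSpace ℝ N) := by
        simp_rw [hcount]
        rw [lintegral_mul_const _ (by simpa using measurable_encard_critSet_inter e isClosed_univ)]
        simp [meanCrit]
    _ = ∫⁻ p, meanCrit e (Metric.closedBall p r) ∂vol :=
        lintegral_lintegral_swap (measurable_encard_critSet_inter_closedBall e r).aemeasurable
    _ = vol Set.univ * meanCrit e (Metric.closedBall p₀ r) := by
        simp_rw [h1]
        rw [lintegral_const, mul_comm]

end Homogeneous

open ProbabilityTheory

/-! ### Kac–Rice for critical points of Gaussian combinations -/

section LinearFamily

variable {ι N : Type*} [Fintype ι] [Fintype N] [DecidableEq ι]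

/-- The partial derivatives of a function on `ι → ℝ`. -/
noncomputable def grad (f : (ι → ℝ) → ℝ) (a : ι → ℝ) : ι → ℝ := fun i => fderiv ℝ f a (Pi.single i 1)

/-- The matrix of second partial derivatives at the origin, as a vector indexed by pairs. -/
noncomputable def hessVec (f : (ι → ℝ) → ℝ) : ι × ι → ℝ := fun s =>
  fderiv ℝ (fderiv ℝ f) 0 (Pi.single s.2 1) (Pi.single s.1 1)

theorem contDiff_grad {f : (ι → ℝ) → ℝ} (hf : ContDiff ℝ ∞ f) : ContDiff ℝ 1 (grad f) := by
  refine contDiff_pi.2 fun i => ?_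
  exact ContDiff.clm_apply (hf.fderiv_right (m := 1) (by norm_cast)) contDiff_const

theorem fderiv_grad_apply {f : (ι → ℝ) → ℝ} (hf : ContDiff ℝ ∞ f) (h : ι → ℝ) (i : ι) :
    fderiv ℝ (grad f) 0 h i = fderiv ℝ (fderiv ℝ f) 0 h (Pi.single i 1) := by
  have hd : DifferentiableAt ℝ (fderiv ℝ f) 0 :=
    (hf.fderiv_right (m := 1) (by norm_cast)).differentiable one_ne_zero 0
  have h1 : HasFDerivAt (grad f)
      (ContinuousLinearMap.pi fun i => (ContinuousLinearMap.apply ℝ ℝ (Pi.single i 1 : ι → ℝ)).comp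
        (fderiv ℝ (fderiv ℝ f) 0)) 0 :=
    hasFDerivAt_pi.2 fun i =>
      (ContinuousLinearMap.apply ℝ ℝ (Pi.single i 1 : ι → ℝ)).hasFDerivAt.comp 0 hd.hasFDerivAt
  rw [h1.fderiv]
  rfl

theorem eq_zero_iff_forall_single {T : (ι → ℝ) →L[ℝ] ℝ} :
    T = 0 ↔ (fun i => T (Pi.single i 1)) = 0 := by
  constructor
  · rintro rfl
    rfl
  · intro h
    refine ContinuousLinearMap.coe_injective (LinearMap.pi_ext' fun i => ?_)
    ext
    simpa using congrFun h i

/-- A Kac–Rice formula for the critical points near the origin of a Gaussian combination of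
functions on `ι → ℝ`. -/
theorem kacRice_critical {f : N → (ι → ℝ) → ℝ} (hf : ∀ n, ContDiff ℝ ∞ (f n)) {σ : ι → ℝ}
    (hσ : ∀ i, 0 < σ i)
    (hB : ∀ i j, ∑ n, grad (f n) 0 i * grad (f n) 0 j = if i = j then σ i else 0)
    (hBC : ∀ i s, ∑ n, grad (f n) 0 i * hessVec (f n) s = 0) :
    ∃ δ > 0, ∃ κ : (ι → ℝ) → ℝ≥0∞,
      Tendsto κ (𝓝 0) (𝓝 (ENNReal.ofReal (∏ i, (√(2 * Real.pi * σ i))⁻¹) *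
        gaussAbsDet (covMatrix fun n => hessVec (f n)))) ∧
      ∀ D ⊆ Metric.ball 0 δ, MeasurableSet D →
        Measurable (fun ξ : EuclideanSpace ℝ N =>
          ({p ∈ D | fderiv ℝ (fun a => ∑ n, ξ n * f n a) p = 0}.encard : ℝ≥0∞)) →
        ∫⁻ ξ : EuclideanSpace ℝ N,
          ({p ∈ D | fderiv ℝ (fun a => ∑ n, ξ n * f n a) p = 0}.encard : ℝ≥0∞)
            ∂stdGaussian (EuclideanSpace ℝ N) = ∫⁻ p in D, κ p := by
  set G : (ι → ℝ) → EuclideanSpace ℝ N →L[ℝ] (ι → ℝ) := fun a =>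
    ∑ n, (EuclideanSpace.proj (𝕜 := ℝ) n : EuclideanSpace ℝ N →L[ℝ] ℝ).smulRight (grad (f n) a)
    with hG
  have hGapp : ∀ a ξ, G a ξ = ∑ n, ξ n • grad (f n) a := by
    intro a ξ
    simp [hG]
  have hGc : ContDiff ℝ 1 G := by
    refine ContDiff.sum fun n _ => ?_
    exact (ContinuousLinearMap.smulRightL ℝ (EuclideanSpace ℝ N) (ι → ℝ)
      (EuclideanSpace.proj (𝕜 := ℝ) n)).contDiff.comp (contDiff_grad (hf n))
  have hGd : ∀ h ξ i, fderiv ℝ G 0 h ξ i =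
      ∑ n, ξ n * fderiv ℝ (fderiv ℝ (f n)) 0 h (Pi.single i 1) := by
    intro h ξ i
    have h1 : HasFDerivAt (fun a => G a ξ) (fderiv ℝ G 0 |>.flip ξ) 0 :=
      (ContinuousLinearMap.apply ℝ (ι → ℝ) ξ).hasFDerivAt.comp 0
        (hGc.differentiable one_ne_zero 0).hasFDerivAt
    have h2 : HasFDerivAt (fun a => G a ξ) (∑ n, ξ n • fderiv ℝ (grad (f n)) 0) 0 := by
      simp_rw [hGapp]
      refine HasFDerivAt.fun_sum fun n _ => HasFDerivAt.fun_const_smul ?_ _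
      exact ((contDiff_grad (hf n)).differentiable one_ne_zero 0).hasFDerivAt
    have h3 := congrArg (fun T : (ι → ℝ) →L[ℝ] (ι → ℝ) => T h i) (h1.unique h2)
    simp only [ContinuousLinearMap.flip_apply] at h3
    rw [h3]
    simp [fderiv_grad_apply (hf _)]
  have hGzero : ∀ a (ξ : EuclideanSpace ℝ N),
      fderiv ℝ (fun a => ∑ n, ξ n * f n a) a = 0 ↔ G a ξ = 0 := by
    intro a ξ
    have hd : ∀ n, DifferentiableAt ℝ (f n) a := fun n => (hf n).differentiable (by simp) a
    rw [eq_zero_iff_forall_single, hGapp, fderiv_fun_sum fun n _ => (hd n).const_mul _]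
    have : (fun i => (∑ n, fderiv ℝ (fun a => ξ n * f n a) a) (Pi.single i 1)) =
        ∑ n, ξ n • grad (f n) a := by
      ext i
      simp [fderiv_const_mul (hd _), grad]
    rw [this]
  -- `rep i` represents the linear form `ξ ↦ G 0 ξ i`. By `hB` these vectors are orthogonal with
  -- squared norms `σ i`, so the right inverse of `G 0` of least norm sends `c` to `∑ (c i / σ i) •
  -- rep i`.
  set rep : ι → EuclideanSpace ℝ N := fun i => WithLp.toLp 2 fun n => grad (f n) 0 i with hrep
  have hinner : ∀ i ξ, inner ℝ (rep i) ξ = G 0 ξ i := by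
    intro i ξ
    simp [hrep, hGapp, PiLp.inner_apply]
  have hGrep : ∀ i, G 0 (rep i) = Pi.single i (σ i) := by
    intro i
    ext j
    rw [hGapp]
    simp only [hrep, Finset.sum_apply, Pi.smul_apply, smul_eq_mul, hB, Pi.single_apply]
    simp only [eq_comm]
  set J : (ι → ℝ) →L[ℝ] EuclideanSpace ℝ N :=
    ∑ i, (ContinuousLinearMap.proj (R := ℝ) (φ := fun _ : ι => ℝ) i).smulRight ((σ i)⁻¹ • rep i)
    with hJ
  have hJapp : ∀ c, J c = ∑ i, (c i / σ i) • rep i := by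
    intro c
    simp [hJ, smul_smul, div_eq_mul_inv]
  have hJ1 : ∀ c, G 0 (J c) = c := by
    intro c
    rw [hJapp, map_sum]
    simp_rw [map_smul, hGrep]
    ext j
    simp only [Finset.sum_apply, Pi.smul_apply, smul_eq_mul, Pi.single_apply, mul_ite, mul_zero,
      Finset.sum_ite_eq, Finset.mem_univ, if_true]
    exact div_mul_cancel₀ _ (hσ j).ne'
  have hJ2 : ∀ c v, inner ℝ (J c) v = ∑ i, c i * G 0 v i / σ i := by
    intro c v
    rw [hJapp, sum_inner]
    refine Finset.sum_congr rfl fun i _ => ?_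
    rw [real_inner_smul_left, hinner]
    ring
  -- The derivative of `G` consists of second derivatives, and these are uncorrelated with the
  -- gradient by `hBC`.
  have hJ3 : ∀ h c, fderiv ℝ G 0 h (J c) = 0 := by
    intro h c
    rw [hJapp, map_sum]
    refine Finset.sum_eq_zero fun i _ => ?_
    rw [map_smul]
    have : fderiv ℝ G 0 h (rep i) = 0 := by
      ext j
      rw [hGd]
      have hh : h = ∑ l, h l • (Pi.single l 1 : ι → ℝ) := by
        ext m
        simp [Pi.single_apply]
      rw [hh]
      simp only [hrep, map_sum, map_smul, sum_apply, smul_apply,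
        smul_eq_mul, Finset.mul_sum]
      rw [Finset.sum_comm]
      refine Finset.sum_eq_zero fun l _ => ?_
      have := hBC i (j, l)
      simp only [hessVec] at this
      calc _ = h l * ∑ n, grad (f n) 0 i *
            fderiv ℝ (fderiv ℝ (f n)) 0 (Pi.single l 1) (Pi.single j 1) := by
            rw [Finset.mul_sum]
            exact Finset.sum_congr rfl fun n _ => by ring
        _ = 0 := by rw [this, mul_zero]
    rw [this, smul_zero]
  obtain ⟨δ, hδ, κ, hκ, h⟩ := kacRice_stdGaussian hGc hσ hJ1 hJ2 hJ3
  refine ⟨δ, hδ, κ, ?_, ?_⟩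
  · convert hκ using 3
    rw [gaussAbsDet, ← map_stdGaussian_eq_multivariateGaussian,
      lintegral_map measurable_abs_det_toSquare (by fun_prop)]
    refine lintegral_congr fun ξ => ?_
    congr 2
    rw [ContinuousLinearMap.det, ← LinearMap.det_toMatrix']
    congr 1
    ext i j
    simp only [toSquare, Matrix.of_apply, LinearMap.toMatrix'_apply,
      ContinuousLinearMap.coe_coe, ContinuousLinearMap.flip_apply, hessVec]
    rw [hGd]
  · simp_rw [hGzero]
    exact h

end LinearFamily

/-! ### Averages over shrinking sets -/

section Average

theorem tendsto_average {α : Type*} [MeasurableSpace α] {μ : Measure α} {κ : α → ℝ≥0∞}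
    {κ₀ : ℝ≥0∞} {x : Filter α} (hκ : Tendsto κ x (𝓝 κ₀)) {β : Type*} {l : Filter β}
    {D : β → Set α} (hD : ∀ s ∈ x, ∀ᶠ r in l, D r ⊆ s) (hDm : ∀ᶠ r in l, MeasurableSet (D r))
    (h0 : ∀ᶠ r in l, μ (D r) ≠ 0) (h1 : ∀ᶠ r in l, μ (D r) ≠ ⊤) :
    Tendsto (fun r => (∫⁻ p in D r, κ p ∂μ) / μ (D r)) l (𝓝 κ₀) := by
  rw [tendsto_order] at hκ ⊢
  constructor
  · intro a ha
    obtain ⟨b, hab, hb⟩ := exists_between ha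
    filter_upwards [hD _ (hκ.1 b hb), hDm, h0, h1] with r hr hm h0 h1
    refine hab.trans_le ?_
    rw [ENNReal.le_div_iff_mul_le (Or.inl h0) (Or.inl h1), ← setLIntegral_const]
    exact setLIntegral_mono' hm fun p hp => (hr hp).le
  · intro a ha
    obtain ⟨b, hb, hab⟩ := exists_between ha
    filter_upwards [hD _ (hκ.2 b hb), hDm, h0, h1] with r hr hm h0 h1
    refine lt_of_le_of_lt ?_ hab
    rw [ENNReal.div_le_iff h0 h1, ← setLIntegral_const]
    exact setLIntegral_mono' hm fun p hp => (hr hp).le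

end Average

open ProbabilityTheory

/-! ### From the local density to the total count -/

section LocalDensity

variable {E : Type*} [NormedAddCommGroup E] [NormedSpace ℝ E]
  {H : Type*} [TopologicalSpace H] {I : ModelWithCorners ℝ E H}
  {M : Type*} [MetricSpace M] [ChartedSpace H M] [IsManifold I ∞ M]
  {ι N : Type*} [Fintype ι]

/-- The chart at `p₀` read in linear coordinates, as a parametrization. -/
noncomputable def chartParam (I : ModelWithCorners ℝ E H) (p₀ : M) (A : (ι → ℝ) ≃L[ℝ] E)
    (a : ι → ℝ) : M :=
  (extChartAt I p₀).symm (A a)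

theorem contDiff_comp_chartParam {p₀ : M} (htgt : (extChartAt I p₀).target = Set.univ)
    (A : (ι → ℝ) ≃L[ℝ] E) (f : Smooth I M) : ContDiff ℝ ∞ (f ∘ chartParam I p₀ A) := by
  have := contDiffOn_comp_extChartAt_symm f p₀
  rw [htgt, contDiffOn_univ] at this
  exact this.comp A.contDiff

theorem chartParam_mem_critSet_iff [I.Boundaryless] {p₀ : M} (htgt : (extChartAt I p₀).target = Set.univ)
    (A : (ι → ℝ) ≃L[ℝ] E) (f : Smooth I M) (a : ι → ℝ) :
    chartParam I p₀ A a ∈ critSet f ↔ fderiv ℝ (f ∘ chartParam I p₀ A) a = 0 := by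
  have ha : A a ∈ (extChartAt I p₀).target := htgt ▸ Set.mem_univ _
  have hc := contDiffOn_comp_extChartAt_symm f p₀
  rw [htgt, contDiffOn_univ] at hc
  rw [chartParam, mem_critSet_iff_fderiv f ((extChartAt I p₀).map_target ha),
    (extChartAt I p₀).right_inv ha]
  have h1 : fderiv ℝ (f ∘ chartParam I p₀ A) a =
      (fderiv ℝ (f ∘ (extChartAt I p₀).symm) (A a)).comp (A : (ι → ℝ) →L[ℝ] E) := by
    have := ((hc.differentiable (by simp) (A a)).hasFDerivAt.comp a A.hasFDerivAt).fderiv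
    exact this
  rw [h1]
  constructor
  · intro h
    rw [h, ContinuousLinearMap.zero_comp]
  · intro h
    ext v
    have := DFunLike.congr_fun h (A.symm v)
    simpa using this

variable [DecidableEq ι] [Fintype N]

/-- The Kac–Rice density of the mean number of critical points at the centre of a chart. -/
noncomputable def critDensity (σ : ι → ℝ) (f : N → (ι → ℝ) → ℝ) : ℝ≥0∞ :=
  ENNReal.ofReal (∏ i, (√(2 * Real.pi * σ i))⁻¹) *
    gaussAbsDet (covMatrix fun n => hessVec (f n))

variable [I.Boundaryless] [CompactSpace M]

theorem tendsto_meanCrit_div {p₀ : M} (htgt : (extChartAt I p₀).target = Set.univ)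
    (h0 : extChartAt I p₀ p₀ = 0) (A : (ι → ℝ) ≃L[ℝ] E) {e : N → Smooth I M} {σ : ι → ℝ}
    (hσ : ∀ i, 0 < σ i)
    (hB : ∀ i j, ∑ n, grad (e n ∘ chartParam I p₀ A) 0 i * grad (e n ∘ chartParam I p₀ A) 0 j =
      if i = j then σ i else 0)
    (hBC : ∀ i s, ∑ n, grad (e n ∘ chartParam I p₀ A) 0 i *
      hessVec (e n ∘ chartParam I p₀ A) s = 0) :
    (∀ᶠ r in 𝓝[>] (0 : ℝ), volume (chartParam I p₀ A ⁻¹' Metric.closedBall p₀ r) ≠ 0 ∧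
      volume (chartParam I p₀ A ⁻¹' Metric.closedBall p₀ r) ≠ ⊤) ∧
    Tendsto (fun r => meanCrit e (Metric.closedBall p₀ r) /
      volume (chartParam I p₀ A ⁻¹' Metric.closedBall p₀ r)) (𝓝[>] (0 : ℝ))
      (𝓝 (critDensity σ fun n => e n ∘ chartParam I p₀ A)) := by
  set ψ := chartParam I p₀ A with hψ
  obtain ⟨δ, hδ, κ, hκ, hKR⟩ := kacRice_critical (f := fun n => e n ∘ ψ)
    (fun n => contDiff_comp_chartParam htgt A (e n)) hσ hB hBC
  have hψ0 : ψ 0 = p₀ := by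
    simp only [hψ, chartParam, map_zero]
    rw [← h0, extChartAt_to_inv]
  have hψc : Continuous ψ := by
    have := continuousOn_extChartAt_symm (I := I) p₀
    rw [htgt, continuousOn_univ] at this
    exact this.comp A.continuous
  have hψi : Function.Injective ψ := by
    intro a b hab
    have := congrArg (extChartAt I p₀) hab
    simp only [hψ, chartParam] at this
    rw [(extChartAt I p₀).right_inv (htgt ▸ Set.mem_univ _),
      (extChartAt I p₀).right_inv (htgt ▸ Set.mem_univ _)] at this
    exact A.injective this
  have hψs : ∀ q ∈ (extChartAt I p₀).source, ψ (A.symm (extChartAt I p₀ q)) = q := by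
    intro q hq
    simp only [hψ, chartParam, ContinuousLinearEquiv.apply_symm_apply,
      (extChartAt I p₀).left_inv hq]
  have hsmall : ∀ s ∈ 𝓝 (0 : ι → ℝ), ∀ᶠ r in 𝓝[>] (0 : ℝ), ψ ⁻¹' Metric.closedBall p₀ r ⊆ s := by
    intro s hs
    have hc : ContinuousAt (fun q => A.symm (extChartAt I p₀ q)) p₀ :=
      A.symm.continuous.continuousAt.comp (continuousAt_extChartAt p₀)
    have hs' : ∀ᶠ q in 𝓝 p₀, A.symm (extChartAt I p₀ q) ∈ s :=
      hc.eventually (show s ∈ 𝓝 (A.symm (extChartAt I p₀ p₀)) by rw [h0, map_zero]; exact hs)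
    obtain ⟨ε, hε, hε'⟩ := Metric.eventually_nhds_iff_ball.1 hs'
    filter_upwards [Ioo_mem_nhdsGT hε] with r hr a ha
    have := hε' _ (Metric.closedBall_subset_ball hr.2 ha)
    simp only [hψ, chartParam, (extChartAt I p₀).right_inv (htgt ▸ Set.mem_univ (A a)),
      ContinuousLinearEquiv.symm_apply_apply] at this
    exact this
  have hsrc : ∀ᶠ r in 𝓝[>] (0 : ℝ), Metric.closedBall p₀ r ⊆ (extChartAt I p₀).source := by
    obtain ⟨ε, hε, hε'⟩ := Metric.mem_nhds_iff.1 (extChartAt_source_mem_nhds (I := I) p₀)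
    filter_upwards [Ioo_mem_nhdsGT hε] with r hr
    exact (Metric.closedBall_subset_ball hr.2).trans hε'
  have hvol : ∀ᶠ r in 𝓝[>] (0 : ℝ), volume (ψ ⁻¹' Metric.closedBall p₀ r) ≠ 0 ∧
      volume (ψ ⁻¹' Metric.closedBall p₀ r) ≠ ⊤ := by
    filter_upwards [self_mem_nhdsWithin, hsmall _ (Metric.ball_mem_nhds 0 hδ)] with r hr hr'
    constructor
    · have : ψ ⁻¹' Metric.closedBall p₀ r ∈ 𝓝 0 :=
        hψc.continuousAt (hψ0 ▸ Metric.closedBall_mem_nhds p₀ hr)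
      exact (Measure.measure_pos_of_mem_nhds _ this).ne'
    · exact ((measure_mono hr').trans_lt measure_ball_lt_top).ne
  refine ⟨hvol, ?_⟩
  have hav := tendsto_average (μ := volume) hκ hsmall
    (Eventually.of_forall fun r => (Metric.isClosed_closedBall.preimage hψc).measurableSet)
    (hvol.mono fun r h => h.1) (hvol.mono fun r h => h.2)
  refine hav.congr' ?_
  filter_upwards [hsmall _ (Metric.ball_mem_nhds 0 hδ), hsrc] with r hr hr'
  congr 1
  have hset : ∀ ξ : EuclideanSpace ℝ N,
      (({a ∈ ψ ⁻¹' Metric.closedBall p₀ r |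
        fderiv ℝ (fun a => ∑ n, ξ n * (e n ∘ ψ) a) a = 0}).encard : ℝ≥0∞) =
      ((critSet (∑ n, ξ n • e n) ∩ Metric.closedBall p₀ r).encard : ℝ≥0∞) := by
    intro ξ
    rw [← hψi.encard_image]
    congr 2
    have hfun : (fun a => ∑ n, ξ n * (e n ∘ ψ) a) = (∑ n, ξ n • e n : Smooth I M) ∘ ψ := by
      ext a
      simp [sum_smooth_apply]
    ext q
    simp only [Set.mem_image, Set.mem_ofPred_eq, Set.mem_preimage, Set.mem_inter_iff, hfun]
    constructor
    · rintro ⟨a, ⟨ha, hd⟩, rfl⟩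
      exact ⟨(chartParam_mem_critSet_iff htgt A _ a).2 hd, ha⟩
    · rintro ⟨hq, hqr⟩
      refine ⟨A.symm (extChartAt I p₀ q), ⟨?_, ?_⟩, hψs q (hr' hqr)⟩
      · rwa [hψs q (hr' hqr)]
      · rw [← chartParam_mem_critSet_iff htgt A]
        change ψ _ ∈ _
        rwa [hψs q (hr' hqr)]
  rw [← hKR _ hr (Metric.isClosed_closedBall.preimage hψc).measurableSet]
  · simp only [hset]
    rfl
  · simp only [hset]
    exact measurable_encard_critSet_inter e Metric.isClosed_closedBall

variable [MeasurableSpace M] [BorelSpace M]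
  {vol : Measure M} [IsFiniteMeasure vol] [vol.IsOpenPosMeasure]

/-- The mean number of critical points of a homogeneous family is its Kac–Rice density at a point
times a constant that does not depend on the family. -/
theorem tendsto_volume_ratio [DecidableEq N] {p₀ : M}
    (htgt : (extChartAt I p₀).target = Set.univ)
    (h0 : extChartAt I p₀ p₀ = 0) (A : (ι → ℝ) ≃L[ℝ] E) {e : N → Smooth I M} {σ : ι → ℝ}
    (hσ : ∀ i, 0 < σ i)
    (hB : ∀ i j, ∑ n, grad (e n ∘ chartParam I p₀ A) 0 i * grad (e n ∘ chartParam I p₀ A) 0 j =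
      if i = j then σ i else 0)
    (hBC : ∀ i s, ∑ n, grad (e n ∘ chartParam I p₀ A) 0 i *
      hessVec (e n ∘ chartParam I p₀ A) s = 0)
    (he : ∀ m n, ∫ p, e m p * e n p ∂vol = if m = n then 1 else 0)
    (hom : ∀ p, ∃ g : M ≃ₘ^∞⟮I, I⟯ M, g p₀ = p ∧ Isometry g ∧ MeasurePreserving g vol vol ∧
      ∀ n, pullback g (e n) ∈ Submodule.span ℝ (Set.range e))
    (hpos : critDensity σ (fun n => e n ∘ chartParam I p₀ A) ≠ 0) :
    (meanCrit e Set.univ ≠ 0 ∧ meanCrit e Set.univ ≠ ⊤) ∧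
    Tendsto (fun r => vol Set.univ * volume (chartParam I p₀ A ⁻¹' Metric.closedBall p₀ r) /
      vol (Metric.closedBall p₀ r)) (𝓝[>] (0 : ℝ))
      (𝓝 (meanCrit e Set.univ / critDensity σ fun n => e n ∘ chartParam I p₀ A)) := by
  obtain ⟨hvol, hlim⟩ := tendsto_meanCrit_div htgt h0 A hσ hB hBC
  set κ₀ := critDensity σ fun n => e n ∘ chartParam I p₀ A
  have htop : κ₀ ≠ ⊤ := ENNReal.mul_ne_top ENNReal.ofReal_ne_top (gaussAbsDet_lt_top _).ne
  set avg : ℝ → ℝ≥0∞ := fun r => meanCrit e (Metric.closedBall p₀ r) /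
    volume (chartParam I p₀ A ⁻¹' Metric.closedBall p₀ r) with havg
  set c : ℝ → ℝ≥0∞ := fun r => vol Set.univ *
    volume (chartParam I p₀ A ⁻¹' Metric.closedBall p₀ r) / vol (Metric.closedBall p₀ r) with hc
  have hball : ∀ r : ℝ, 0 < r → vol (Metric.closedBall p₀ r) ≠ 0 := fun r hr =>
    (Metric.measure_closedBall_pos vol p₀ hr).ne'
  -- `c r` depends only on the manifold and the chart, `avg r` tends to the density, and the product
  -- is the total count for every small `r`; so `c r` must converge to the quotient.
  have hmul : ∀ᶠ r in 𝓝[>] (0 : ℝ), c r * avg r = meanCrit e Set.univ := by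
    filter_upwards [hvol, self_mem_nhdsWithin] with r hr hr0
    have h1 := meanCrit_univ_mul he p₀ hom (r := r) hr0
    have h2 : meanCrit e Set.univ =
        vol Set.univ * meanCrit e (Metric.closedBall p₀ r) / vol (Metric.closedBall p₀ r) := by
      rw [ENNReal.eq_div_iff (hball r hr0) (measure_ne_top _ _), mul_comm, h1]
    rw [h2, hc, havg]
    simp only [div_eq_mul_inv]
    calc _ = vol Set.univ * meanCrit e (Metric.closedBall p₀ r) * (vol (Metric.closedBall p₀ r))⁻¹ *
          (volume (chartParam I p₀ A ⁻¹' Metric.closedBall p₀ r) *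
            (volume (chartParam I p₀ A ⁻¹' Metric.closedBall p₀ r))⁻¹) := by ring
      _ = _ := by rw [ENNReal.mul_inv_cancel hr.1 hr.2, mul_one]
  have hav : ∀ᶠ r in 𝓝[>] (0 : ℝ), avg r ≠ 0 ∧ avg r ≠ ⊤ :=
    (hlim.eventually_ne hpos).and (hlim.eventually_ne htop)
  have hcr : ∀ᶠ r in 𝓝[>] (0 : ℝ), c r ≠ 0 ∧ c r ≠ ⊤ := by
    have : Nonempty M := ⟨p₀⟩
    filter_upwards [hvol, self_mem_nhdsWithin] with r hr hr0
    constructor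
    · exact (ENNReal.div_pos (mul_ne_zero (isOpen_univ.measure_pos vol ⟨p₀, trivial⟩).ne' hr.1)
        (measure_ne_top _ _)).ne'
    · exact ENNReal.div_ne_top (ENNReal.mul_ne_top (measure_ne_top _ _) hr.2) (hball r hr0)
  constructor
  · obtain ⟨r, h1, h2, h3⟩ := (hmul.and (hav.and hcr)).exists
    rw [← h1]
    exact ⟨mul_ne_zero h3.1 h2.1, ENNReal.mul_ne_top h3.2 h2.2⟩
  · have h1 : Tendsto (fun r => meanCrit e Set.univ / avg r) (𝓝[>] (0 : ℝ))
        (𝓝 (meanCrit e Set.univ / κ₀)) := ENNReal.Tendsto.const_div hlim (Or.inl htop)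
    refine h1.congr' ?_
    filter_upwards [hmul, hav] with r hr ha
    rw [← hr, mul_div_assoc, ENNReal.div_self ha.1 ha.2, mul_one]

end LocalDensity

/-! ### Two-jets in one variable -/

section Jets

/-- `a`, `b`, `c` are the value and the first two derivatives of `φ` at `0`. -/
def HasJet (φ : ℝ → ℝ) (a b c : ℝ) : Prop :=
  φ 0 = a ∧ ∃ φ' : ℝ → ℝ, (∀ s, HasDerivAt φ (φ' s) s) ∧ φ' 0 = b ∧ HasDerivAt φ' c 0

theorem HasJet.unique {φ : ℝ → ℝ} {a b c a' b' c' : ℝ} (h : HasJet φ a b c)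
    (h' : HasJet φ a' b' c') : a = a' ∧ b = b' ∧ c = c' := by
  obtain ⟨h0, p, hp, hp0, hp1⟩ := h
  obtain ⟨h0', q, hq, hq0, hq1⟩ := h'
  obtain rfl : p = q := funext fun s => (hp s).unique (hq s)
  exact ⟨h0 ▸ h0', hp0 ▸ hq0, hp1.unique hq1⟩

theorem HasJet.const_mul {φ : ℝ → ℝ} {a b c : ℝ} (h : HasJet φ a b c) (r : ℝ) :
    HasJet (fun s => r * φ s) (r * a) (r * b) (r * c) := by
  obtain ⟨h0, p, hp, hp0, hp1⟩ := h
  exact ⟨by simp [h0], fun s => r * p s, fun s => (hp s).const_mul r, by simp [hp0], hp1.const_mul r⟩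

theorem HasJet.add {φ ψ : ℝ → ℝ} {a b c a' b' c' : ℝ} (h : HasJet φ a b c)
    (h' : HasJet ψ a' b' c') : HasJet (fun s => φ s + ψ s) (a + a') (b + b') (c + c') := by
  obtain ⟨h0, p, hp, hp0, hp1⟩ := h
  obtain ⟨h0', q, hq, hq0, hq1⟩ := h'
  exact ⟨by simp [h0, h0'], fun s => p s + q s, fun s => (hp s).add (hq s), by simp [hp0, hq0],
    hp1.add hq1⟩

theorem HasJet.mul {φ ψ : ℝ → ℝ} {a b c a' b' c' : ℝ} (h : HasJet φ a b c)
    (h' : HasJet ψ a' b' c') :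
    HasJet (fun s => φ s * ψ s) (a * a') (b * a' + a * b') (c * a' + 2 * b * b' + a * c') := by
  obtain ⟨h0, p, hp, hp0, hp1⟩ := h
  obtain ⟨h0', q, hq, hq0, hq1⟩ := h'
  refine ⟨by simp [h0, h0'], fun s => p s * ψ s + φ s * q s, fun s => (hp s).mul (hq s),
    by simp [hp0, hq0, h0, h0'], ?_⟩
  refine ((hp1.mul (hq 0)).add ((hp 0).mul hq1)).congr_deriv ?_
  rw [hp0, hq0, h0, h0']
  ring

theorem hasJet_sum {N : Type*} (t : Finset N) {φ : N → ℝ → ℝ} {a b c : N → ℝ}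
    (h : ∀ n, HasJet (φ n) (a n) (b n) (c n)) :
    HasJet (fun s => ∑ n ∈ t, φ n s) (∑ n ∈ t, a n) (∑ n ∈ t, b n) (∑ n ∈ t, c n) := by
  choose h0 p hp hp0 hp1 using h
  exact ⟨by simp [h0], fun s => ∑ n ∈ t, p n s, fun s => HasDerivAt.fun_sum fun n _ => hp n s,
    by simp [hp0], HasDerivAt.fun_sum fun n _ => hp1 n⟩

theorem HasJet.eval {φ : ℝ → ℝ} {a b c : ℝ} (h : HasJet φ a b c) (Z : Polynomial ℝ) :
    HasJet (fun s => Z.eval (φ s)) (Z.eval a) (Z.derivative.eval a * b)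
      (Z.derivative.derivative.eval a * b ^ 2 + Z.derivative.eval a * c) := by
  obtain ⟨h0, p, hp, hp0, hp1⟩ := h
  refine ⟨by simp [h0], fun s => Z.derivative.eval (φ s) * p s,
    fun s => (Z.hasDerivAt _).comp s (hp s), by simp [h0, hp0], ?_⟩
  refine ((((Z.derivative).hasDerivAt (φ 0)).comp 0 (hp 0)).mul hp1).congr_deriv ?_
  simp only [Function.comp, h0, hp0]
  ring

theorem hasJet_line {E : Type*} [NormedAddCommGroup E] [NormedSpace ℝ E] {F : E → ℝ}
    (hF : ContDiff ℝ 2 F) (v : E) :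
    HasJet (fun s => F (s • v)) (F 0) (fderiv ℝ F 0 v) (fderiv ℝ (fderiv ℝ F) 0 v v) := by
  have hl : ∀ s : ℝ, HasDerivAt (fun s : ℝ => s • v) v s := fun s => by
    simpa using (hasDerivAt_id s).smul_const v
  have hd : Differentiable ℝ (fderiv ℝ F) :=
    (hF.fderiv_right (m := 1) (by norm_num)).differentiable (by norm_num)
  refine ⟨by simp, fun s => fderiv ℝ F (s • v) v, fun s => ?_, by simp, ?_⟩
  · exact (hF.differentiable (by norm_num) _).hasFDerivAt.comp_hasDerivAt s (hl s)
  · have h1 : HasDerivAt (fun s : ℝ => fderiv ℝ F (s • v)) (fderiv ℝ (fderiv ℝ F) 0 v) 0 := by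
      have h2 : HasFDerivAt (fderiv ℝ F) (fderiv ℝ (fderiv ℝ F) 0) ((0 : ℝ) • v) := by
        rw [zero_smul]
        exact (hd 0).hasFDerivAt
      exact h2.comp_hasDerivAt (0 : ℝ) (hl 0)
    simpa using h1.clm_apply (hasDerivAt_const (0 : ℝ) v)

/-- On the line `s • a` in stereographic coordinates, with `q = |a|²`, this is the cosine of the
angle from the centre; the sine is `√q` times the function of `hasJet_stereo_sin`. -/
theorem hasJet_stereo_cos {q : ℝ} (hq : 0 ≤ q) :
    HasJet (fun s => (4 - s ^ 2 * q) / (4 + s ^ 2 * q)) 1 0 (-q) := by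
  have hne : ∀ s : ℝ, 4 + s ^ 2 * q ≠ 0 := fun s => by positivity
  refine ⟨by norm_num, fun s => -16 * s * q / (4 + s ^ 2 * q) ^ 2, fun s => ?_, by norm_num, ?_⟩
  · have h1 : HasDerivAt (fun s : ℝ => s ^ 2 * q) (2 * s * q) s := by
      simpa using (hasDerivAt_pow 2 s).mul_const q
    refine ((h1.const_sub 4).div (h1.const_add 4) (hne s)).congr_deriv ?_
    congr 1
    ring
  · have h1 : HasDerivAt (fun s : ℝ => s ^ 2 * q) (2 * 0 * q) 0 := by
      simpa using (hasDerivAt_pow 2 (0 : ℝ)).mul_const q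
    have h2 : HasDerivAt (fun s : ℝ => -16 * s * q) (-16 * q) 0 := by
      simpa using ((hasDerivAt_id (0 : ℝ)).const_mul (-16)).mul_const q
    refine (h2.div ((h1.const_add 4).pow 2) (pow_ne_zero 2 (hne 0))).congr_deriv ?_
    simp only [Pi.pow_apply]
    norm_num
    ring

theorem hasJet_stereo_sin {q : ℝ} (hq : 0 ≤ q) :
    HasJet (fun s => 4 * s / (4 + s ^ 2 * q)) 0 1 0 := by
  have hne : ∀ s : ℝ, 4 + s ^ 2 * q ≠ 0 := fun s => by positivity
  refine ⟨by norm_num, fun s => (16 - 4 * (s ^ 2 * q)) / (4 + s ^ 2 * q) ^ 2, fun s => ?_,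
    by norm_num, ?_⟩
  · have h1 : HasDerivAt (fun s : ℝ => s ^ 2 * q) (2 * s * q) s := by
      simpa using (hasDerivAt_pow 2 s).mul_const q
    have h2 : HasDerivAt (fun s : ℝ => 4 * s) 4 s := by
      simpa using (hasDerivAt_id s).const_mul 4
    refine (h2.div (h1.const_add 4) (hne s)).congr_deriv ?_
    congr 1
    ring
  · have h1 : HasDerivAt (fun s : ℝ => s ^ 2 * q) (2 * 0 * q) 0 := by
      simpa using (hasDerivAt_pow 2 (0 : ℝ)).mul_const q
    refine (((h1.const_mul 4).const_sub 16).div ((h1.const_add 4).pow 2)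
      (pow_ne_zero 2 (hne 0))).congr_deriv ?_
    norm_num

end Jets

/-! ### Covariances of the two-jet of an isotropic field -/

section IsotropicJets

variable {ι N : Type*} [Fintype ι] [Fintype N]

/-- The inner product of the two points of the sphere with stereographic coordinates `x`, `y`. -/
noncomputable def stereoInner (x y : ι → ℝ) : ℝ :=
  (16 * (x ⬝ᵥ y) + (x ⬝ᵥ x - 4) * (y ⬝ᵥ y - 4)) / ((x ⬝ᵥ x + 4) * (y ⬝ᵥ y + 4))

/-- The spherical law of cosines. Its form separates `s` from `t`, so that jets can be taken in one
variable at a time. -/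
theorem stereoInner_smul_smul (a b : ι → ℝ) (s t : ℝ) :
    stereoInner (s • a) (t • b) =
      (4 - t ^ 2 * (b ⬝ᵥ b)) / (4 + t ^ 2 * (b ⬝ᵥ b)) *
        ((4 - s ^ 2 * (a ⬝ᵥ a)) / (4 + s ^ 2 * (a ⬝ᵥ a))) +
      (a ⬝ᵥ b) * (4 * t / (4 + t ^ 2 * (b ⬝ᵥ b))) * (4 * s / (4 + s ^ 2 * (a ⬝ᵥ a))) := by
  have h : ∀ x : ι → ℝ, 0 ≤ x ⬝ᵥ x := fun x => Finset.sum_nonneg fun i _ => mul_self_nonneg _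
  have h1 : 4 + s ^ 2 * (a ⬝ᵥ a) ≠ 0 := by have := h a; positivity
  have h2 : 4 + t ^ 2 * (b ⬝ᵥ b) ≠ 0 := by have := h b; positivity
  simp only [stereoInner, smul_dotProduct, dotProduct_smul, smul_eq_mul]
  rw [show s * (s * (a ⬝ᵥ a)) + 4 = 4 + s ^ 2 * (a ⬝ᵥ a) by ring,
    show t * (t * (b ⬝ᵥ b)) + 4 = 4 + t ^ 2 * (b ⬝ᵥ b) by ring]
  field_simp
  ring

variable [DecidableEq ι]

/-- The second order statistics at `0` of the random function `∑ n, ξ n * f n` with standard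
Gaussian `ξ` are those of an isotropic field on a sphere in stereographic coordinates, with
covariance a function of the inner product whose value and first two derivatives at `1` are
`z`, `z₁`, `z₂`. -/
structure IsotropicJet (f : N → (ι → ℝ) → ℝ) (z z₁ z₂ : ℝ) : Prop where
  val_val : ∑ n, f n 0 * f n 0 = z
  val_grad : ∀ i, ∑ n, f n 0 * grad (f n) 0 i = 0
  grad_grad : ∀ i j, ∑ n, grad (f n) 0 i * grad (f n) 0 j = z₁ * if i = j then 1 else 0
  val_hess : ∀ i j, ∑ n, f n 0 * hessVec (f n) (i, j) = -z₁ * if i = j then 1 else 0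
  grad_hess : ∀ i j l, ∑ n, grad (f n) 0 i * hessVec (f n) (j, l) = 0
  hess_hess : ∀ i j l m, ∑ n, hessVec (f n) (i, j) * hessVec (f n) (l, m) =
    z₂ * ((if i = l then 1 else 0) * (if j = m then 1 else 0) +
      (if i = m then 1 else 0) * (if j = l then 1 else 0) +
      (if i = j then 1 else 0) * (if l = m then 1 else 0)) +
    z₁ * ((if i = j then 1 else 0) * (if l = m then 1 else 0))

theorem isotropicJet_of_kernel {f : N → (ι → ℝ) → ℝ} (hf : ∀ n, ContDiff ℝ 2 (f n))
    {Z : Polynomial ℝ} (hZ : ∀ x y, ∑ n, f n x * f n y = Z.eval (stereoInner x y)) :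
    IsotropicJet f (Z.eval 1) (Z.derivative.eval 1) (Z.derivative.derivative.eval 1) := by
  set D1 : N → (ι → ℝ) → ℝ := fun n a => fderiv ℝ (f n) 0 a with hD1
  set B : N → (ι → ℝ) → (ι → ℝ) → ℝ := fun n a b => fderiv ℝ (fderiv ℝ (f n)) 0 a b with hB
  have hnn : ∀ x : ι → ℝ, 0 ≤ x ⬝ᵥ x := fun x => Finset.sum_nonneg fun i _ => mul_self_nonneg _
  have hjet : ∀ n a, HasJet (fun s => f n (s • a)) (f n 0) (D1 n a) (B n a a) :=
    fun n a => hasJet_line (hf n) a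
  -- Compare the two-jets in `s` at `0` of both sides of the kernel identity on the lines `s • a`
  -- and `t • b`, with `t` fixed.
  have hstep : ∀ a b t,
      (∑ n, f n 0 * f n (t • b) = Z.eval ((4 - t ^ 2 * (b ⬝ᵥ b)) / (4 + t ^ 2 * (b ⬝ᵥ b)))) ∧
      (∑ n, D1 n a * f n (t • b) =
        (a ⬝ᵥ b) * (Z.derivative.eval ((4 - t ^ 2 * (b ⬝ᵥ b)) / (4 + t ^ 2 * (b ⬝ᵥ b))) *
          (4 * t / (4 + t ^ 2 * (b ⬝ᵥ b))))) ∧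
      (∑ n, B n a a * f n (t • b) =
        (a ⬝ᵥ b) ^ 2 *
          (Z.derivative.derivative.eval ((4 - t ^ 2 * (b ⬝ᵥ b)) / (4 + t ^ 2 * (b ⬝ᵥ b))) *
          ((4 * t / (4 + t ^ 2 * (b ⬝ᵥ b))) * (4 * t / (4 + t ^ 2 * (b ⬝ᵥ b))))) +
        -(a ⬝ᵥ a) * (Z.derivative.eval ((4 - t ^ 2 * (b ⬝ᵥ b)) / (4 + t ^ 2 * (b ⬝ᵥ b))) *
          ((4 - t ^ 2 * (b ⬝ᵥ b)) / (4 + t ^ 2 * (b ⬝ᵥ b))))) := by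
    intro a b t
    have h1 := hasJet_sum Finset.univ fun n => (hjet n a).const_mul (f n (t • b))
    have h2 := (((hasJet_stereo_cos (hnn a)).const_mul
      ((4 - t ^ 2 * (b ⬝ᵥ b)) / (4 + t ^ 2 * (b ⬝ᵥ b)))).add
      ((hasJet_stereo_sin (hnn a)).const_mul
        ((a ⬝ᵥ b) * (4 * t / (4 + t ^ 2 * (b ⬝ᵥ b)))))).eval Z
    have h3 : (fun s => ∑ n, f n (t • b) * f n (s • a)) = fun s => Z.eval
        ((4 - t ^ 2 * (b ⬝ᵥ b)) / (4 + t ^ 2 * (b ⬝ᵥ b)) *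
          ((4 - s ^ 2 * (a ⬝ᵥ a)) / (4 + s ^ 2 * (a ⬝ᵥ a))) +
        (a ⬝ᵥ b) * (4 * t / (4 + t ^ 2 * (b ⬝ᵥ b))) * (4 * s / (4 + s ^ 2 * (a ⬝ᵥ a)))) := by
      funext s
      rw [← stereoInner_smul_smul, ← hZ]
      exact Finset.sum_congr rfl fun n _ => mul_comm _ _
    rw [h3] at h1
    obtain ⟨e0, e1, e2⟩ := h1.unique h2
    simp only [mul_one, mul_zero, add_zero, zero_add] at e0 e1 e2
    refine ⟨?_, ?_, ?_⟩
    · rw [← e0]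
      exact Finset.sum_congr rfl fun n _ => mul_comm _ _
    · refine (Finset.sum_congr rfl fun n _ => mul_comm _ _).trans (e1.trans ?_)
      ring
    · refine (Finset.sum_congr rfl fun n _ => mul_comm _ _).trans (e2.trans ?_)
      ring
  have hcos := fun b : ι → ℝ => hasJet_stereo_cos (hnn b)
  have hsin := fun b : ι → ℝ => hasJet_stereo_sin (hnn b)
  -- The two-jets in `t` of the three identities in `hstep` give the covariances of value, slope and
  -- second derivative along lines.
  have k0 : ∀ b, (∑ n, f n 0 * f n 0 = Z.eval 1) ∧ (∑ n, f n 0 * D1 n b = 0) ∧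
      (∑ n, f n 0 * B n b b = -(b ⬝ᵥ b) * Z.derivative.eval 1) := by
    intro b
    have h1 := hasJet_sum Finset.univ fun n => (hjet n b).const_mul (f n 0)
    simp only [(hstep 0 b _).1] at h1
    obtain ⟨e0, e1, e2⟩ := h1.unique ((hcos b).eval Z)
    refine ⟨e0, e1.trans (by ring), e2.trans (by ring)⟩
  have k1 : ∀ a b, (∑ n, D1 n a * D1 n b = (a ⬝ᵥ b) * Z.derivative.eval 1) ∧
      (∑ n, D1 n a * B n b b = 0) := by
    intro a b
    have h1 := hasJet_sum Finset.univ fun n => (hjet n b).const_mul (D1 n a)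
    simp only [(hstep a b _).2.1] at h1
    obtain ⟨e0, e1, e2⟩ := h1.unique ((((hcos b).eval Z.derivative).mul (hsin b)).const_mul _)
    refine ⟨e1.trans (by ring), e2.trans (by ring)⟩
  have k2 : ∀ a b, ∑ n, B n a a * B n b b = 2 * (a ⬝ᵥ b) ^ 2 * Z.derivative.derivative.eval 1 +
      (a ⬝ᵥ a) * (b ⬝ᵥ b) * (Z.derivative.derivative.eval 1 + Z.derivative.eval 1) := by
    intro a b
    have h1 := hasJet_sum Finset.univ fun n => (hjet n b).const_mul (B n a a)
    simp only [(hstep a b _).2.2] at h1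
    obtain ⟨e0, e1, e2⟩ := h1.unique
      (((((hcos b).eval Z.derivative.derivative).mul ((hsin b).mul (hsin b))).const_mul _).add
        ((((hcos b).eval Z.derivative).mul (hcos b)).const_mul _))
    exact e2.trans (by ring)
  -- Polarization: mixed second derivatives are recovered from those along lines.
  have hpol : ∀ n a b, B n a b = (B n (a + b) (a + b) - B n (a - b) (a - b)) / 4 := by
    intro n a b
    have hs : B n b a = B n a b :=
      ((hf n).contDiffAt.isSymmSndFDerivAt (by simp)) b a
    have e1 : B n (a + b) (a + b) = B n a a + B n a b + B n b a + B n b b := by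
      simp only [hB, map_add, add_apply]; ring
    have e2 : B n (a - b) (a - b) = B n a a - B n a b - B n b a + B n b b := by
      simp only [hB, map_sub, sub_apply]; ring
    rw [e1, e2, hs]
    ring
  have hG : ∀ n i, grad (f n) 0 i = D1 n (Pi.single i 1) := fun n i => rfl
  have hH : ∀ n i j, hessVec (f n) (i, j) = B n (Pi.single j 1) (Pi.single i 1) := fun n i j => rfl
  have hdot : ∀ i j : ι, (Pi.single i 1 : ι → ℝ) ⬝ᵥ Pi.single j 1 = if i = j then 1 else 0 := by
    intro i j
    rw [single_dotProduct, one_mul, Pi.single_apply]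
  have l0 : ∀ c : N → ℝ, ∀ a b, ∑ n, c n * B n a b =
      (∑ n, c n * B n (a + b) (a + b) - ∑ n, c n * B n (a - b) (a - b)) / 4 := by
    intro c a b
    rw [← Finset.sum_sub_distrib, Finset.sum_div]
    exact Finset.sum_congr rfl fun n _ => by rw [hpol n a b]; ring
  constructor
  · exact (k0 0).1
  · exact fun i => (k0 _).2.1
  · intro i j
    simp only [hG, (k1 _ _).1, hdot, mul_comm]
  · intro i j
    simp only [hH]
    rw [l0 (fun n => f n 0), (k0 _).2.2, (k0 _).2.2]
    simp only [dotProduct_add, add_dotProduct, dotProduct_sub, sub_dotProduct, hdot]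
    by_cases h : i = j
    · subst h; simp; ring
    · simp [h, Ne.symm h]
  · intro i j l
    simp only [hH, hG]
    rw [l0 (fun n => D1 n _), (k1 _ _).2, (k1 _ _).2]
    simp
  · intro i j l m
    simp only [hH]
    have l1 : ∀ a b c d, ∑ n, B n a b * B n c d =
        (∑ n, B n (a + b) (a + b) * B n (c + d) (c + d)
          - ∑ n, B n (a + b) (a + b) * B n (c - d) (c - d)
          - ∑ n, B n (a - b) (a - b) * B n (c + d) (c + d)
          + ∑ n, B n (a - b) (a - b) * B n (c - d) (c - d)) / 16 := by
      intro a b c d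
      rw [← Finset.sum_sub_distrib, ← Finset.sum_sub_distrib, ← Finset.sum_add_distrib,
        Finset.sum_div]
      exact Finset.sum_congr rfl fun n _ => by rw [hpol n a b, hpol n c d]; ring
    rw [l1]
    simp only [k2, dotProduct_add, add_dotProduct, dotProduct_sub, sub_dotProduct, hdot,
      eq_comm (a := j) (b := i), eq_comm (a := m) (b := l)]
    ring

end IsotropicJets

open ProbabilityTheory

/-! ### Normalizing the Hessian -/

section Rescaling

variable {ι N : Type*} [Fintype ι] [Fintype N] [DecidableEq ι]

theorem gaussAbsDet_covMatrix (a : N → ι × ι → ℝ) :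
    gaussAbsDet (covMatrix a) = ∫⁻ ξ, ENNReal.ofReal |(Matrix.of fun i j => ∑ n, ξ n * a n (i, j) :
      Matrix ι ι ℝ).det| ∂stdGaussian (EuclideanSpace ℝ N) := by
  rw [gaussAbsDet, ← map_stdGaussian_eq_multivariateGaussian,
    lintegral_map measurable_abs_det_toSquare (by fun_prop)]
  rfl

/-- The rescaled matrix is `p • D H D` with `D` diagonal, so its determinant picks up `p ^ card ι`
and the square of `det D`. -/
theorem gaussAbsDet_covMatrix_scale (a : N → ι × ι → ℝ) (p : ℝ) (d : ι → ℝ) :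
    gaussAbsDet (covMatrix fun n s => p * d s.1 * d s.2 * a n s) =
      ENNReal.ofReal (|p| ^ Fintype.card ι * ∏ i, d i ^ 2) * gaussAbsDet (covMatrix a) := by
  rw [gaussAbsDet_covMatrix, gaussAbsDet_covMatrix,
    ← lintegral_const_mul' _ _ ENNReal.ofReal_ne_top]
  refine lintegral_congr fun ξ => ?_
  rw [← ENNReal.ofReal_mul (by positivity)]
  congr 1
  have h : (Matrix.of fun i j => ∑ n, ξ n * (p * d i * d j * a n (i, j)) : Matrix ι ι ℝ) =
      p • Matrix.of fun i j => d i * (Matrix.of (fun i j => d j *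
        (Matrix.of fun i j => ∑ n, ξ n * a n (i, j) : Matrix ι ι ℝ) i j) : Matrix ι ι ℝ) i j := by
    ext i j
    simp only [Matrix.of_apply, Matrix.smul_apply, smul_eq_mul, Finset.mul_sum]
    exact Finset.sum_congr rfl fun n _ => by ring
  rw [h, Matrix.det_smul, Matrix.det_mul_column, Matrix.det_mul_row, abs_mul, abs_mul, abs_mul,
    abs_pow]
  have h2 : ∏ i, d i ^ 2 = |∏ i, d i| * |∏ i, d i| := by
    rw [abs_mul_abs_self, ← Finset.prod_mul_distrib]
    exact Finset.prod_congr rfl fun i _ => sq (d i)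
  rw [h2]
  ring

/-- The Kac–Rice density in terms of the covariance of the normalized Hessian. -/
theorem critDensity_eq {σ : ι → ℝ} (hσ : ∀ i, 0 < σ i) (f : N → (ι → ℝ) → ℝ) {s : ℝ}
    (hs : 0 < s) :
    critDensity σ f = ENNReal.ofReal (∏ i, (√(2 * Real.pi))⁻¹ * √(σ i / s)) *
      gaussAbsDet (covMatrix fun n t => √s * (√(σ t.1))⁻¹ * (√(σ t.2))⁻¹ * hessVec (f n) t) := by
  rw [critDensity, gaussAbsDet_covMatrix_scale (fun n => hessVec (f n)) (√s)
    (fun i => (√(σ i))⁻¹), ← mul_assoc, ← ENNReal.ofReal_mul (by positivity)]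
  congr 2
  rw [← Finset.card_univ, ← Finset.prod_const, ← Finset.prod_mul_distrib,
    ← Finset.prod_mul_distrib]
  refine Finset.prod_congr rfl fun i _ => ?_
  have h1 : √(σ i) ≠ 0 := (Real.sqrt_pos.2 (hσ i)).ne'
  have h2 : √s ≠ 0 := (Real.sqrt_pos.2 hs).ne'
  rw [Real.sqrt_mul (by positivity), Real.sqrt_div (hσ i).le, abs_of_nonneg (Real.sqrt_nonneg s)]
  field_simp

end Rescaling

/-! ### Product functions and the limiting covariance -/

section Products

variable {ι₁ ι₂ N₁ N₂ : Type*}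

/-- The function `a ↦ u(a₁) w(a₂)` in the coordinates of a product. -/
def prodFun (u : (ι₁ → ℝ) → ℝ) (w : (ι₂ → ℝ) → ℝ) (a : ι₁ ⊕ ι₂ → ℝ) : ℝ :=
  u (a ∘ Sum.inl) * w (a ∘ Sum.inr)

theorem contDiff_prodFun [Fintype ι₁] [Fintype ι₂] {u : (ι₁ → ℝ) → ℝ} {w : (ι₂ → ℝ) → ℝ}
    (hu : ContDiff ℝ ∞ u) (hw : ContDiff ℝ ∞ w) : ContDiff ℝ ∞ (prodFun u w) := by
  refine (hu.comp ?_).mul (hw.comp ?_) <;> exact contDiff_pi.2 fun i => contDiff_apply _ _ _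

variable [DecidableEq ι₁] [DecidableEq ι₂]

/-- The covariance of the normalized Hessian of a product of two isotropic fields. -/
def isoCov (r₁ q₁ r₂ q₂ : ℝ) : Matrix ((ι₁ ⊕ ι₂) × (ι₁ ⊕ ι₂)) ((ι₁ ⊕ ι₂) × (ι₁ ⊕ ι₂)) ℝ :=
  Matrix.of fun s t => match s, t with
    | (Sum.inl i, Sum.inl j), (Sum.inl l, Sum.inl m) =>
      r₁ * ((if i = l then 1 else 0) * (if j = m then 1 else 0) +
        (if i = m then 1 else 0) * (if j = l then 1 else 0) +
        (if i = j then 1 else 0) * (if l = m then 1 else 0)) +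
      q₁ * ((if i = j then 1 else 0) * (if l = m then 1 else 0))
    | (Sum.inr i, Sum.inr j), (Sum.inr l, Sum.inr m) =>
      r₂ * ((if i = l then 1 else 0) * (if j = m then 1 else 0) +
        (if i = m then 1 else 0) * (if j = l then 1 else 0) +
        (if i = j then 1 else 0) * (if l = m then 1 else 0)) +
      q₂ * ((if i = j then 1 else 0) * (if l = m then 1 else 0))
    | (Sum.inl i, Sum.inl j), (Sum.inr l, Sum.inr m) =>
      (if i = j then 1 else 0) * (if l = m then 1 else 0)
    | (Sum.inr i, Sum.inr j), (Sum.inl l, Sum.inl m) =>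
      (if i = j then 1 else 0) * (if l = m then 1 else 0)
    | (Sum.inl i, Sum.inr j), (Sum.inl l, Sum.inr m) =>
      (if i = l then 1 else 0) * (if j = m then 1 else 0)
    | (Sum.inl i, Sum.inr j), (Sum.inr m, Sum.inl l) =>
      (if i = l then 1 else 0) * (if j = m then 1 else 0)
    | (Sum.inr j, Sum.inl i), (Sum.inl l, Sum.inr m) =>
      (if i = l then 1 else 0) * (if j = m then 1 else 0)
    | (Sum.inr j, Sum.inl i), (Sum.inr m, Sum.inl l) =>
      (if i = l then 1 else 0) * (if j = m then 1 else 0)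
    | _, _ => 0

theorem continuous_isoCov : Continuous fun p : (ℝ × ℝ) × (ℝ × ℝ) =>
    (isoCov p.1.1 p.1.2 p.2.1 p.2.2 :
      Matrix ((ι₁ ⊕ ι₂) × (ι₁ ⊕ ι₂)) ((ι₁ ⊕ ι₂) × (ι₁ ⊕ ι₂)) ℝ) := by
  refine continuous_matrix fun s t => ?_
  obtain ⟨i | i, j | j⟩ := s <;> obtain ⟨l | l, m | m⟩ := t <;>
    simp only [isoCov, Matrix.of_apply] <;> fun_prop

variable [Fintype ι₁] [Fintype ι₂]

theorem grad_prodFun {u : (ι₁ → ℝ) → ℝ} {w : (ι₂ → ℝ) → ℝ} (hu : Differentiable ℝ u)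
    (hw : Differentiable ℝ w) (a : ι₁ ⊕ ι₂ → ℝ) :
    (∀ i, grad (prodFun u w) a (Sum.inl i) = prodFun (fun b => grad u b i) w a) ∧
    ∀ j, grad (prodFun u w) a (Sum.inr j) = prodFun u (fun b => grad w b j) a := by
  set P₁ : (ι₁ ⊕ ι₂ → ℝ) →L[ℝ] (ι₁ → ℝ) :=
    ContinuousLinearMap.pi fun i => ContinuousLinearMap.proj (Sum.inl i)
  set P₂ : (ι₁ ⊕ ι₂ → ℝ) →L[ℝ] (ι₂ → ℝ) :=
    ContinuousLinearMap.pi fun i => ContinuousLinearMap.proj (Sum.inr i)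
  have h1 : HasFDerivAt (fun a : ι₁ ⊕ ι₂ → ℝ => u (P₁ a)) ((fderiv ℝ u (P₁ a)).comp P₁) a :=
    (hu _).hasFDerivAt.comp a P₁.hasFDerivAt
  have h2 : HasFDerivAt (fun a : ι₁ ⊕ ι₂ → ℝ => w (P₂ a)) ((fderiv ℝ w (P₂ a)).comp P₂) a :=
    (hw _).hasFDerivAt.comp a P₂.hasFDerivAt
  have h : fderiv ℝ (prodFun u w) a = u (P₁ a) • (fderiv ℝ w (P₂ a)).comp P₂ +
      w (P₂ a) • (fderiv ℝ u (P₁ a)).comp P₁ := (h1.mul h2).fderiv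
  have e11 : ∀ i, P₁ (Pi.single (Sum.inl i) 1) = Pi.single i 1 := fun i => by
    ext j; simp [P₁, Pi.single_apply]
  have e12 : ∀ i, P₁ (Pi.single (Sum.inr i) 1) = 0 := fun i => by
    ext j; simp [P₁]
  have e21 : ∀ i, P₂ (Pi.single (Sum.inl i) 1) = 0 := fun i => by
    ext j; simp [P₂]
  have e22 : ∀ i, P₂ (Pi.single (Sum.inr i) 1) = Pi.single i 1 := fun i => by
    ext j; simp [P₂, Pi.single_apply]
  constructor
  · intro i
    simp only [grad, h, add_apply, smul_apply, ContinuousLinearMap.comp_apply, e11, e21, map_zero,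
      mul_zero, zero_add, smul_eq_mul]
    exact mul_comm (w (P₂ a)) _
  · intro j
    simp only [grad, h, add_apply, smul_apply, ContinuousLinearMap.comp_apply, e12, e22, map_zero,
      mul_zero, add_zero, smul_eq_mul]
    rfl

theorem hessVec_eq_grad_grad {ι : Type*} [Fintype ι] [DecidableEq ι] {f : (ι → ℝ) → ℝ}
    (hf : ContDiff ℝ ∞ f) (s : ι × ι) : hessVec f s = grad (fun b => grad f b s.1) 0 s.2 := by
  rw [hessVec, ← fderiv_grad_apply hf]
  have := hasFDerivAt_pi'.1 ((contDiff_grad hf).differentiable one_ne_zero 0).hasFDerivAt s.1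
  simp only [grad]
  simp only [grad] at this
  rw [this.fderiv]
  rfl

theorem hessVec_prodFun {u : (ι₁ → ℝ) → ℝ} {w : (ι₂ → ℝ) → ℝ} (hu : ContDiff ℝ ∞ u)
    (hw : ContDiff ℝ ∞ w) :
    (∀ i j, hessVec (prodFun u w) (Sum.inl i, Sum.inl j) = hessVec u (i, j) * w 0) ∧
    (∀ i j, hessVec (prodFun u w) (Sum.inl i, Sum.inr j) = grad u 0 i * grad w 0 j) ∧
    (∀ i j, hessVec (prodFun u w) (Sum.inr j, Sum.inl i) = grad u 0 i * grad w 0 j) ∧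
    (∀ i j, hessVec (prodFun u w) (Sum.inr i, Sum.inr j) = u 0 * hessVec w (i, j)) := by
  have hud := hu.differentiable (by simp)
  have hwd := hw.differentiable (by simp)
  have hug : ∀ i, Differentiable ℝ fun b => grad u b i := fun i =>
    (contDiff_pi.1 (contDiff_grad hu) i).differentiable one_ne_zero
  have hwg : ∀ i, Differentiable ℝ fun b => grad w b i := fun i =>
    (contDiff_pi.1 (contDiff_grad hw) i).differentiable one_ne_zero
  simp only [hessVec_eq_grad_grad (contDiff_prodFun hu hw), hessVec_eq_grad_grad hu,
    hessVec_eq_grad_grad hw, (grad_prodFun hud hwd _).1, (grad_prodFun hud hwd _).2,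
    (grad_prodFun (hug _) hwd _).1, (grad_prodFun (hug _) hwd _).2,
    (grad_prodFun hud (hwg _) _).1, (grad_prodFun hud (hwg _) _).2]
  exact ⟨fun i j => rfl, fun i j => rfl, fun i j => rfl, fun i j => rfl⟩

/-- `gaussAbsDet_pos` is tested on the identity of the second block. The covariance maps it to the
diagonal matrix with entries `card ι₂` on the first block and `r₂ (card ι₂ + 2)` on the second. The
vanishing last parameter is its value in the limit of large degree. -/
theorem gaussAbsDet_isoCov_pos [Nonempty ι₂] {r₁ q₁ r₂ : ℝ} (hr : 0 < r₂)
    (h : (isoCov r₁ q₁ r₂ 0 :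
      Matrix ((ι₁ ⊕ ι₂) × (ι₁ ⊕ ι₂)) ((ι₁ ⊕ ι₂) × (ι₁ ⊕ ι₂)) ℝ).PosSemidef) :
    0 < gaussAbsDet (isoCov r₁ q₁ r₂ 0 :
      Matrix ((ι₁ ⊕ ι₂) × (ι₁ ⊕ ι₂)) ((ι₁ ⊕ ι₂) × (ι₁ ⊕ ι₂)) ℝ) := by
  set k : ℝ := (Fintype.card ι₂ : ℝ) with hk
  have hk0 : 0 < k := by rw [hk]; exact_mod_cast Fintype.card_pos
  set y : EuclideanSpace ℝ ((ι₁ ⊕ ι₂) × (ι₁ ⊕ ι₂)) := WithLp.toLp 2 fun s =>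
    Sum.elim (fun _ => 0) (fun i => Sum.elim (fun _ => 0) (fun j => if i = j then 1 else 0) s.2) s.1
    with hy
  refine gaussAbsDet_pos h y ?_
  have hsum : ∀ C : Matrix ((ι₁ ⊕ ι₂) × (ι₁ ⊕ ι₂)) ((ι₁ ⊕ ι₂) × (ι₁ ⊕ ι₂)) ℝ, ∀ s,
      Matrix.toEuclideanCLM (𝕜 := ℝ) C y s = ∑ i : ι₂, C s (Sum.inr i, Sum.inr i) := by
    intro C s
    have : Matrix.toEuclideanCLM (𝕜 := ℝ) C y s = (C.mulVec y.ofLp) s := rfl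
    rw [this]
    simp [Matrix.mulVec, dotProduct, hy, Fintype.sum_prod_type]
  have hdiag : toSquare (Matrix.toEuclideanCLM (𝕜 := ℝ) (isoCov r₁ q₁ r₂ 0 :
      Matrix ((ι₁ ⊕ ι₂) × (ι₁ ⊕ ι₂)) ((ι₁ ⊕ ι₂) × (ι₁ ⊕ ι₂)) ℝ) y) =
      Matrix.diagonal (Sum.elim (fun _ => k) fun _ => r₂ * (k + 2)) := by
    ext s t
    simp only [toSquare, Matrix.of_apply, hsum]
    obtain i | i := s <;> obtain j | j := t
    · by_cases hij : i = j
      · simp [isoCov, hij, hk]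
      · simp [isoCov, hij]
    · simp [isoCov]
    · simp [isoCov]
    · by_cases hij : i = j
      · subst hij
        simp [isoCov, ← Finset.mul_sum, Finset.sum_add_distrib, hk]
        left
        ring
      · simp [isoCov, hij, ← Finset.mul_sum, Finset.sum_add_distrib,
          Ne.symm hij]
  rw [hdiag, Matrix.det_diagonal]
  refine Finset.prod_ne_zero_iff.2 fun i _ => ?_
  obtain i | i := i
  · exact hk0.ne'
  · simp only [Sum.elim_inr]
    positivity

end Products

/-! ### Two-jets of products of isotropic fields -/

section ProductJets

variable {ι₁ ι₂ N₁ N₂ : Type*} [DecidableEq ι₁] [DecidableEq ι₂]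
  [Fintype N₁] [Fintype N₂] {U : N₁ → (ι₁ → ℝ) → ℝ} {W : N₂ → (ι₂ → ℝ) → ℝ}
  {z z₁ z₂ y y₁ y₂ : ℝ}

/-- Covariances over a product family factor, so every second order statistic of the product is a
product of entries of the two `IsotropicJet` structures. -/
theorem sum_sum_mul_mul (a b : N₁ → ℝ) (c d : N₂ → ℝ) :
    ∑ m, ∑ n, (a m * c n) * (b m * d n) = (∑ n, a n * b n) * ∑ n, c n * d n := by
  rw [Finset.sum_mul_sum]
  exact Finset.sum_congr rfl fun m _ => Finset.sum_congr rfl fun n _ => by ring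

theorem IsotropicJet.hess_val (h : IsotropicJet U z z₁ z₂) (i j : ι₁) :
    ∑ n, hessVec (U n) (i, j) * U n 0 = -z₁ * if i = j then 1 else 0 := by
  rw [← h.val_hess]
  exact Finset.sum_congr rfl fun n _ => mul_comm _ _

theorem IsotropicJet.hess_grad (h : IsotropicJet U z z₁ z₂) (i j l : ι₁) :
    ∑ n, hessVec (U n) (i, j) * grad (U n) 0 l = 0 := by
  rw [← h.grad_hess l i j]
  exact Finset.sum_congr rfl fun n _ => mul_comm _ _

theorem IsotropicJet.grad_val (h : IsotropicJet U z z₁ z₂) (i : ι₁) :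
    ∑ n, grad (U n) 0 i * U n 0 = 0 := by
  rw [← h.val_grad i]
  exact Finset.sum_congr rfl fun n _ => mul_comm _ _

variable [Fintype ι₁] [Fintype ι₂]

theorem grad_grad_prodFun (hU : ∀ n, ContDiff ℝ ∞ (U n)) (hW : ∀ n, ContDiff ℝ ∞ (W n))
    (h : IsotropicJet U z z₁ z₂) (h' : IsotropicJet W y y₁ y₂) (i j : ι₁ ⊕ ι₂) :
    ∑ n : N₁ × N₂, grad (prodFun (U n.1) (W n.2)) 0 i * grad (prodFun (U n.1) (W n.2)) 0 j =
      if i = j then Sum.elim (fun _ => z₁ * y) (fun _ => z * y₁) i else 0 := by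
  have hg := fun n : N₁ × N₂ => grad_prodFun ((hU n.1).differentiable (by simp))
    ((hW n.2).differentiable (by simp)) 0
  obtain i | i := i <;> obtain j | j := j <;>
    simp only [(hg _).1, (hg _).2, prodFun, Pi.zero_comp, Fintype.sum_prod_type,
      sum_sum_mul_mul, h.grad_grad,
      h'.grad_grad, h.val_val, h'.val_val, h.val_grad, h'.val_grad, h.grad_val, h'.grad_val,
      zero_mul, mul_zero, Sum.inl.injEq, Sum.inr.injEq, reduceCtorEq, if_false, Sum.elim_inl,
      Sum.elim_inr, ite_mul, mul_ite, mul_one]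

theorem grad_hessVec_prodFun (hU : ∀ n, ContDiff ℝ ∞ (U n)) (hW : ∀ n, ContDiff ℝ ∞ (W n))
    (h : IsotropicJet U z z₁ z₂) (h' : IsotropicJet W y y₁ y₂) (i : ι₁ ⊕ ι₂)
    (s : (ι₁ ⊕ ι₂) × (ι₁ ⊕ ι₂)) :
    ∑ n : N₁ × N₂, grad (prodFun (U n.1) (W n.2)) 0 i * hessVec (prodFun (U n.1) (W n.2)) s
      = 0 := by
  have hg := fun n : N₁ × N₂ => grad_prodFun ((hU n.1).differentiable (by simp))
    ((hW n.2).differentiable (by simp)) 0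
  have hh := fun n : N₁ × N₂ => hessVec_prodFun (hU n.1) (hW n.2)
  obtain i | i := i <;> obtain ⟨j | j, l | l⟩ := s <;>
    simp only [(hg _).1, (hg _).2, (hh _).1, (hh _).2.1, (hh _).2.2.1, (hh _).2.2.2, prodFun,
      Pi.zero_comp, Fintype.sum_prod_type,
      sum_sum_mul_mul, h.grad_hess, h'.grad_hess, h.val_grad, h'.val_grad,
      h.grad_val, h'.grad_val, zero_mul, mul_zero]

theorem covMatrix_prodFun (hU : ∀ n, ContDiff ℝ ∞ (U n)) (hW : ∀ n, ContDiff ℝ ∞ (W n))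
    (h : IsotropicJet U z z₁ z₂) (h' : IsotropicJet W y y₁ y₂) (hz : 0 < z) (hz₁ : 0 < z₁)
    (hy : 0 < y) (hy₁ : 0 < y₁) :
    (covMatrix fun (n : N₁ × N₂) (t : (ι₁ ⊕ ι₂) × (ι₁ ⊕ ι₂)) => √(z * y) *
      (√(Sum.elim (fun _ => z₁ * y) (fun _ => z * y₁) t.1))⁻¹ *
      (√(Sum.elim (fun _ => z₁ * y) (fun _ => z * y₁) t.2))⁻¹ *
        hessVec (prodFun (U n.1) (W n.2)) t) =
      isoCov (z₂ * z / z₁ ^ 2) (z / z₁) (y₂ * y / y₁ ^ 2) (y / y₁) := by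
  have hh := fun m n => hessVec_prodFun (hU m) (hW n)
  ext s t
  have hs : √(z * y) * √(z * y) = z * y := Real.mul_self_sqrt (by positivity)
  have h1 : √(z₁ * y) * √(z₁ * y) = z₁ * y := Real.mul_self_sqrt (by positivity)
  have h2 : √(z * y₁) * √(z * y₁) = z * y₁ := Real.mul_self_sqrt (by positivity)
  set S := √(z * y) with S_def
  set A := √(z₁ * y) with A_def
  set B := √(z * y₁) with B_def
  have hA : A ≠ 0 := by intro h0; rw [h0] at h1; have : 0 < z₁ * y := by positivity
                        linarith
  have hB : B ≠ 0 := by intro h0; rw [h0] at h2; have : 0 < z * y₁ := by positivity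
                        linarith
  have hpull : ∀ (c c' : ℝ) (f g : N₁ × N₂ → ℝ), ∑ n, c * f n * (c' * g n) =
      c * c' * ∑ n, f n * g n := by
    intro c c' f g
    rw [Finset.mul_sum]
    exact Finset.sum_congr rfl fun n _ => by ring
  -- Products of two normalizing factors, one for each pattern of blocks; in each of them the square
  -- roots pair up.
  have k1 : S * A⁻¹ * A⁻¹ * (S * A⁻¹ * A⁻¹) = z / (z₁ ^ 2 * y) := by
    calc _ = (S * S) / ((A * A) * (A * A)) := by field_simp
      _ = _ := by rw [hs, h1]; field_simp
  have k2 : S * B⁻¹ * B⁻¹ * (S * B⁻¹ * B⁻¹) = y / (y₁ ^ 2 * z) := by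
    calc _ = (S * S) / ((B * B) * (B * B)) := by field_simp
      _ = _ := by rw [hs, h2]; field_simp
  have k3 : S * A⁻¹ * A⁻¹ * (S * B⁻¹ * B⁻¹) = 1 / (z₁ * y₁) := by
    calc _ = (S * S) / ((A * A) * (B * B)) := by field_simp
      _ = _ := by rw [hs, h1, h2]; field_simp
  have k4 : S * B⁻¹ * B⁻¹ * (S * A⁻¹ * A⁻¹) = 1 / (z₁ * y₁) := by rw [← k3]; ring
  have k5 : S * A⁻¹ * B⁻¹ * (S * A⁻¹ * B⁻¹) = 1 / (z₁ * y₁) := by rw [← k3]; ring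
  have k6 : S * A⁻¹ * B⁻¹ * (S * B⁻¹ * A⁻¹) = 1 / (z₁ * y₁) := by rw [← k3]; ring
  have k7 : S * B⁻¹ * A⁻¹ * (S * A⁻¹ * B⁻¹) = 1 / (z₁ * y₁) := by rw [← k3]; ring
  have k8 : S * B⁻¹ * A⁻¹ * (S * B⁻¹ * A⁻¹) = 1 / (z₁ * y₁) := by rw [← k3]; ring
  obtain ⟨i | i, j | j⟩ := s <;> obtain ⟨l | l, m | m⟩ := t <;>
    simp only [covMatrix, isoCov, Matrix.of_apply, Sum.elim_inl, Sum.elim_inr, ← S_def,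
      ← A_def, ← B_def, hpull] <;>
    simp only [k1, k2, k3, k4, k5, k6, k7, k8, (hh _ _).1, (hh _ _).2.1, (hh _ _).2.2.1,
      (hh _ _).2.2.2, Fintype.sum_prod_type, sum_sum_mul_mul,
      h.val_val, h'.val_val, h.val_hess, h'.val_hess, h.hess_val, h'.hess_val, h.hess_hess,
      h'.hess_hess, h.grad_hess, h'.grad_hess, h.hess_grad, h'.hess_grad, h.val_grad, h'.val_grad,
      h.grad_val, h'.grad_val, h.grad_grad, h'.grad_grad, zero_mul, mul_zero]
  all_goals field_simp

/-- Taking `s` in `critDensity_eq` to be the variance `z * y` of the value reduces each `σ i / s` to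
a ratio belonging to one factor, `z₁ / z` or `y₁ / y`. -/
theorem critDensity_prodFun (hU : ∀ n, ContDiff ℝ ∞ (U n)) (hW : ∀ n, ContDiff ℝ ∞ (W n))
    (h : IsotropicJet U z z₁ z₂) (h' : IsotropicJet W y y₁ y₂) (hz : 0 < z) (hz₁ : 0 < z₁)
    (hy : 0 < y) (hy₁ : 0 < y₁) :
    critDensity (Sum.elim (fun _ => z₁ * y) (fun _ => z * y₁) : ι₁ ⊕ ι₂ → ℝ)
      (fun n : N₁ × N₂ => prodFun (U n.1) (W n.2)) =
      ENNReal.ofReal ((√(2 * Real.pi))⁻¹ ^ (Fintype.card ι₁ + Fintype.card ι₂) *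
        (√(z₁ / z) ^ Fintype.card ι₁ * √(y₁ / y) ^ Fintype.card ι₂)) *
      gaussAbsDet (isoCov (z₂ * z / z₁ ^ 2) (z / z₁) (y₂ * y / y₁ ^ 2) (y / y₁) :
        Matrix ((ι₁ ⊕ ι₂) × (ι₁ ⊕ ι₂)) ((ι₁ ⊕ ι₂) × (ι₁ ⊕ ι₂)) ℝ) := by
  rw [critDensity_eq (s := z * y) (by rintro (i | i) <;> simp <;> positivity) _ (by positivity),
    covMatrix_prodFun hU hW h h' hz hz₁ hy hy₁]
  congr 2
  have e1 : z₁ * y / (z * y) = z₁ / z := by field_simp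
  have e2 : z * y₁ / (z * y) = y₁ / y := by field_simp
  simp only [Fintype.prod_sum_type, Sum.elim_inl, Sum.elim_inr, e1, e2, Finset.prod_const,
    Finset.card_univ, mul_pow, pow_add]
  ring

end ProductJets

/-! ### Stereographic charts of the sphere -/

section Charts

open Metric

variable {F : Type*} [NormedAddCommGroup F] [InnerProductSpace ℝ F] {n : ℕ}
  [Fact (Module.finrank ℝ F = n + 1)]

theorem inner_stereographic_symm (v : sphere (0 : F) 1) (x y : EuclideanSpace ℝ (Fin n)) :
    inner ℝ ((stereographic' n v).symm x : F) ((stereographic' n v).symm y : F) =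
      stereoInner x.ofLp y.ofLp := by
  rw [stereographic'_symm_apply, stereographic'_symm_apply]
  set U : (ℝ ∙ (v : F))ᗮ ≃ₗᵢ[ℝ] EuclideanSpace ℝ (Fin n) :=
    (OrthonormalBasis.fromOrthogonalSpanSingleton n (ne_zero_of_mem_unit_sphere v)).repr
  have hU : ∀ x y, inner ℝ (U.symm x : F) (U.symm y : F) = x.ofLp ⬝ᵥ y.ofLp := by
    intro x y
    rw [← Submodule.coe_inner, U.symm.inner_map_map, PiLp.inner_apply]
    simp [dotProduct, mul_comm]
  have hn : ∀ x, ‖(U.symm x : F)‖ ^ 2 = x.ofLp ⬝ᵥ x.ofLp := fun x => by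
    rw [← real_inner_self_eq_norm_sq, hU]
  have hv : ∀ x, inner ℝ (U.symm x : F) (v : F) = 0 := fun x =>
    Submodule.inner_left_of_mem_orthogonal (Submodule.mem_span_singleton_self _) (U.symm x).2
  have hv' : ∀ x, inner ℝ (v : F) (U.symm x : F) = 0 := fun x => by
    rw [real_inner_comm, hv]
  have hvv : inner ℝ (v : F) (v : F) = 1 := by
    rw [real_inner_self_eq_norm_sq, norm_eq_of_mem_sphere, one_pow]
  have hpos : ∀ x : EuclideanSpace ℝ (Fin n), x.ofLp ⬝ᵥ x.ofLp + 4 ≠ 0 := fun x => by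
    rw [← hn]; positivity
  simp only [hn, inner_add_left, inner_add_right, real_inner_smul_left, real_inner_smul_right, hU,
    hv, hv', hvv, stereoInner]
  have h1 := hpos x
  have h2 := hpos y
  field_simp
  ring

theorem extChartAt_sphere_symm (v : sphere (0 : F) 1) (x : EuclideanSpace ℝ (Fin n)) :
    (extChartAt (𝓡 n) v).symm x = (stereographic' n (-v)).symm x := rfl

theorem extChartAt_sphere_target (v : sphere (0 : F) 1) :
    (extChartAt (𝓡 n) v).target = Set.univ := by
  rw [extChartAt_target]
  change (𝓡 n).symm ⁻¹' (stereographic' n (-v)).target ∩ Set.range (𝓡 n) = Set.univ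
  rw [stereographic'_target]
  simp

theorem extChartAt_sphere_self (v : sphere (0 : F) 1) : extChartAt (𝓡 n) v v = 0 := by
  change stereographic' n (-v) v = 0
  simp only [stereographic', OpenPartialHomeomorph.coe_trans, Function.comp]
  have : stereographic (norm_eq_of_mem_sphere (-v)) v = 0 := by
    exact stereographic_neg_apply v
  rw [this]
  exact map_zero (OrthonormalBasis.fromOrthogonalSpanSingleton n
    (ne_zero_of_mem_unit_sphere (-v))).repr

/-- The chart at `v` is onto the whole Euclidean space and turns the inner product into
`stereoInner`, whatever the centre, so `isotropicJet_of_kernel` applies. -/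
theorem isotropicJet_sphere {N : Type*} [Fintype N] (v : sphere (0 : F) 1)
    {w : N → Smooth (𝓡 n) (sphere (0 : F) 1)} {Z : Polynomial ℝ}
    (hZ : ∀ x y, ∑ l, w l x * w l y = Z.eval (inner ℝ (x : F) (y : F))) :
    IsotropicJet (fun l (a : Fin n → ℝ) => w l ((extChartAt (𝓡 n) v).symm (WithLp.toLp 2 a)))
      (Z.eval 1) (Z.derivative.eval 1) (Z.derivative.derivative.eval 1) := by
  refine isotropicJet_of_kernel (fun l => ?_) fun x y => ?_
  · have := contDiffOn_comp_extChartAt_symm (w l) v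
    rw [extChartAt_sphere_target, contDiffOn_univ] at this
    refine ContDiff.of_le (n := ∞) (this.comp
      (EuclideanSpace.equiv (Fin n) ℝ).symm.contDiff) (by norm_cast)
  · rw [hZ, extChartAt_sphere_symm, extChartAt_sphere_symm, inner_stereographic_symm]

end Charts

/-! ### The circle as the unit sphere of ℂ -/

section CircleChart

theorem extChartAt_circle_target (z : Circle) : (extChartAt (𝓡 1) z).target = Set.univ :=
  have := finrank_real_complex_fact'
  extChartAt_sphere_target (F := ℂ) (n := 1) z

theorem extChartAt_circle_self (z : Circle) : extChartAt (𝓡 1) z z = 0 :=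
  have := finrank_real_complex_fact'
  extChartAt_sphere_self (F := ℂ) (n := 1) z

theorem isotropicJet_circle {N : Type*} [Fintype N] (z : Circle)
    {u : N → Smooth (𝓡 1) Circle} {Z : Polynomial ℝ}
    (hZ : ∀ x y, ∑ l, u l x * u l y = Z.eval (inner ℝ (x : ℂ) (y : ℂ))) :
    IsotropicJet (fun l (a : Fin 1 → ℝ) => u l ((extChartAt (𝓡 1) z).symm (WithLp.toLp 2 a)))
      (Z.eval 1) (Z.derivative.eval 1) (Z.derivative.derivative.eval 1) :=
  have := finrank_real_complex_fact'
  isotropicJet_sphere (F := ℂ) (n := 1) z hZ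

end CircleChart

/-! ### Charts of a product -/

section ProductChart

variable {n₁ n₂ : ℕ} {H₁ : Type*} [TopologicalSpace H₁]
  {I₁ : ModelWithCorners ℝ (EuclideanSpace ℝ (Fin n₁)) H₁}
  {M₁ : Type*} [TopologicalSpace M₁] [ChartedSpace H₁ M₁]
  {H₂ : Type*} [TopologicalSpace H₂] {I₂ : ModelWithCorners ℝ (EuclideanSpace ℝ (Fin n₂)) H₂}
  {M₂ : Type*} [TopologicalSpace M₂] [ChartedSpace H₂ M₂]

/-- Coordinates on a product of two Euclidean spaces. -/
noncomputable def prodCoord (n₁ n₂ : ℕ) : (Fin n₁ ⊕ Fin n₂ → ℝ) ≃L[ℝ]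
    EuclideanSpace ℝ (Fin n₁) × EuclideanSpace ℝ (Fin n₂) :=
  ContinuousLinearEquiv.trans
    (ContinuousLinearEquiv.sumPiEquivProdPi ℝ (Fin n₁) (Fin n₂) fun _ => ℝ)
    ((EuclideanSpace.equiv (Fin n₁) ℝ).symm.prodCongr (EuclideanSpace.equiv (Fin n₂) ℝ).symm)

theorem prodCoord_apply (a : Fin n₁ ⊕ Fin n₂ → ℝ) : prodCoord n₁ n₂ a =
    (WithLp.toLp 2 (a ∘ Sum.inl), WithLp.toLp 2 (a ∘ Sum.inr)) := rfl

theorem extMul_comp_chart (p : M₁ × M₂) (u : Smooth I₁ M₁) (w : Smooth I₂ M₂) :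
    (extMul u w : M₁ × M₂ → ℝ) ∘ (fun a => (extChartAt (I₁.prod I₂) p).symm (prodCoord n₁ n₂ a)) =
      prodFun (fun a => u ((extChartAt I₁ p.1).symm (WithLp.toLp 2 a)))
        (fun a => w ((extChartAt I₂ p.2).symm (WithLp.toLp 2 a))) := by
  funext a
  simp only [Function.comp, extChartAt_prod, prodCoord_apply]
  rfl

end ProductChart

/-! ### The trigonometric system and its kernel -/

section TrigonometricSystem

open Real

theorem trigFun_zero_exp (θ : ℝ) : trigFun 0 (Circle.exp θ) = (√(2 * π))⁻¹ := by
  simp only [trigFun, if_true]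
  exact mul_one _

theorem trigFun_neg_exp {m : ℤ} (hm : m < 0) (θ : ℝ) :
    trigFun m (Circle.exp θ) = (√π)⁻¹ * cos (m * θ) := by
  simp only [trigFun, hm.ne, if_false, hm, if_true]
  exact congrArg _ (cosFun_exp m θ)

theorem trigFun_pos_exp {m : ℤ} (hm : 0 < m) (θ : ℝ) :
    trigFun m (Circle.exp θ) = (√π)⁻¹ * sin (m * θ) := by
  simp only [trigFun, hm.ne', if_false, hm.not_gt]
  exact congrArg _ (sinFun_exp m θ)

theorem integral_arcLength {f : Circle → ℝ} (hf : Continuous f) :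
    ∫ z, f z ∂arcLength = ∫ θ in (-π)..π, f (Circle.exp θ) := by
  rw [arcLength, integral_map Circle.exp.continuous.measurable.aemeasurable
    hf.aestronglyMeasurable, intervalIntegral.integral_of_le (by linarith [pi_pos])]

theorem integral_cos_int_mul (j : ℤ) :
    ∫ θ in (-π)..π, cos (j * θ) = if j = 0 then 2 * π else 0 := by
  split_ifs with h
  · simp [h]; ring
  · have hj : (j : ℝ) ≠ 0 := by exact_mod_cast h
    rw [intervalIntegral.integral_comp_mul_left (fun x => cos x) hj, integral_cos]
    simp [sin_int_mul_pi]

theorem integral_sin_int_mul (j : ℤ) : ∫ θ in (-π)..π, sin (j * θ) = 0 := by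
  rcases eq_or_ne j 0 with rfl | h
  · simp
  · have hj : (j : ℝ) ≠ 0 := by exact_mod_cast h
    rw [intervalIntegral.integral_comp_mul_left (fun x => sin x) hj, integral_sin]
    simp

theorem integral_cos_mul_cos (m n : ℤ) : ∫ θ in (-π)..π, cos (m * θ) * cos (n * θ) =
    (if m = n then π else 0) + if m = -n then π else 0 := by
  have h : ∀ θ, cos (m * θ) * cos (n * θ) =
      2⁻¹ * (cos ((m - n : ℤ) * θ) + cos ((m + n : ℤ) * θ)) := by
    intro θ
    push_cast
    rw [sub_mul, add_mul, cos_sub, cos_add]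
    ring
  simp only [h]
  rw [intervalIntegral.integral_const_mul, intervalIntegral.integral_add
    ((by fun_prop : Continuous _).intervalIntegrable _ _)
    ((by fun_prop : Continuous _).intervalIntegrable _ _),
    integral_cos_int_mul, integral_cos_int_mul]
  simp only [sub_eq_zero, add_eq_zero_iff_eq_neg]
  split_ifs <;> ring

theorem integral_sin_mul_sin (m n : ℤ) : ∫ θ in (-π)..π, sin (m * θ) * sin (n * θ) =
    (if m = n then π else 0) - if m = -n then π else 0 := by
  have h : ∀ θ, sin (m * θ) * sin (n * θ) =
      2⁻¹ * (cos ((m - n : ℤ) * θ) - cos ((m + n : ℤ) * θ)) := by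
    intro θ
    push_cast
    rw [sub_mul, add_mul, cos_sub, cos_add]
    ring
  simp only [h]
  rw [intervalIntegral.integral_const_mul, intervalIntegral.integral_sub
    ((by fun_prop : Continuous _).intervalIntegrable _ _)
    ((by fun_prop : Continuous _).intervalIntegrable _ _),
    integral_cos_int_mul, integral_cos_int_mul]
  simp only [sub_eq_zero, add_eq_zero_iff_eq_neg]
  split_ifs <;> ring

theorem integral_sin_mul_cos (m n : ℤ) : ∫ θ in (-π)..π, sin (m * θ) * cos (n * θ) = 0 := by
  have h : ∀ θ, sin (m * θ) * cos (n * θ) =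
      2⁻¹ * (sin ((m - n : ℤ) * θ) + sin ((m + n : ℤ) * θ)) := by
    intro θ
    push_cast
    rw [sub_mul, add_mul, sin_sub, sin_add]
    ring
  simp only [h]
  rw [intervalIntegral.integral_const_mul, intervalIntegral.integral_add
    ((by fun_prop : Continuous _).intervalIntegrable _ _)
    ((by fun_prop : Continuous _).intervalIntegrable _ _),
    integral_sin_int_mul, integral_sin_int_mul]
  simp

theorem integral_trigFun_mul (m n : ℤ) :
    ∫ z, trigFun m z * trigFun n z ∂arcLength = if m = n then 1 else 0 := by
  rw [integral_arcLength (f := fun z => trigFun m z * trigFun n z)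
    ((trigFun m).contMDiff.continuous.mul (trigFun n).contMDiff.continuous)]
  have hp : (√π)⁻¹ * (√π)⁻¹ * π = 1 := by
    rw [← mul_inv, mul_self_sqrt pi_pos.le, inv_mul_cancel₀ pi_ne_zero]
  have h2p : (√(2 * π))⁻¹ * (√(2 * π))⁻¹ * (2 * π) = 1 := by
    rw [← mul_inv, mul_self_sqrt (by positivity), inv_mul_cancel₀ (by positivity)]
  have hre : ∀ x y : ℝ, (√π)⁻¹ * x * ((√π)⁻¹ * y) = (√π)⁻¹ * (√π)⁻¹ * (x * y) :=
    fun x y => by ring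
  rcases lt_trichotomy m 0 with hm | rfl | hm <;> rcases lt_trichotomy n 0 with hn | rfl | hn
  · simp only [trigFun_neg_exp hm, trigFun_neg_exp hn, hre, intervalIntegral.integral_const_mul,
      integral_cos_mul_cos, show m ≠ -n by omega, if_false, add_zero, mul_ite, mul_zero, hp]
  · simp only [trigFun_neg_exp hm, trigFun_zero_exp, mul_right_comm _ _ (√(2 * π))⁻¹,
      intervalIntegral.integral_const_mul, integral_cos_int_mul, hm.ne, if_false, mul_zero]
  · simp only [trigFun_neg_exp hm, trigFun_pos_exp hn, hre, mul_comm (cos _) (sin _),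
      intervalIntegral.integral_const_mul, integral_sin_mul_cos, (hm.trans hn).ne, if_false,
      mul_zero]
  · simp only [trigFun_neg_exp hn, trigFun_zero_exp, ← mul_assoc,
      intervalIntegral.integral_const_mul, integral_cos_int_mul, hn.ne, hn.ne', if_false, mul_zero]
  · simp only [trigFun_zero_exp, intervalIntegral.integral_const, smul_eq_mul, if_true]
    rw [← h2p]
    ring
  · simp only [trigFun_pos_exp hn, trigFun_zero_exp, ← mul_assoc,
      intervalIntegral.integral_const_mul, integral_sin_int_mul, hn.ne, if_false, mul_zero]
  · simp only [trigFun_pos_exp hm, trigFun_neg_exp hn, hre,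
      intervalIntegral.integral_const_mul, integral_sin_mul_cos, (hn.trans hm).ne', if_false,
      mul_zero]
  · simp only [trigFun_pos_exp hm, trigFun_zero_exp, mul_right_comm _ _ (√(2 * π))⁻¹,
      intervalIntegral.integral_const_mul, integral_sin_int_mul, hm.ne', if_false, mul_zero]
  · simp only [trigFun_pos_exp hm, trigFun_pos_exp hn, hre, intervalIntegral.integral_const_mul,
      integral_sin_mul_sin, show m ≠ -n by omega, if_false, sub_zero, mul_ite, mul_zero, hp]

/-- The reproducing kernel of the trigonometric polynomials of degree at most `ρ`, as a polynomial
in the inner product. -/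
noncomputable def trigKernel (ρ : ℕ) : Polynomial ℝ :=
  Polynomial.C (2 * π)⁻¹ +
    ∑ j ∈ Finset.range ρ, Polynomial.C π⁻¹ * Polynomial.Chebyshev.T ℝ (j + 1 : ℕ)

theorem sum_Icc_neg_self (g : ℤ → ℝ) (ρ : ℕ) : ∑ m ∈ Finset.Icc (-(ρ : ℤ)) ρ, g m =
    g 0 + ∑ j ∈ Finset.range ρ, (g (-(j + 1 : ℕ)) + g (j + 1 : ℕ)) := by
  induction ρ with
  | zero => simp
  | succ ρ ih =>
    have h : Finset.Icc (-((ρ + 1 : ℕ) : ℤ)) ((ρ + 1 : ℕ) : ℤ) =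
        insert (-((ρ + 1 : ℕ) : ℤ)) (insert ((ρ + 1 : ℕ) : ℤ) (Finset.Icc (-(ρ : ℤ)) ρ)) := by
      ext m
      simp only [Finset.mem_Icc, Finset.mem_insert]
      omega
    rw [h, Finset.sum_insert, Finset.sum_insert, ih, Finset.sum_range_succ]
    · ring
    · simp
    · simp only [Finset.mem_insert, Finset.mem_Icc]
      omega

theorem inner_exp (θ φ : ℝ) :
    inner ℝ (Circle.exp θ : ℂ) (Circle.exp φ : ℂ) = cos (θ - φ) := by
  rw [Complex.inner, Circle.coe_exp, Circle.coe_exp, Complex.mul_re, Complex.conj_re,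
    Complex.conj_im, Complex.exp_ofReal_mul_I_re, Complex.exp_ofReal_mul_I_re,
    Complex.exp_ofReal_mul_I_im, Complex.exp_ofReal_mul_I_im, cos_sub]
  ring

/-- The terms of index `j` and `-j` add up to `π⁻¹ cos (j (θ - φ))`, a Chebyshev polynomial in `cos
(θ - φ)`, which is the inner product. -/
theorem sum_trigFun_mul (ρ : ℕ) (z z' : Circle) :
    ∑ m : Finset.Icc (-(ρ : ℤ)) ρ, trigFun m z * trigFun m z' =
      (trigKernel ρ).eval (inner ℝ (z : ℂ) (z' : ℂ)) := by
  obtain ⟨θ, rfl⟩ := Circle.exp_surjective z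
  obtain ⟨φ, rfl⟩ := Circle.exp_surjective z'
  rw [Finset.sum_coe_sort (Finset.Icc (-(ρ : ℤ)) ρ)
    (fun m => trigFun m (Circle.exp θ) * trigFun m (Circle.exp φ)), sum_Icc_neg_self, inner_exp,
    trigKernel, Polynomial.eval_add, Polynomial.eval_C, Polynomial.eval_finsetSum,
    trigFun_zero_exp, trigFun_zero_exp, ← mul_inv, mul_self_sqrt (by positivity)]
  congr 1
  refine Finset.sum_congr rfl fun j _ => ?_
  rw [trigFun_neg_exp (by omega), trigFun_neg_exp (by omega), trigFun_pos_exp (by omega),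
    trigFun_pos_exp (by omega), Polynomial.eval_mul, Polynomial.eval_C,
    Polynomial.Chebyshev.T_real_cos, mul_sub, cos_sub, Int.cast_neg, neg_mul, neg_mul, cos_neg,
    cos_neg]
  have hp : π⁻¹ = (√π)⁻¹ * (√π)⁻¹ := by rw [← mul_inv, mul_self_sqrt pi_pos.le]
  rw [hp]
  ring

theorem trigKernel_eval_one (ρ : ℕ) : (trigKernel ρ).eval 1 = (2 * ρ + 1) / (2 * π) := by
  simp only [trigKernel, Polynomial.eval_add, Polynomial.eval_C, Polynomial.eval_finsetSum,
    Polynomial.eval_mul, Polynomial.Chebyshev.T_eval_one, Finset.sum_const, Finset.card_range,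
    nsmul_eq_mul]
  field_simp
  ring

theorem trigKernel_derivative_eval_one (ρ : ℕ) :
    (trigKernel ρ).derivative.eval 1 = ρ * (ρ + 1) * (2 * ρ + 1) / (6 * π) := by
  simp only [trigKernel, map_add, Polynomial.derivative_C, map_sum, Polynomial.derivative_C_mul,
    zero_add, Polynomial.eval_finsetSum, Polynomial.eval_mul, Polynomial.eval_C,
    Polynomial.Chebyshev.derivative_T_eval_one]
  induction ρ with
  | zero => simp
  | succ ρ ih =>
    rw [Finset.sum_range_succ, ih]
    push_cast
    field_simp
    ring

theorem trigKernel_derivative_derivative_eval_one (ρ : ℕ) :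
    (trigKernel ρ).derivative.derivative.eval 1 =
      ρ * (ρ + 1) * (2 * ρ + 1) * ((ρ - 1) * (ρ + 2)) / (30 * π) := by
  -- From the recurrence for iterated derivatives at `1`, starting with `T_n'(1) = n²`.
  have hT : ∀ n : ℤ, (Polynomial.Chebyshev.T ℝ n).derivative.derivative.eval 1 =
      n ^ 2 * (n ^ 2 - 1) / 3 := by
    intro n
    have := Polynomial.Chebyshev.iterate_derivative_T_eval_one_recurrence (R := ℝ) n 1
    simp only [Function.iterate_succ, Function.iterate_zero, Function.comp_apply, id,
      Polynomial.Chebyshev.derivative_T_eval_one] at this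
    push_cast at this
    linarith
  simp only [trigKernel, map_add, Polynomial.derivative_C, map_sum, Polynomial.derivative_C_mul,
    zero_add, Polynomial.eval_finsetSum, Polynomial.eval_mul, Polynomial.eval_C, hT]
  induction ρ with
  | zero => simp
  | succ ρ ih =>
    rw [Finset.sum_range_succ, ih]
    push_cast
    field_simp
    ring

end TrigonometricSystem

/-! ### Rotations of the circle -/

section Rotations

/-- A rotation shifts the interval that parametrizes the circle, and all half-open intervals of
length `2π` are fundamental domains for the same group of translations. -/
theorem measurePreserving_mul_left_circle (z : Circle) :
    MeasurePreserving (fun w => z * w) arcLength arcLength := by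
  have hc : Continuous (Circle.exp : ℝ → Circle) := Circle.exp.continuous
  have hm : Measurable fun w : Circle => z * w := (continuous_const_mul z).measurable
  refine ⟨hm, ?_⟩
  obtain ⟨α, rfl⟩ := Circle.exp_surjective z
  ext s hs
  rw [Measure.map_apply hm hs, arcLength, Measure.map_apply hc.measurable (hm hs),
    Measure.map_apply hc.measurable hs, Measure.restrict_apply (hc.measurable (hm hs)),
    Measure.restrict_apply (hc.measurable hs)]
  set A := (Circle.exp : ℝ → Circle) ⁻¹' s with hA
  have h1 : (Circle.exp : ℝ → Circle) ⁻¹' ((fun w => Circle.exp α * w) ⁻¹' s) ∩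
      Set.Ioc (-Real.pi) Real.pi =
      (fun θ => α + θ) ⁻¹' (A ∩ Set.Ioc (α - Real.pi) (α - Real.pi + 2 * Real.pi)) := by
    ext θ
    simp only [hA, Set.mem_inter_iff, Set.mem_preimage, Circle.exp_add, Set.mem_Ioc]
    refine and_congr_right fun _ => ⟨fun h => ?_, fun h => ?_⟩ <;> constructor <;> linarith [h.1, h.2]
  rw [h1, measure_preimage_add]
  have h2 : Set.Ioc (-Real.pi) Real.pi = Set.Ioc (-Real.pi) (-Real.pi + 2 * Real.pi) := by
    congr 1; ring
  rw [h2]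
  refine (isAddFundamentalDomain_Ioc Real.two_pi_pos _).measure_set_eq
    (isAddFundamentalDomain_Ioc Real.two_pi_pos _) (hc.measurable hs) fun g => ?_
  obtain ⟨g, n, rfl⟩ := g
  ext θ
  simp only [Set.mem_preimage]
  have : Circle.exp ((⟨n • (2 * Real.pi), n, rfl⟩ : AddSubgroup.zmultiples (2 * Real.pi)) +ᵥ θ) =
      Circle.exp θ := by
    change Circle.exp (n • (2 * Real.pi) + θ) = _
    rw [add_comm]
    exact Circle.periodic_exp.zsmul n θ
  exact iff_of_eq (congrArg (· ∈ s) this)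

/-- The rotation of the circle by `z`. -/
noncomputable def rotation (z : Circle) : Circle ≃ₘ^∞⟮𝓡 1, 𝓡 1⟯ Circle where
  toEquiv := Equiv.mulLeft z
  contMDiff_toFun := ContMDiff.of_le (n := ω) (contMDiff_mul_left (a := z)) le_top
  contMDiff_invFun := ContMDiff.of_le (n := ω) (contMDiff_mul_left (a := z⁻¹)) le_top

theorem cosFun_mem_trigPoly {ρ : ℕ} {m : ℤ} (hm : |m| ≤ ρ) : cosFun m ∈ trigPoly ρ := by
  have hp : √Real.pi ≠ 0 := (Real.sqrt_pos.2 Real.pi_pos).ne'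
  have hcase : ∃ (n : ℤ) (c : ℝ), n ∈ Set.Icc (-(ρ : ℤ)) ρ ∧ cosFun m = c • trigFun n := by
    rcases eq_or_ne m 0 with rfl | h0
    · refine ⟨0, √(2 * Real.pi), by simp, ?_⟩
      ext z
      obtain ⟨θ, rfl⟩ := Circle.exp_surjective z
      change _ = √(2 * Real.pi) * trigFun 0 (Circle.exp θ)
      rw [cosFun_exp, trigFun_zero_exp, mul_inv_cancel₀ (Real.sqrt_pos.2 (by positivity)).ne']
      simp
    · refine ⟨-|m|, √Real.pi, ⟨by linarith [abs_nonneg m], by linarith [abs_nonneg m]⟩, ?_⟩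
      ext z
      obtain ⟨θ, rfl⟩ := Circle.exp_surjective z
      change _ = √Real.pi * trigFun (-|m|) (Circle.exp θ)
      rw [cosFun_exp, trigFun_neg_exp (by simpa using h0), mul_inv_cancel_left₀ hp]
      rcases abs_choice m with h | h <;> simp [h]
  obtain ⟨n, c, hn, h⟩ := hcase
  rw [h]
  exact Submodule.smul_mem _ _ (Submodule.subset_span ⟨n, hn, rfl⟩)

theorem sinFun_mem_trigPoly {ρ : ℕ} {m : ℤ} (hm : |m| ≤ ρ) : sinFun m ∈ trigPoly ρ := by
  have hp : √Real.pi ≠ 0 := (Real.sqrt_pos.2 Real.pi_pos).ne'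
  have hcase : ∃ (n : ℤ) (c : ℝ), n ∈ Set.Icc (-(ρ : ℤ)) ρ ∧ sinFun m = c • trigFun n := by
    rcases eq_or_ne m 0 with rfl | h0
    · refine ⟨0, 0, by simp, ?_⟩
      ext z
      obtain ⟨θ, rfl⟩ := Circle.exp_surjective z
      change _ = 0 * trigFun 0 (Circle.exp θ)
      rw [sinFun_exp]
      simp
    · rcases abs_choice m with h | h
      · refine ⟨|m|, √Real.pi, ⟨by linarith [abs_nonneg m], by linarith [abs_nonneg m]⟩, ?_⟩
        ext z
        obtain ⟨θ, rfl⟩ := Circle.exp_surjective z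
        change _ = √Real.pi * trigFun (|m|) (Circle.exp θ)
        rw [sinFun_exp, trigFun_pos_exp (by simpa using h0), mul_inv_cancel_left₀ hp, h]
      · refine ⟨|m|, -√Real.pi, ⟨by linarith [abs_nonneg m], by linarith [abs_nonneg m]⟩, ?_⟩
        ext z
        obtain ⟨θ, rfl⟩ := Circle.exp_surjective z
        change _ = -√Real.pi * trigFun (|m|) (Circle.exp θ)
        rw [sinFun_exp, trigFun_pos_exp (by simpa using h0), neg_mul, mul_inv_cancel_left₀ hp, h]
        simp
  obtain ⟨n, c, hn, h⟩ := hcase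
  rw [h]
  exact Submodule.smul_mem _ _ (Submodule.subset_span ⟨n, hn, rfl⟩)

theorem pullback_rotation_trigFun_mem (z : Circle) {ρ : ℕ} {m : ℤ}
    (hm : m ∈ Set.Icc (-(ρ : ℤ)) ρ) : pullback (rotation z) (trigFun m) ∈ trigPoly ρ := by
  obtain ⟨α, rfl⟩ := Circle.exp_surjective z
  have habs : |m| ≤ ρ := abs_le.2 hm
  have hrot : ∀ θ, rotation (Circle.exp α) (Circle.exp θ) = Circle.exp (α + θ) := fun θ =>
    (Circle.exp_add α θ).symm
  have hcase : ∃ a b : ℝ, pullback (rotation (Circle.exp α)) (trigFun m) =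
      a • cosFun m + b • sinFun m := by
    rcases lt_trichotomy m 0 with h | rfl | h
    · refine ⟨(√Real.pi)⁻¹ * Real.cos (m * α), -(√Real.pi)⁻¹ * Real.sin (m * α), ?_⟩
      ext z
      obtain ⟨θ, rfl⟩ := Circle.exp_surjective z
      change trigFun m (rotation _ _) = _ * cosFun m _ + _ * sinFun m _
      rw [hrot, trigFun_neg_exp h, cosFun_exp, sinFun_exp, mul_add, Real.cos_add]
      ring
    · refine ⟨(√(2 * Real.pi))⁻¹, 0, ?_⟩
      ext z
      obtain ⟨θ, rfl⟩ := Circle.exp_surjective z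
      change trigFun 0 (rotation _ _) = _ * cosFun 0 _ + _ * sinFun 0 _
      rw [hrot, trigFun_zero_exp, cosFun_exp]
      simp
    · refine ⟨(√Real.pi)⁻¹ * Real.sin (m * α), (√Real.pi)⁻¹ * Real.cos (m * α), ?_⟩
      ext z
      obtain ⟨θ, rfl⟩ := Circle.exp_surjective z
      change trigFun m (rotation _ _) = _ * cosFun m _ + _ * sinFun m _
      rw [hrot, trigFun_pos_exp h, cosFun_exp, sinFun_exp, mul_add, Real.sin_add]
      ring
  obtain ⟨a, b, h⟩ := hcase
  rw [h]
  exact add_mem (Submodule.smul_mem _ _ (cosFun_mem_trigPoly habs))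
    (Submodule.smul_mem _ _ (sinFun_mem_trigPoly habs))

end Rotations

/-! ### Spherical harmonics as restrictions of polynomials -/

section HarmonicDecomposition

open MvPolynomial

variable {k : ℕ}

/-- The polynomial `∑ X_i ^ 2`. -/
noncomputable def normSqPoly (k : ℕ) : MvPolynomial (Fin (k + 1)) ℝ := ∑ i, X i ^ 2

theorem isHomogeneous_normSqPoly : (normSqPoly k).IsHomogeneous 2 :=
  IsHomogeneous.sum _ _ _ fun i _ => isHomogeneous_X_pow i 2

theorem polyLaplacian_apply (f : MvPolynomial (Fin (k + 1)) ℝ) :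
    polyLaplacian k f = ∑ i, pderiv i (pderiv i f) := by
  simp [polyLaplacian]

/-- The subtraction is truncated: in degree below two the Laplacian is zero, and zero is homogeneous
of every degree. -/
theorem isHomogeneous_polyLaplacian {f : MvPolynomial (Fin (k + 1)) ℝ} {n : ℕ}
    (hf : f.IsHomogeneous n) : (polyLaplacian k f).IsHomogeneous (n - 2) := by
  rw [polyLaplacian_apply]
  exact IsHomogeneous.sum _ _ _ fun i _ => hf.pderiv.pderiv

theorem pderiv_normSqPoly (i : Fin (k + 1)) : pderiv i (normSqPoly k) = 2 * X i := by
  simp only [normSqPoly, map_sum, pderiv_pow, pderiv_X]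
  rw [Finset.sum_eq_single i]
  · simp
  · intro j _ hj
    simp [hj.symm]
  · simp

theorem polyLaplacian_normSqPoly_mul {f : MvPolynomial (Fin (k + 1)) ℝ} {n : ℕ}
    (hf : f.IsHomogeneous n) : polyLaplacian k (normSqPoly k * f) =
      normSqPoly k * polyLaplacian k f + (4 * n + 2 * (k + 1) : ℝ) • f := by
  have h : ∀ i : Fin (k + 1), pderiv i (pderiv i (normSqPoly k * f)) =
      normSqPoly k * pderiv i (pderiv i f) + 4 * (X i * pderiv i f) + 2 * f := by
    intro i
    have h2 : pderiv i (2 : MvPolynomial (Fin (k + 1)) ℝ) = 0 := by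
      rw [← map_ofNat (C (σ := Fin (k + 1)) (R := ℝ)) 2, pderiv_C]
    simp only [Derivation.leibniz, pderiv_normSqPoly, map_add, smul_eq_mul, pderiv_X_self, h2]
    ring
  rw [polyLaplacian_apply, polyLaplacian_apply, Finset.sum_congr rfl fun i _ => h i,
    Finset.sum_add_distrib, Finset.sum_add_distrib, ← Finset.mul_sum, ← Finset.mul_sum,
    hf.sum_X_mul_pderiv, Finset.sum_const, Finset.card_univ, Fintype.card_fin,
    smul_eq_C_mul, add_assoc]
  simp only [nsmul_eq_mul, C_mul, C_add, map_ofNat, map_natCast, map_one]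
  push_cast
  ring

/-- Such an `f` is `|x|² g` with `g` proportional to `Δf`. By `polyLaplacian_normSqPoly_mul` the
hypothesis becomes an equation of the same shape for `g`, with a larger constant and degree lower by
two. -/
theorem eq_zero_of_normSqPoly_mul_polyLaplacian {n : ℕ} {f : MvPolynomial (Fin (k + 1)) ℝ}
    (hf : f.IsHomogeneous n) {c : ℝ} (hc : 0 < c)
    (h : normSqPoly k * polyLaplacian k f + c • f = 0) : f = 0 := by
  induction n using Nat.strong_induction_on generalizing f c with
  | _ n ih =>
    have hdeg := isHomogeneous_polyLaplacian hf
    set g := (-c⁻¹) • polyLaplacian k f with hg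
    have hgh : g.IsHomogeneous (n - 2) := (homogeneousSubmodule _ ℝ (n - 2)).smul_mem _ hdeg
    have hlap : polyLaplacian k f = (-c) • g := by
      rw [hg, smul_smul, neg_mul_neg, mul_inv_cancel₀ hc.ne', one_smul]
    have hfg : f = normSqPoly k * g := by
      rw [hlap, mul_smul_comm, neg_smul, neg_add_eq_zero] at h
      exact (smul_right_injective _ hc.ne' h).symm
    rcases lt_or_ge n 2 with hn | hn
    -- Here `n - 2 = 0`, so `|x|² g` is homogeneous of degree two, which differs from `n`.
    · by_contra hne
      have := (hfg ▸ isHomogeneous_normSqPoly.mul hgh : f.IsHomogeneous (2 + (n - 2))).inj_right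
        hf hne
      omega
    · have h2 := polyLaplacian_normSqPoly_mul hgh
      rw [← hfg, hlap] at h2
      have h3 : g = 0 := by
        refine ih (n - 2) (by omega) hgh
          (c := 4 * ((n - 2 : ℕ) : ℝ) + 2 * (k + 1) + c) (by positivity) ?_
        rw [add_smul, ← add_assoc, ← h2, neg_smul, neg_add_cancel]
      rw [hfg, h3, mul_zero]

/-- The map `f ↦ Δ(|x|² f)` is injective on the finite-dimensional space of homogeneous polynomials
of degree `n`, hence surjective. -/
theorem exists_polyLaplacian_normSqPoly_mul_eq {n : ℕ} {g : MvPolynomial (Fin (k + 1)) ℝ}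
    (hg : g.IsHomogeneous n) :
    ∃ f : MvPolynomial (Fin (k + 1)) ℝ, f.IsHomogeneous n ∧
      polyLaplacian k (normSqPoly k * f) = g := by
  have : FiniteDimensional ℝ (homogeneousSubmodule (Fin (k + 1)) ℝ n) :=
    Module.Finite.iff_fg.2 (homogeneousSubmodule_fg _ _ n)
  let T : homogeneousSubmodule (Fin (k + 1)) ℝ n →ₗ[ℝ] homogeneousSubmodule (Fin (k + 1)) ℝ n :=
    ((polyLaplacian k ∘ₗ LinearMap.mulLeft ℝ (normSqPoly k)).domRestrict _).codRestrict _ fun f => by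
      have := isHomogeneous_polyLaplacian (isHomogeneous_normSqPoly.mul f.2)
      rwa [Nat.add_sub_cancel_left] at this
  have hT : Function.Injective T := by
    rw [← LinearMap.ker_eq_bot, LinearMap.ker_eq_bot']
    intro f hf
    have h1 : polyLaplacian k (normSqPoly k * f.1) = 0 := congrArg Subtype.val hf
    rw [polyLaplacian_normSqPoly_mul f.2] at h1
    exact Subtype.ext (eq_zero_of_normSqPoly_mul_polyLaplacian f.2 (by positivity) h1)
  obtain ⟨f, hf⟩ := LinearMap.injective_iff_surjective.1 hT ⟨g, hg⟩
  exact ⟨f.1, f.2, congrArg Subtype.val hf⟩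

theorem restrictSph_apply (p : MvPolynomial (Fin (k + 1)) ℝ) (x : Sph k) :
    restrictSph k p x = eval (fun i => x.1 i) p := rfl

theorem eval_normSqPoly (x : Sph k) : eval (fun i => x.1 i) (normSqPoly k) = 1 := by
  have h := norm_eq_of_mem_sphere x
  have h2 := EuclideanSpace.norm_sq_eq x.1
  rw [h] at h2
  simp only [normSqPoly, map_sum, map_pow, eval_X]
  simpa using h2.symm

theorem restrictSph_normSqPoly_mul (f : MvPolynomial (Fin (k + 1)) ℝ) :
    restrictSph k (normSqPoly k * f) = restrictSph k f := by
  ext x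
  rw [restrictSph_apply, restrictSph_apply, map_mul, eval_normSqPoly, one_mul]

/-- For a suitable `g` the difference `f - |x|² g` is harmonic, and on the sphere `|x|² g` agrees
with `g`, whose degree is lower by two. -/
theorem restrictSph_mem_of_isHomogeneous {n ν : ℕ} (hn : n ≤ ν)
    {f : MvPolynomial (Fin (k + 1)) ℝ} (hf : f.IsHomogeneous n) :
    restrictSph k f ∈ sphPoly k ν := by
  have hharm : ∀ {m : ℕ} {g : MvPolynomial (Fin (k + 1)) ℝ}, m ≤ ν → g.IsHomogeneous m →
      polyLaplacian k g = 0 → restrictSph k g ∈ sphPoly k ν := by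
    intro m g hm hg h0
    exact Submodule.mem_iSup_of_mem (⟨m, by omega⟩ : Fin (ν + 1)) ⟨g, ⟨hg, h0⟩, rfl⟩
  induction n using Nat.strong_induction_on generalizing f with
  | _ n ih =>
    obtain ⟨g, hg, hgf⟩ := exists_polyLaplacian_normSqPoly_mul_eq (isHomogeneous_polyLaplacian hf)
    rcases lt_or_ge n 2 with hn2 | hn2
    · have h1 : polyLaplacian k f = 0 := by
        rw [polyLaplacian_apply]
        refine Finset.sum_eq_zero fun i _ => ?_
        have h2 : (pderiv i f).IsHomogeneous 0 := by
          have := hf.pderiv (i := i)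
          rwa [show n - 1 = 0 by omega] at this
        rw [← totalDegree_zero_iff_isHomogeneous, totalDegree_eq_zero_iff_eq_C] at h2
        rw [h2, pderiv_C]
      exact hharm hn hf h1
    · have hqg : (normSqPoly k * g).IsHomogeneous n := by
        have := isHomogeneous_normSqPoly.mul hg
        rwa [show 2 + (n - 2) = n by omega] at this
      have h1 := hharm hn (hf.sub hqg) (by rw [map_sub, hgf, sub_self])
      have h2 := ih (n - 2) (by omega) (by omega) hg
      rw [map_sub, restrictSph_normSqPoly_mul] at h1
      simpa using add_mem h1 h2

/-- This description by degree alone is visibly stable under linear changes of variables and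
contains all polynomials of bounded degree in one coordinate. -/
theorem sphPoly_eq_map (k ν : ℕ) :
    sphPoly k ν = (restrictTotalDegree (Fin (k + 1)) ℝ ν).map (restrictSph k) := by
  refine le_antisymm (iSup_le fun n => ?_) ?_
  · rintro _ ⟨p, ⟨hp, -⟩, rfl⟩
    refine ⟨p, ?_, rfl⟩
    rw [SetLike.mem_coe, mem_restrictTotalDegree]
    exact (IsHomogeneous.totalDegree_le hp).trans (Nat.lt_succ_iff.1 n.2)
  · rintro _ ⟨p, hp, rfl⟩
    rw [SetLike.mem_coe, mem_restrictTotalDegree] at hp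
    rw [← sum_homogeneousComponent p, map_sum]
    refine Submodule.sum_mem _ fun n hn => ?_
    exact restrictSph_mem_of_isHomogeneous ((Nat.lt_succ_iff.1 (Finset.mem_range.1 hn)).trans hp)
      (homogeneousComponent_isHomogeneous n p)

theorem mem_sphPoly_iff {ν : ℕ} {w : Smooth (𝓡 k) (Sph k)} :
    w ∈ sphPoly k ν ↔ ∃ p : MvPolynomial (Fin (k + 1)) ℝ, p.totalDegree ≤ ν ∧
      restrictSph k p = w := by
  rw [sphPoly_eq_map, Submodule.mem_map]
  simp only [mem_restrictTotalDegree]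

end HarmonicDecomposition

/-! ### The dimension of `sphPoly` -/

section Dimension

open MvPolynomial

theorem finrank_homogeneousSubmodule (k n : ℕ) :
    Module.finrank ℝ (homogeneousSubmodule (Fin (k + 1)) ℝ n) = (k + n).choose k := by
  have h1 : homogeneousSubmodule (Fin (k + 1)) ℝ n =
      restrictSupport ℝ ((Finset.univ.finsuppAntidiag n : Finset (Fin (k + 1) →₀ ℕ)) :
        Set (Fin (k + 1) →₀ ℕ)) := by
    rw [homogeneousSubmodule_eq_finsupp_supported, restrictSupport]
    congr 1
    ext d
    simp [Finset.mem_finsuppAntidiag, Finsupp.degree_eq_sum]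
  rw [h1, Module.finrank_eq_nat_card_basis (basisRestrictSupport ℝ _)]
  simp only [Finset.coe_sort_coe, Nat.card_eq_fintype_card, Fintype.card_coe,
    Finset.card_finsuppAntidiag_nat_eq_choose, Finset.card_univ, Fintype.card_fin]
  rw [show k + 1 + n - 1 = k + n by omega, Nat.choose_symm_add]

theorem eval_smul_of_isHomogeneous {σ : Type*} {n : ℕ} {f : MvPolynomial σ ℝ}
    (hf : f.IsHomogeneous n) (c : ℝ) (x : σ → ℝ) : eval (c • x) f = c ^ n * eval x f := by
  rw [eval_eq, eval_eq, Finset.mul_sum]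
  refine Finset.sum_congr rfl fun d hd => ?_
  have h1 : c ^ n = ∏ i ∈ d.support, c ^ d i := by
    rw [Finset.prod_pow_eq_pow_sum, ← hf.degree_eq_sum_deg_support hd]
  simp only [Pi.smul_apply, smul_eq_mul, mul_pow, Finset.prod_mul_distrib, h1]
  ring

theorem exists_eq_norm_smul_sphere {k : ℕ} (y : EuclideanSpace ℝ (Fin (k + 1))) :
    ∃ u : Sph k, y = ‖y‖ • (u : EuclideanSpace ℝ (Fin (k + 1))) := by
  rcases eq_or_ne y 0 with rfl | hy
  · exact ⟨⟨EuclideanSpace.single 0 1, by simp⟩, by simp⟩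
  · have hn : ‖y‖ ≠ 0 := norm_ne_zero_iff.2 hy
    refine ⟨⟨‖y‖⁻¹ • y, ?_⟩, ?_⟩
    · rw [mem_sphere_zero_iff_norm, norm_smul, norm_inv, norm_norm, inv_mul_cancel₀ hn]
    · rw [smul_smul, mul_inv_cancel₀ hn, one_smul]

theorem eq_zero_of_eval_sphere_eq_zero {k n : ℕ} {f : MvPolynomial (Fin (k + 1)) ℝ}
    (hf : f.IsHomogeneous n) (h : ∀ x : Sph k, eval (fun i => x.1 i) f = 0) : f = 0 := by
  refine IsHomogeneous.eq_zero_of_forall_eval_eq_zero hf fun r => ?_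
  obtain ⟨u, hu⟩ := exists_eq_norm_smul_sphere (WithLp.toLp 2 r : EuclideanSpace ℝ (Fin (k + 1)))
  have hr : r = ‖(WithLp.toLp 2 r : EuclideanSpace ℝ (Fin (k + 1)))‖ • fun i => u.1 i := by
    funext i
    exact congrArg (fun v : EuclideanSpace ℝ (Fin (k + 1)) => v i) hu
  rw [hr, eval_smul_of_isHomogeneous hf, h, mul_zero]

/-- Multiplication by `|x|²` raises the degree by two without changing the restriction, so
homogeneous polynomials of degrees `ν + 1` and `ν` suffice. Their restrictions are independent
because they have opposite parity under `x ↦ -x`. -/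
theorem finrank_sphPoly_succ (k ν : ℕ) : Module.finrank ℝ (sphPoly k (ν + 1)) =
    (k + (ν + 1)).choose k + (k + ν).choose k := by
  have hfin : ∀ n, FiniteDimensional ℝ (homogeneousSubmodule (Fin (k + 1)) ℝ n) := fun n =>
    Module.Finite.iff_fg.2 (homogeneousSubmodule_fg _ _ n)
  have := hfin ν
  have := hfin (ν + 1)
  let T : homogeneousSubmodule (Fin (k + 1)) ℝ (ν + 1) × homogeneousSubmodule (Fin (k + 1)) ℝ ν
      →ₗ[ℝ] Smooth (𝓡 k) (Sph k) :=
    ((restrictSph k).domRestrict _).coprod ((restrictSph k).domRestrict _)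
  have hTapp : ∀ f g, T (f, g) = restrictSph k f.1 + restrictSph k g.1 := fun f g => rfl
  have hinj : Function.Injective T := by
    rw [← LinearMap.ker_eq_bot, LinearMap.ker_eq_bot']
    rintro ⟨f, g⟩ hfg
    rw [hTapp] at hfg
    have h1 : ∀ x : Sph k, eval (fun i => x.1 i) f.1 + eval (fun i => x.1 i) g.1 = 0 :=
      fun x => DFunLike.congr_fun hfg x
    have hneg : ∀ x : Sph k, (fun i => (-x).1 i) = (-1 : ℝ) • fun i => x.1 i := fun x => by
      funext i; simp
    have h2 : ∀ x : Sph k, eval (fun i => x.1 i) f.1 = eval (fun i => x.1 i) g.1 := fun x => by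
      have := h1 (-x)
      rw [hneg, eval_smul_of_isHomogeneous f.2, eval_smul_of_isHomogeneous g.2, pow_succ] at this
      rcases neg_one_pow_eq_or ℝ ν with h | h <;> rw [h] at this <;> linarith
    have hf : f = 0 := Subtype.ext (eq_zero_of_eval_sphere_eq_zero f.2 fun x => by
      linarith [h1 x, h2 x])
    have hg : g = 0 := Subtype.ext (eq_zero_of_eval_sphere_eq_zero g.2 fun x => by
      linarith [h1 x, h2 x])
    rw [hf, hg]
    rfl
  have hrange : LinearMap.range T = sphPoly k (ν + 1) := by
    apply le_antisymm
    · rintro _ ⟨⟨f, g⟩, rfl⟩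
      rw [hTapp]
      exact add_mem (restrictSph_mem_of_isHomogeneous le_rfl f.2)
        (restrictSph_mem_of_isHomogeneous (Nat.le_succ ν) g.2)
    · have hup : ∀ j n, ∀ f : MvPolynomial (Fin (k + 1)) ℝ, f.IsHomogeneous n →
          ∃ g : MvPolynomial (Fin (k + 1)) ℝ, g.IsHomogeneous (n + 2 * j) ∧
            restrictSph k g = restrictSph k f := by
        intro j n f hf
        induction j with
        | zero => exact ⟨f, hf, rfl⟩
        | succ j ih =>
          obtain ⟨g, hg, hgf⟩ := ih
          refine ⟨normSqPoly k * g, ?_, by rw [restrictSph_normSqPoly_mul, hgf]⟩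
          have := isHomogeneous_normSqPoly.mul hg
          rwa [show 2 + (n + 2 * j) = n + 2 * (j + 1) by ring] at this
      rw [sphPoly_eq_map]
      rintro _ ⟨p, hp, rfl⟩
      rw [SetLike.mem_coe, mem_restrictTotalDegree] at hp
      rw [← sum_homogeneousComponent p, map_sum]
      refine Submodule.sum_mem _ fun n hn => ?_
      have hn' : n ≤ ν + 1 := (Nat.lt_succ_iff.1 (Finset.mem_range.1 hn)).trans hp
      have hc := homogeneousComponent_isHomogeneous n p
      rcases Nat.even_or_odd (ν + 1 - n) with ⟨j, hj⟩ | ⟨j, hj⟩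
      · obtain ⟨g, hg, hgf⟩ := hup j n _ hc
        rw [show n + 2 * j = ν + 1 by omega] at hg
        exact ⟨(⟨g, hg⟩, 0), by rw [hTapp, ← hgf]; simp⟩
      · obtain ⟨g, hg, hgf⟩ := hup j n _ hc
        rw [show n + 2 * j = ν by omega] at hg
        exact ⟨(0, ⟨g, hg⟩), by rw [hTapp, ← hgf]; simp⟩
  rw [← hrange, LinearMap.finrank_range_of_inj hinj, Module.finrank_prod,
    finrank_homogeneousSubmodule, finrank_homogeneousSubmodule]

end Dimension

/-! ### Reproducing kernels and their invariance -/

section ReproducingKernel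

variable {E : Type*} [NormedAddCommGroup E] [NormedSpace ℝ E]
  {H : Type*} [TopologicalSpace H] {I : ModelWithCorners ℝ E H}
  {M : Type*} [MetricSpace M] [ChartedSpace H M] [CompactSpace M] [MeasurableSpace M]
  [BorelSpace M]

theorem exists_orthonormal_family (vol : Measure M) [IsFiniteMeasure vol] [vol.IsOpenPosMeasure]
    (V : Submodule ℝ (Smooth I M)) [FiniteDimensional ℝ V] :
    ∃ e : Fin (Module.finrank ℝ V) → Smooth I M,
      (∀ m n, ∫ p, e m p * e n p ∂vol = if m = n then 1 else 0) ∧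
      Submodule.span ℝ (Set.range e) = V := by
  let _ := l2Norm (I := I) vol
  let _ := l2Inner (I := I) vol
  let b := stdOrthonormalBasis ℝ V
  refine ⟨fun n => (b n : Smooth I M), fun m n => ?_, ?_⟩
  · exact (orthonormal_iff_ite.1 b.orthonormal) m n
  · have h := congrArg (Submodule.map V.subtype) b.toBasis.span_eq
    rw [Submodule.map_span, Submodule.map_top, Submodule.range_subtype, ← Set.range_comp] at h
    simpa [Function.comp_def] using h

variable {N : Type*} [Fintype N] [DecidableEq N] {e : N → Smooth I M}
  {vol : Measure M} [IsFiniteMeasure vol]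

theorem integral_sum_mul_mul (he : ∀ m n, ∫ p, e m p * e n p ∂vol = if m = n then 1 else 0)
    {f : Smooth I M} (hf : f ∈ Submodule.span ℝ (Set.range e)) (x : M) :
    ∫ y, (∑ n, e n x * e n y) * f y ∂vol = f x := by
  obtain ⟨c, rfl⟩ := (Submodule.mem_span_range_iff_exists_fun ℝ).1 hf
  have h1 : ∀ y, (∑ n, e n x * e n y) * (∑ n, c n • e n : Smooth I M) y =
      ∑ n, ∑ m, e n x * c m * (e n y * e m y) := by
    intro y
    rw [sum_smooth_apply, Finset.sum_mul_sum]
    exact Finset.sum_congr rfl fun n _ => Finset.sum_congr rfl fun m _ => by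
      simp only [ContMDiffMap.coe_smul, Pi.smul_apply, smul_eq_mul]
      ring
  simp only [h1]
  rw [integral_finsetSum _ fun n _ => integrable_finsetSum _ fun m _ =>
    (integrable_mul vol (e n) (e m)).const_mul _]
  rw [sum_smooth_apply]
  refine Finset.sum_congr rfl fun n _ => ?_
  rw [integral_finsetSum _ fun m _ => (integrable_mul vol (e n) (e m)).const_mul _]
  simp only [integral_const_mul, he]
  simp [mul_comm]

variable [vol.IsOpenPosMeasure]

/-- The kernel is the inner product of the vectors `φ x` of basis values, and `φ (g x) = T⁻¹ (φ x)`
for the isometry `T` of `exists_isometry_pullback`. -/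
theorem sum_mul_apply_eq (he : ∀ m n, ∫ p, e m p * e n p ∂vol = if m = n then 1 else 0)
    (g : M ≃ₘ^∞⟮I, I⟯ M) (hg : MeasurePreserving g vol vol)
    (hV : ∀ n, pullback g (e n) ∈ Submodule.span ℝ (Set.range e)) (x y : M) :
    ∑ n, e n (g x) * e n (g y) = ∑ n, e n x * e n y := by
  obtain ⟨T, hT⟩ := exists_isometry_pullback he g hg hV
  set φ : M → EuclideanSpace ℝ N := fun x => WithLp.toLp 2 fun n => e n x with hφ
  have hin : ∀ x y, ∑ n, e n x * e n y = inner ℝ (φ x) (φ y) := fun x y => by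
    simp [hφ, PiLp.inner_apply, mul_comm]
  have hφg : ∀ x, φ (g x) = T.symm (φ x) := fun x => by
    refine ext_inner_left ℝ fun ξ => ?_
    rw [← T.inner_map_map ξ (T.symm (φ x)), T.apply_symm_apply]
    have := DFunLike.congr_fun (hT ξ) x
    rw [sum_smooth_apply] at this
    have h1 : pullback g (∑ n, ξ n • e n) x = (∑ n, ξ n • e n : Smooth I M) (g x) := rfl
    rw [h1, sum_smooth_apply] at this
    simpa [hφ, PiLp.inner_apply, mul_comm] using this
  rw [hin, hin, hφg, hφg, T.symm.inner_map_map]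

end ReproducingKernel

/-! ### Linear isometries acting on the sphere -/

section Isometries

variable {k : ℕ}

/-- One reflection takes `x` to `x'`. A second one takes the image of `y` to `y'`; it fixes `x'`,
which is orthogonal to the difference of these vectors as the inner products agree. -/
theorem exists_isometry_map_pair {F : Type*} [NormedAddCommGroup F] [InnerProductSpace ℝ F]
    [CompleteSpace F] {x y x' y' : F} (hx : ‖x‖ = ‖x'‖) (hy : ‖y‖ = ‖y'‖)
    (hxy : inner ℝ x y = inner ℝ x' y') : ∃ g : F ≃ₗᵢ[ℝ] F, g x = x' ∧ g y = y' := by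
  set g₁ : F ≃ₗᵢ[ℝ] F := (ℝ ∙ (x - x'))ᗮ.reflection
  have h1 : g₁ x = x' := Submodule.reflection_sub hx
  set g₂ : F ≃ₗᵢ[ℝ] F := (ℝ ∙ (g₁ y - y'))ᗮ.reflection
  have h2 : g₂ (g₁ y) = y' := Submodule.reflection_sub (by rw [g₁.norm_map, hy])
  have h3 : g₂ x' = x' := by
    refine Submodule.reflection_mem_subspace_eq_self ?_
    rw [Submodule.mem_orthogonal_singleton_iff_inner_right, inner_sub_left, ← h1,
      g₁.inner_map_map, h1, real_inner_comm, hxy, real_inner_comm, sub_self]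
  exact ⟨g₁.trans g₂, by simp [h1, h3], by simp [h2]⟩

theorem isometry_mem_sphere (g : EuclideanSpace ℝ (Fin (k + 1)) ≃ₗᵢ[ℝ]
    EuclideanSpace ℝ (Fin (k + 1))) (x : Sph k) :
    g x.1 ∈ Metric.sphere (0 : EuclideanSpace ℝ (Fin (k + 1))) 1 := by
  rw [mem_sphere_zero_iff_norm, g.norm_map, norm_eq_of_mem_sphere]

theorem contMDiff_isometry_sphere (g : EuclideanSpace ℝ (Fin (k + 1)) ≃ₗᵢ[ℝ]
    EuclideanSpace ℝ (Fin (k + 1))) :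
    ContMDiff (𝓡 k) (𝓡 k) ∞ fun x : Sph k => (⟨g x.1, isometry_mem_sphere g x⟩ : Sph k) := by
  have := Fact.mk (@finrank_euclideanSpace_fin ℝ _ (k + 1))
  exact ContMDiff.codRestrict_sphere (g.contDiff.contMDiff.comp contMDiff_coe_sphere)
    (isometry_mem_sphere g)

/-- The diffeomorphism of the sphere given by a linear isometry. -/
noncomputable def sphIsometry (g : EuclideanSpace ℝ (Fin (k + 1)) ≃ₗᵢ[ℝ]
    EuclideanSpace ℝ (Fin (k + 1))) : Sph k ≃ₘ^∞⟮𝓡 k, 𝓡 k⟯ Sph k where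
  toFun x := ⟨g x, isometry_mem_sphere g x⟩
  invFun x := ⟨g.symm x, isometry_mem_sphere g.symm x⟩
  left_inv x := Subtype.ext (g.symm_apply_apply x.1)
  right_inv x := Subtype.ext (g.apply_symm_apply x.1)
  contMDiff_toFun := contMDiff_isometry_sphere g
  contMDiff_invFun := contMDiff_isometry_sphere g.symm

variable (g : EuclideanSpace ℝ (Fin (k + 1)) ≃ₗᵢ[ℝ] EuclideanSpace ℝ (Fin (k + 1)))

theorem coe_sphIsometry (x : Sph k) :
    (sphIsometry g x : EuclideanSpace ℝ (Fin (k + 1))) = g x := rfl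

theorem isometry_sphIsometry : Isometry (sphIsometry g) := fun x y =>
  g.isometry.edist_eq x.1 y.1

-- `toSphere` measures a set through the volume of the cone over it, and a linear isometry maps
-- cones to cones.
open scoped Pointwise in
theorem measurePreserving_sphIsometry :
    MeasurePreserving (sphIsometry g) (sphArea k) (sphArea k) := by
  have hm : Measurable (sphIsometry g) := (isometry_sphIsometry g).continuous.measurable
  refine ⟨hm, ?_⟩
  ext s hs
  rw [Measure.map_apply hm hs, sphArea, Measure.toSphere_apply' _ (hm hs),
    Measure.toSphere_apply' _ hs]
  congr 1
  have h : (g ⁻¹' (Set.Ioo (0 : ℝ) 1 • ((Subtype.val : Sph k → _) '' s))) =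
      Set.Ioo (0 : ℝ) 1 • ((Subtype.val : Sph k → _) '' (sphIsometry g ⁻¹' s)) := by
    ext x
    simp only [Set.mem_preimage, Set.mem_smul, Set.mem_image]
    constructor
    · rintro ⟨r, hr, _, ⟨y, hy, rfl⟩, h⟩
      refine ⟨r, hr, _, ⟨(sphIsometry g).symm y, by simpa using hy, rfl⟩, ?_⟩
      change r • g.symm y.1 = x
      rw [← map_smul, h, g.symm_apply_apply]
    · rintro ⟨r, hr, _, ⟨y, hy, rfl⟩, rfl⟩
      exact ⟨r, hr, _, ⟨sphIsometry g y, hy, rfl⟩, by rw [coe_sphIsometry, map_smul]⟩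
  rw [← h]
  exact g.measurePreserving.measure_preimage_emb g.toHomeomorph.measurableEmbedding _

/-- Substituting linear forms for the variables does not raise the degree. -/
theorem pullback_sphIsometry_mem {ν : ℕ} {w : Smooth (𝓡 k) (Sph k)} (hw : w ∈ sphPoly k ν) :
    pullback (sphIsometry g) w ∈ sphPoly k ν := by
  obtain ⟨p, hp, rfl⟩ := mem_sphPoly_iff.1 hw
  set L : Fin (k + 1) → MvPolynomial (Fin (k + 1)) ℝ := fun i =>
    ∑ j, MvPolynomial.C (g (EuclideanSpace.single j 1) i) * MvPolynomial.X j with hL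
  have hLh : ∀ i, (L i).IsHomogeneous 1 := fun i =>
    MvPolynomial.IsHomogeneous.sum _ _ _ fun j _ => MvPolynomial.isHomogeneous_C_mul_X _ _
  have hLe : ∀ (x : Sph k) i, MvPolynomial.eval (fun j => x.1 j) (L i) = g x.1 i := by
    intro x i
    have hx : x.1 = ∑ j, x.1 j • EuclideanSpace.single j (1 : ℝ) := by
      ext i
      simp [Pi.single_apply]
    conv_rhs => rw [hx]
    simp [hL, map_sum, mul_comm]
  have h1 : pullback (sphIsometry g) (restrictSph k p) =
      restrictSph k (MvPolynomial.aeval L p) := by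
    ext x
    change MvPolynomial.eval (fun i => g x.1 i) p = MvPolynomial.eval _ (MvPolynomial.aeval L p)
    clear hp hw
    induction p using MvPolynomial.induction_on with
    | C a => simp
    | add p q hp hq => simp only [map_add, hp, hq]
    | mul_X p i hp => simp only [map_mul, hp, MvPolynomial.aeval_X, MvPolynomial.eval_X, hLe]
  rw [h1, ← MvPolynomial.sum_homogeneousComponent p, map_sum, map_sum]
  refine Submodule.sum_mem _ fun n hn => ?_
  refine restrictSph_mem_of_isHomogeneous (n := 1 * n) ?_
    ((MvPolynomial.homogeneousComponent_isHomogeneous n p).aeval L hLh)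
  rw [one_mul]
  exact (Nat.lt_succ_iff.1 (Finset.mem_range.1 hn)).trans hp

end Isometries

/-! ### The kernel as a polynomial in the inner product -/

section ZonalKernel

variable {k : ℕ}

/-- The point of `ℝ^{k+1}` with first coordinate `c`, `i`-th coordinate `s` and the others `0`. -/
noncomputable def planePoint (i : Fin (k + 1)) (c s : ℝ) : EuclideanSpace ℝ (Fin (k + 1)) :=
  c • EuclideanSpace.single 0 1 + s • EuclideanSpace.single i 1

theorem inner_planePoint {i : Fin (k + 1)} (hi : i ≠ 0) (c s c' s' : ℝ) :
    inner ℝ (planePoint i c s) (planePoint i c' s') = c * c' + s * s' := by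
  simp [planePoint, inner_add_left, inner_add_right, real_inner_smul_left, real_inner_smul_right,
    hi, hi.symm, EuclideanSpace.inner_single_left, mul_comm]

theorem inner_planePoint_right (i : Fin (k + 1)) (c s : ℝ) (x : EuclideanSpace ℝ (Fin (k + 1))) :
    inner ℝ x (planePoint i c s) = c * x 0 + s * x i := by
  simp [planePoint, inner_add_right, real_inner_smul_right, EuclideanSpace.inner_single_right]

theorem norm_planePoint {i : Fin (k + 1)} (hi : i ≠ 0) {c s : ℝ} (h : c ^ 2 + s ^ 2 = 1) :
    ‖planePoint i c s‖ = 1 := by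
  have h1 := real_inner_self_eq_norm_sq (planePoint i c s)
  rw [inner_planePoint hi, ← sq, ← sq, h] at h1
  exact (pow_eq_one_iff_of_nonneg (norm_nonneg _) two_ne_zero).1 h1.symm

theorem planePoint_apply {i : Fin (k + 1)} (c s : ℝ) (j : Fin (k + 1)) :
    planePoint i c s j = c * (if j = 0 then 1 else 0) + s * (if j = i then 1 else 0) := by
  simp [planePoint]

/-- Adding the values at `s` and `-s` leaves only even powers of `s`, and these are powers of `1 -
c²` of the same total degree. -/
theorem exists_polynomial_eval_planePoint {i : Fin (k + 1)} (hi : i ≠ 0)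
    (p : MvPolynomial (Fin (k + 1)) ℝ) :
    ∃ Z : Polynomial ℝ, Z.natDegree ≤ p.totalDegree ∧ ∀ c s, c ^ 2 + s ^ 2 = 1 →
      MvPolynomial.eval (fun j => planePoint i c s j) p +
        MvPolynomial.eval (fun j => planePoint i c (-s) j) p = Z.eval c := by
  classical
  -- As `0 ^ 0 = 1`, this is `1` if the monomial involves only the coordinates `0` and `i`, and `0`
  -- otherwise.
  set κ : (Fin (k + 1) →₀ ℕ) → ℝ := fun d => ∏ j ∈ (Finset.univ.erase 0).erase i, (0 : ℝ) ^ d j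
  set Q : (Fin (k + 1) →₀ ℕ) → Polynomial ℝ := fun d => Polynomial.C (p.coeff d * κ d) *
    (Polynomial.X ^ d 0 * if Even (d i) then 2 * (1 - Polynomial.X ^ 2) ^ (d i / 2) else 0) with hQ
  have hi' : i ∈ Finset.univ.erase (0 : Fin (k + 1)) := Finset.mem_erase.2 ⟨hi, Finset.mem_univ _⟩
  have hmon : ∀ (d : Fin (k + 1) →₀ ℕ) (c s : ℝ),
      ∏ j, planePoint i c s j ^ d j = c ^ d 0 * (s ^ d i * κ d) := by
    intro d c s
    rw [← Finset.mul_prod_erase _ _ (Finset.mem_univ (0 : Fin (k + 1))),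
      ← Finset.mul_prod_erase _ _ hi']
    congr 1
    · simp [planePoint_apply, hi.symm]
    · congr 1
      · simp [planePoint_apply, hi]
      · refine Finset.prod_congr rfl fun j hj => ?_
        simp only [Finset.mem_erase] at hj
        simp [planePoint_apply, hj.1, hj.2.1]
  refine ⟨∑ d ∈ p.support, Q d, ?_, ?_⟩
  · refine Polynomial.natDegree_sum_le_of_forall_le _ _ fun d hd => ?_
    have hdeg : d 0 + d i ≤ p.totalDegree := by
      refine le_trans ?_ (MvPolynomial.le_totalDegree hd)
      rw [Finsupp.sum_fintype _ _ fun _ => rfl, ← Finset.add_sum_erase _ _ (Finset.mem_univ 0),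
        ← Finset.add_sum_erase _ _ hi']
      omega
    refine (Polynomial.natDegree_C_mul_le _ _).trans (Polynomial.natDegree_mul_le.trans ?_)
    rw [Polynomial.natDegree_X_pow]
    refine le_trans (Nat.add_le_add_left ?_ _) hdeg
    split_ifs with h
    · have h1 : (1 - Polynomial.X ^ 2 : Polynomial ℝ).natDegree ≤ 2 := by compute_degree
      have h2 : (2 : Polynomial ℝ).natDegree = 0 := Polynomial.natDegree_ofNat 2
      calc _ ≤ 0 + d i / 2 * 2 := Polynomial.natDegree_mul_le.trans
            (Nat.add_le_add h2.le (Polynomial.natDegree_pow_le.trans (Nat.mul_le_mul_left _ h1)))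
        _ ≤ d i := by omega
    · simp
  · intro c s hcs
    rw [MvPolynomial.eval_eq', MvPolynomial.eval_eq', ← Finset.sum_add_distrib,
      Polynomial.eval_finsetSum]
    refine Finset.sum_congr rfl fun d _ => ?_
    rw [hmon, hmon, hQ]
    simp only [Polynomial.eval_mul, Polynomial.eval_C, Polynomial.eval_pow, Polynomial.eval_X]
    split_ifs with h
    · obtain ⟨j, hj⟩ := h
      have h1 : d i / 2 = j := by omega
      have h2 : (1 - c ^ 2) = s ^ 2 := by linarith
      simp only [Polynomial.eval_mul, Polynomial.eval_pow, Polynomial.eval_sub,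
        Polynomial.eval_one, Polynomial.eval_X, Polynomial.eval_ofNat, h1, h2]
      rw [hj, ← two_mul, pow_mul, pow_mul, neg_sq]
      ring
    · rw [(Nat.not_even_iff_odd.1 h).neg_pow]
      simp only [Polynomial.eval_zero]
      ring

/-- Isometries act transitively on pairs of points with given inner product, so the kernel depends
only on it. The points `planePoint i c s` and `planePoint i c (-s)` both have inner product `c` with
the pole, and averaging the kernel over them gives a polynomial in `c`. -/
theorem exists_zonal_kernel (hk : 1 ≤ k) {ν : ℕ} {N : Type*} [Fintype N] [DecidableEq N]
    {e : N → Smooth (𝓡 k) (Sph k)}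
    (he : ∀ m n, ∫ p, e m p * e n p ∂(sphArea k) = if m = n then 1 else 0)
    (hspan : Submodule.span ℝ (Set.range e) = sphPoly k ν) :
    ∃ Z : Polynomial ℝ, Z.natDegree ≤ ν ∧
      ∀ x y, ∑ n, e n x * e n y = Z.eval (inner ℝ x.1 y.1) := by
  obtain ⟨i, hi⟩ : ∃ i : Fin (k + 1), i ≠ 0 := ⟨⟨1, by omega⟩, by simp [Fin.ext_iff]⟩
  have hinv : ∀ g : EuclideanSpace ℝ (Fin (k + 1)) ≃ₗᵢ[ℝ] EuclideanSpace ℝ (Fin (k + 1)),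
      ∀ x y : Sph k, ∑ n, e n (sphIsometry g x) * e n (sphIsometry g y) =
        ∑ n, e n x * e n y := fun g => by
    refine sum_mul_apply_eq he _ (measurePreserving_sphIsometry g) fun n => ?_
    rw [hspan]
    exact pullback_sphIsometry_mem g (hspan ▸ Submodule.subset_span ⟨n, rfl⟩)
  have hpair : ∀ x y x' y' : Sph k, inner ℝ x.1 y.1 = inner ℝ x'.1 y'.1 →
      ∑ n, e n x * e n y = ∑ n, e n x' * e n y' := by
    intro x y x' y' h
    obtain ⟨g, h1, h2⟩ := exists_isometry_map_pair (x := x.1) (y := y.1) (x' := x'.1) (y' := y'.1)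
      (by rw [norm_eq_of_mem_sphere, norm_eq_of_mem_sphere])
      (by rw [norm_eq_of_mem_sphere, norm_eq_of_mem_sphere]) h
    rw [← hinv g x y]
    have e1 : sphIsometry g x = x' := Subtype.ext h1
    have e2 : sphIsometry g y = y' := Subtype.ext h2
    rw [e1, e2]
  set x₀ : Sph k := ⟨planePoint i 1 0, by
    rw [mem_sphere_zero_iff_norm]; exact norm_planePoint hi (by norm_num)⟩
  obtain ⟨p, hp, hpe⟩ := mem_sphPoly_iff.1 (hspan ▸ Submodule.sum_mem _ fun n _ =>
    Submodule.smul_mem _ (e n x₀) (Submodule.subset_span ⟨n, rfl⟩) :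
      (∑ n, e n x₀ • e n) ∈ sphPoly k ν)
  have hpe' : ∀ y : Sph k, ∑ n, e n x₀ * e n y = MvPolynomial.eval (fun j => y.1 j) p := by
    intro y
    rw [← restrictSph_apply, hpe, sum_smooth_apply]
    rfl
  obtain ⟨Z, hZd, hZ⟩ := exists_polynomial_eval_planePoint hi p
  refine ⟨Polynomial.C 2⁻¹ * Z, (Polynomial.natDegree_C_mul_le _ _).trans (hZd.trans hp),
    fun x y => ?_⟩
  set c := inner ℝ x.1 y.1 with hc
  have hc1 : |c| ≤ 1 := by
    have := abs_real_inner_le_norm x.1 y.1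
    rwa [norm_eq_of_mem_sphere, norm_eq_of_mem_sphere, one_mul] at this
  have hc2 : 0 ≤ 1 - c ^ 2 := by
    have := (sq_le_one_iff_abs_le_one c).2 hc1
    linarith
  set s := √(1 - c ^ 2) with hs
  have hcs : c ^ 2 + s ^ 2 = 1 := by rw [hs, Real.sq_sqrt hc2]; ring
  have hcs' : c ^ 2 + (-s) ^ 2 = 1 := by rw [neg_sq, hcs]
  have h1 := hpair x y x₀ ⟨planePoint i c s, by
    rw [mem_sphere_zero_iff_norm]; exact norm_planePoint hi hcs⟩ (by
      change c = inner ℝ (planePoint i 1 0) (planePoint i c s)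
      rw [inner_planePoint hi]; ring)
  have h2 := hpair x y x₀ ⟨planePoint i c (-s), by
    rw [mem_sphere_zero_iff_norm]; exact norm_planePoint hi hcs'⟩ (by
      change c = inner ℝ (planePoint i 1 0) (planePoint i c (-s))
      rw [inner_planePoint hi]; ring)
  rw [hpe'] at h1 h2
  have h3 := hZ c s hcs
  rw [Polynomial.eval_mul, Polynomial.eval_C, ← h3, ← h1, ← h2]
  ring

end ZonalKernel

/-! ### Integration by parts for zonal functions -/

section IntegrationByParts

variable {k : ℕ}

theorem integrable_sph {f : Sph k → ℝ} (hf : Continuous f) : Integrable f (sphArea k) :=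
  hf.integrable_of_hasCompactSupport (HasCompactSupport.of_compactSpace _)

theorem continuous_sph_apply (i : Fin (k + 1)) : Continuous fun x : Sph k => x.1 i := by
  fun_prop

/-- The integral of `x_i h(x_0)` does not change when `x` is rotated in the plane of coordinates `0`
and `i`; the integrand here is the derivative in the angle at zero. -/
theorem integral_rotation_derivative {i : Fin (k + 1)} (hi : i ≠ 0) (h : Polynomial ℝ) :
    ∫ x : Sph k, (x.1 0 * h.eval (x.1 0) - x.1 i ^ 2 * h.derivative.eval (x.1 0)) ∂(sphArea k)
      = 0 := by
  set F : ℝ → Sph k → ℝ := fun s x => (Real.sin s * x.1 0 + Real.cos s * x.1 i) *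
    h.eval (Real.cos s * x.1 0 + -Real.sin s * x.1 i) with hF
  set F' : ℝ → Sph k → ℝ := fun s x => (Real.cos s * x.1 0 + -Real.sin s * x.1 i) *
      h.eval (Real.cos s * x.1 0 + -Real.sin s * x.1 i) +
    (Real.sin s * x.1 0 + Real.cos s * x.1 i) *
      (h.derivative.eval (Real.cos s * x.1 0 + -Real.sin s * x.1 i) *
        (-Real.sin s * x.1 0 + -Real.cos s * x.1 i)) with hF'
  have hF'c : Continuous (Function.uncurry F') := by
    simp only [hF', Function.uncurry_def]
    have h0 : ∀ j, Continuous fun q : ℝ × Sph k => q.2.1 j := fun j =>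
      (continuous_sph_apply j).comp continuous_snd
    have h1 : Continuous fun q : ℝ × Sph k => Real.cos q.1 * q.2.1 0 + -Real.sin q.1 * q.2.1 i := by
      have := h0 0; have := h0 i; fun_prop
    have h2 := h.continuous.comp h1
    have h3 := h.derivative.continuous.comp h1
    have := h0 0
    have := h0 i
    simp only [Function.comp_def] at h2 h3
    fun_prop
  have hFc : ∀ s, Continuous (F s) := fun s => by
    have h1 : Continuous fun x : Sph k => Real.cos s * x.1 0 + -Real.sin s * x.1 i := by
      fun_prop
    have h2 := h.continuous.comp h1
    simp only [Function.comp_def] at h2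
    simp only [hF]
    fun_prop
  have hd : ∀ s x, HasDerivAt (fun s => F s x) (F' s x) s := by
    intro s x
    have h1 : HasDerivAt (fun s => Real.cos s * x.1 0 + -Real.sin s * x.1 i)
        (-Real.sin s * x.1 0 + -Real.cos s * x.1 i) s :=
      ((Real.hasDerivAt_cos s).mul_const _).add ((Real.hasDerivAt_sin s).neg.mul_const _)
    have h2 : HasDerivAt (fun s => Real.sin s * x.1 0 + Real.cos s * x.1 i)
        (Real.cos s * x.1 0 + -Real.sin s * x.1 i) s :=
      ((Real.hasDerivAt_sin s).mul_const _).add ((Real.hasDerivAt_cos s).mul_const _)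
    exact h2.mul ((h.hasDerivAt _).comp s h1)
  obtain ⟨B, hB⟩ := (isCompact_Icc.prod isCompact_univ :
    IsCompact (Set.Icc (-1 : ℝ) 1 ×ˢ (Set.univ : Set (Sph k)))).exists_bound_of_continuousOn
      hF'c.continuousOn
  have key := (hasDerivAt_integral_of_dominated_loc_of_deriv_le (μ := sphArea k) (F := F)
    (F' := F') (x₀ := 0) (bound := fun _ => B) (Metric.ball_mem_nhds (0 : ℝ) one_pos)
    (Eventually.of_forall fun s => (hFc s).aestronglyMeasurable) (integrable_sph (hFc 0))
    (hF'c.comp (Continuous.prodMk_right 0)).aestronglyMeasurable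
    (Eventually.of_forall fun x s hs => hB (s, x) ⟨by
      rw [Metric.mem_ball, dist_zero_right, Real.norm_eq_abs, abs_lt] at hs
      exact ⟨hs.1.le, hs.2.le⟩, Set.mem_univ _⟩)
    (integrable_const B)
    (Eventually.of_forall fun x s _ => hd s x)).2
  have hconst : ∀ s, ∫ x, F s x ∂(sphArea k) = ∫ x, F 0 x ∂(sphArea k) := by
    intro s
    have hcs : Real.cos s ^ 2 + (-Real.sin s) ^ 2 = 1 := by rw [neg_sq, Real.cos_sq_add_sin_sq]
    have hsc : Real.sin s ^ 2 + Real.cos s ^ 2 = 1 := Real.sin_sq_add_cos_sq s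
    obtain ⟨g, hg0, hgi⟩ := exists_isometry_map_pair
      (x := planePoint i 1 0) (y := planePoint i 0 1)
      (x' := planePoint i (Real.cos s) (-Real.sin s))
      (y' := planePoint i (Real.sin s) (Real.cos s))
      (by rw [norm_planePoint hi (by norm_num), norm_planePoint hi hcs])
      (by rw [norm_planePoint hi (by norm_num), norm_planePoint hi hsc])
      (by rw [inner_planePoint hi, inner_planePoint hi]; ring)
    have e0 : ∀ x : Sph k, (sphIsometry g.symm x).1 0 =
        Real.cos s * x.1 0 + -Real.sin s * x.1 i := by
      intro x
      have h1 := g.inner_map_map (g.symm x.1) (planePoint i 1 0)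
      rw [g.apply_symm_apply, hg0, inner_planePoint_right, inner_planePoint_right, one_mul,
        zero_mul, add_zero] at h1
      exact h1.symm
    have ei : ∀ x : Sph k, (sphIsometry g.symm x).1 i =
        Real.sin s * x.1 0 + Real.cos s * x.1 i := by
      intro x
      have h1 := g.inner_map_map (g.symm x.1) (planePoint i 0 1)
      rw [g.apply_symm_apply, hgi, inner_planePoint_right, inner_planePoint_right, one_mul,
        zero_mul, zero_add] at h1
      exact h1.symm
    rw [← (measurePreserving_sphIsometry g.symm).integral_comp
      (sphIsometry g.symm).toHomeomorph.measurableEmbedding (F 0)]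
    refine integral_congr_ae (Eventually.of_forall fun x => ?_)
    simp [hF, e0, ei]
  have h0 : HasDerivAt (fun s => ∫ x, F s x ∂(sphArea k)) 0 0 := by
    rw [funext hconst]
    exact hasDerivAt_const _ _
  have := key.unique h0
  simp only [hF', Real.sin_zero, Real.cos_zero, zero_mul, one_mul, neg_zero, zero_add, add_zero,
    neg_mul] at this
  rw [← this]
  refine integral_congr_ae (Eventually.of_forall fun x => ?_)
  simp only
  ring

/-- The mean over the sphere of a polynomial in the first coordinate. -/
noncomputable def zonalMean (k : ℕ) (h : Polynomial ℝ) : ℝ :=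
  ∫ x : Sph k, h.eval (x.1 0) ∂(sphArea k)

theorem continuous_eval_sph (h : Polynomial ℝ) : Continuous fun x : Sph k => h.eval (x.1 0) :=
  h.continuous.comp (continuous_sph_apply 0)

theorem zonalMean_add (f g : Polynomial ℝ) :
    zonalMean k (f + g) = zonalMean k f + zonalMean k g := by
  simp only [zonalMean, Polynomial.eval_add]
  exact integral_add (integrable_sph (continuous_eval_sph f)) (integrable_sph (continuous_eval_sph g))

/-- Sum `integral_rotation_derivative` over the `k` indices `i ≠ 0` and use `∑ x_i² = 1 - x_0²`.
This is integration by parts for the weight `(1 - t²)^(k/2 - 1)`, which need not be made explicit.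
-/
theorem zonalMean_integration_by_parts (h : Polynomial ℝ) :
    zonalMean k ((1 - Polynomial.X ^ 2) * h.derivative - Polynomial.C (k : ℝ) * Polynomial.X * h)
      = 0 := by
  have hsum : ∑ i ∈ Finset.univ.erase (0 : Fin (k + 1)),
      ∫ x : Sph k, (x.1 0 * h.eval (x.1 0) - x.1 i ^ 2 * h.derivative.eval (x.1 0)) ∂(sphArea k)
        = 0 :=
    Finset.sum_eq_zero fun i hi => integral_rotation_derivative (Finset.mem_erase.1 hi).1 h
  rw [← integral_finsetSum] at hsum
  · rw [← neg_eq_zero, ← hsum, zonalMean, ← integral_neg]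
    refine integral_congr_ae (Eventually.of_forall fun x => ?_)
    have h1 : ∑ i ∈ Finset.univ.erase (0 : Fin (k + 1)), x.1 i ^ 2 = 1 - x.1 0 ^ 2 := by
      have h2 := EuclideanSpace.norm_sq_eq x.1
      rw [norm_eq_of_mem_sphere] at h2
      rw [← Finset.add_sum_erase _ _ (Finset.mem_univ (0 : Fin (k + 1)))] at h2
      simp only [Real.norm_eq_abs, sq_abs] at h2
      linarith
    simp only [Finset.sum_sub_distrib, ← Finset.sum_mul, h1, Finset.sum_const,
      Finset.card_erase_of_mem (Finset.mem_univ (0 : Fin (k + 1))), Finset.card_univ,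
      Fintype.card_fin, Nat.add_sub_cancel, nsmul_eq_mul, Polynomial.eval_sub, Polynomial.eval_mul,
      Polynomial.eval_one, Polynomial.eval_pow, Polynomial.eval_X, Polynomial.eval_C]
    ring
  · intro i _
    have h1 := continuous_eval_sph (k := k) h
    have h2 := continuous_eval_sph (k := k) h.derivative
    exact integrable_sph (by fun_prop)

end IntegrationByParts

/-! ### The Jacobi equation of the kernel -/

section Jacobi

open Polynomial

variable {k : ℕ}

/-- The Jacobi operator `(1 - X²) (d/dX)² - (1 + (k + 1) X) d/dX`. -/
noncomputable def jacobiOp (k : ℕ) (h : ℝ[X]) : ℝ[X] :=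
  (1 - X ^ 2) * derivative (derivative h) - (1 + C (k + 1 : ℝ) * X) * derivative h

theorem coeff_jacobiOp (h : ℝ[X]) (m : ℕ) : (jacobiOp k h).coeff m =
    (m + 2) * (m + 1) * h.coeff (m + 2) - (m + 1) * h.coeff (m + 1) -
      m * (m + k) * h.coeff m := by
  rw [jacobiOp, sub_mul, add_mul, one_mul, one_mul, mul_assoc, coeff_sub, coeff_sub, coeff_add,
    coeff_C_mul]
  rcases m with _ | _ | m
  · simp [coeff_derivative, one_add_one_eq_two]
    ring
  · simp [coeff_derivative, coeff_X_pow_mul', coeff_X_mul]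
    ring
  · simp [coeff_derivative, coeff_X_pow_mul', coeff_X_mul]
    ring

theorem degree_jacobiOp_lt {h : ℝ[X]} {n : ℕ} (hh : h.degree < n) :
    (jacobiOp k h).degree < n := by
  rw [degree_lt_iff_coeff_zero] at hh ⊢
  intro m hm
  rw [coeff_jacobiOp, hh m hm, hh (m + 1) (by omega), hh (m + 2) (by omega)]
  ring

/-- Integrating `(1 - X) h' q` by parts shows that the left side is minus the mean of `(1 - X)(1 -
X²) h' q'`, which is symmetric in `h` and `q`. -/
theorem zonalMean_jacobiOp_mul (h q : ℝ[X]) :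
    zonalMean k ((1 - X) * (jacobiOp k h * q)) = zonalMean k ((1 - X) * (h * jacobiOp k q)) := by
  have hform : ∀ h q : ℝ[X], zonalMean k ((1 - X) * (jacobiOp k h * q) +
      (1 - X) * ((1 - X ^ 2) * (derivative h * derivative q))) = 0 := by
    intro h q
    rw [← zonalMean_integration_by_parts (k := k) ((1 - X) * derivative h * q)]
    congr 1
    simp only [jacobiOp, derivative_mul, derivative_sub, derivative_one, derivative_X, map_add,
      map_one]
    ring
  have h1 := hform h q
  have h2 := hform q h
  rw [zonalMean_add] at h1 h2
  rw [mul_comm (derivative q)] at h2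
  rw [mul_comm h]
  linarith

/-- A nonnegative continuous function of mean zero vanishes, and every `c` in `[-1, 1)` is the first
coordinate of a point of the sphere, so `R` has infinitely many roots. -/
theorem eq_zero_of_zonalMean_mul_self (hk : 1 ≤ k) {R : ℝ[X]}
    (hR : zonalMean k ((1 - X) * (R * R)) = 0) : R = 0 := by
  obtain ⟨i, hi⟩ : ∃ i : Fin (k + 1), i ≠ 0 := ⟨⟨1, by omega⟩, by simp [Fin.ext_iff]⟩
  have hle : ∀ x : Sph k, x.1 0 ≤ 1 := fun x => by
    have := PiLp.norm_apply_le x.1 0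
    rw [norm_eq_of_mem_sphere] at this
    exact (le_abs_self _).trans this
  have h0 : (fun x : Sph k => ((1 - X) * (R * R)).eval (x.1 0)) =ᵐ[sphArea k] 0 := by
    refine (integral_eq_zero_iff_of_nonneg (fun x => ?_)
      (integrable_sph (continuous_eval_sph _))).1 hR
    simp only [eval_mul, eval_sub, eval_one, eval_X, Pi.zero_apply]
    exact mul_nonneg (by linarith [hle x]) (mul_self_nonneg _)
  have h1 := Measure.eq_of_ae_eq h0 (continuous_eval_sph _) continuous_const
  refine eq_zero_of_infinite_isRoot R (Set.Infinite.mono ?_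
    (Set.Ico_infinite (show (-1 : ℝ) < 1 by norm_num)))
  intro c hc
  have hcs : c ^ 2 + √(1 - c ^ 2) ^ 2 = 1 := by
    rw [Real.sq_sqrt (by nlinarith [hc.1, hc.2])]; ring
  have h2 := congrFun h1 ⟨planePoint i c (√(1 - c ^ 2)), by
    rw [mem_sphere_zero_iff_norm]; exact norm_planePoint hi hcs⟩
  have h3 : planePoint i c (√(1 - c ^ 2)) 0 = c := by
    simp [planePoint_apply, hi.symm]
  simp only [h3, eval_mul, eval_sub, eval_one, eval_X, Pi.zero_apply, mul_eq_zero, or_self] at h2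
  rcases h2 with h2 | h2
  · linarith [hc.2]
  · exact h2

variable {ν : ℕ} {Z : ℝ[X]}

/-- Since `(1 - X) q` vanishes at `1`, the reproducing property makes `Z` orthogonal, for the weight
`1 - X`, to all `q` of degree below `ν`. The remainder `R` has degree below `ν` because the
coefficients of degree `ν` cancel, and symmetry of the operator then makes `R` orthogonal to itself.
-/
theorem jacobiOp_eq_of_reproducing (hk : 1 ≤ k) (hZ : Z.natDegree ≤ ν)
    (hrep : ∀ r : ℝ[X], r.natDegree ≤ ν → zonalMean k (Z * r) = r.eval 1) :
    jacobiOp k Z = -(C (ν * (ν + k) : ℝ) * Z) := by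
  have horth : ∀ q : ℝ[X], q.degree < ν → zonalMean k ((1 - X) * (Z * q)) = 0 := by
    intro q hq
    have hdeg : ((1 - X) * q).natDegree ≤ ν := by
      rw [natDegree_le_iff_degree_le]
      refine (degree_mul_le _ _).trans ?_
      have h1 : (1 - X : ℝ[X]).degree ≤ 1 := by compute_degree
      rcases eq_or_ne q 0 with rfl | hq0
      · simp
      · rw [degree_eq_natDegree hq0] at hq ⊢
        have h2 : q.natDegree < ν := by exact_mod_cast hq
        calc (1 - X : ℝ[X]).degree + (q.natDegree : WithBot ℕ) ≤ 1 + (q.natDegree : WithBot ℕ) := by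
              gcongr
          _ ≤ ν := by exact_mod_cast (by omega : 1 + q.natDegree ≤ ν)
    have h := hrep _ hdeg
    rw [eval_mul, eval_sub, eval_one, eval_X, sub_self, zero_mul] at h
    rw [← h]
    congr 1
    ring
  set R := jacobiOp k Z + C (ν * (ν + k) : ℝ) * Z with hRdef
  have hRdeg : R.degree < ν := by
    rw [degree_lt_iff_coeff_zero]
    intro m hm
    have hz : ∀ j, ν < j → Z.coeff j = 0 := fun j hj =>
      coeff_eq_zero_of_natDegree_lt (lt_of_le_of_lt hZ hj)
    rw [hRdef, coeff_add, coeff_jacobiOp, coeff_C_mul, hz (m + 1) (by omega), hz (m + 2) (by omega)]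
    rcases hm.eq_or_lt with rfl | hm
    · ring
    · rw [hz m hm]; ring
  have hR : R = 0 := by
    refine eq_zero_of_zonalMean_mul_self hk ?_
    have h1 : (1 - X) * (R * R) = (1 - X) * (jacobiOp k Z * R) +
        (1 - X) * (Z * (C (ν * (ν + k) : ℝ) * R)) := by
      nth_rewrite 1 [hRdef]
      ring
    rw [h1, zonalMean_add, zonalMean_jacobiOp_mul, horth _ (degree_jacobiOp_lt hRdeg), horth,
      add_zero]
    rw [degree_lt_iff_coeff_zero] at hRdeg ⊢
    intro m hm
    rw [coeff_C_mul, hRdeg m hm, mul_zero]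
  exact eq_neg_of_add_eq_zero_left hR

/-- Evaluate the Jacobi equation and its derivative at `1`, where the coefficient `1 - X²` of the
highest derivative vanishes. -/
theorem derivatives_of_reproducing (hk : 1 ≤ k) (hZ : Z.natDegree ≤ ν)
    (hrep : ∀ r : ℝ[X], r.natDegree ≤ ν → zonalMean k (Z * r) = r.eval 1) :
    (derivative Z).eval 1 = ν * (ν + k) / (k + 2) * Z.eval 1 ∧
    (derivative (derivative Z)).eval 1 =
      (ν - 1) * (ν + k + 1) / (k + 4) * (derivative Z).eval 1 := by
  have h := jacobiOp_eq_of_reproducing hk hZ hrep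
  have h1 := congrArg (eval 1) h
  have h2 := congrArg (fun p => eval 1 (derivative p)) h
  simp only [jacobiOp, derivative_sub, derivative_mul, derivative_add, derivative_one,
    derivative_X_pow, derivative_C, derivative_X, derivative_neg, eval_sub, eval_mul, eval_add,
    eval_one, eval_pow, eval_X, eval_C, eval_neg, eval_zero, map_natCast, eval_natCast] at h1 h2
  constructor
  · field_simp
    linarith
  · field_simp
    push_cast at h2
    linarith

/-- `Z(1)` is the mean of `Z²`. Were it zero, `Z` would have mean zero, against the reproducing
property for the constant `1`. -/
theorem eval_one_pos_of_reproducing (hZ : Z.natDegree ≤ ν)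
    (hrep : ∀ r : ℝ[X], r.natDegree ≤ ν → zonalMean k (Z * r) = r.eval 1) : 0 < Z.eval 1 := by
  have hone := hrep 1 (by simp)
  rw [mul_one, eval_one] at hone
  have h := hrep Z hZ
  have hnn : 0 ≤ Z.eval 1 := by
    rw [← h]
    exact integral_nonneg fun x => by
      rw [eval_mul]; exact mul_self_nonneg _
  refine lt_of_le_of_ne hnn fun h0 => ?_
  rw [← h0] at h
  have h1 : (fun x : Sph k => (Z * Z).eval (x.1 0)) =ᵐ[sphArea k] 0 :=
    (integral_eq_zero_iff_of_nonneg (fun x => by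
      simp only [eval_mul, Pi.zero_apply]; exact mul_self_nonneg _)
      (integrable_sph (continuous_eval_sph _))).1 h
  have h2 : zonalMean k Z = 0 := by
    refine integral_eq_zero_of_ae (h1.mono fun x hx => ?_)
    simpa [eval_mul] using hx
  rw [h2] at hone
  exact zero_ne_one hone

end Jacobi

/-! ### The reproducing property in one variable -/

section SphereKernel

variable {k : ℕ}

/-- The reproducing property at the pole for the function `x ↦ r (x 0)`, a restriction of a
polynomial of degree at most `ν`. -/
theorem zonalMean_mul_of_kernel {ν : ℕ} {N : Type*} [Fintype N] [DecidableEq N]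
    {e : N → Smooth (𝓡 k) (Sph k)}
    (he : ∀ m n, ∫ p, e m p * e n p ∂(sphArea k) = if m = n then 1 else 0)
    (hspan : Submodule.span ℝ (Set.range e) = sphPoly k ν) {Z : Polynomial ℝ}
    (hZ : ∀ x y, ∑ n, e n x * e n y = Z.eval (inner ℝ x.1 y.1)) {r : Polynomial ℝ}
    (hr : r.natDegree ≤ ν) : zonalMean k (Z * r) = r.eval 1 := by
  set x₀ : Sph k := ⟨EuclideanSpace.single 0 1, by simp⟩ with hx₀
  set p : MvPolynomial (Fin (k + 1)) ℝ := Polynomial.aeval (MvPolynomial.X 0) r with hp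
  have heval : ∀ x : Sph k, restrictSph k p x = r.eval (x.1 0) := by
    intro x
    rw [restrictSph_apply, hp, Polynomial.aeval_eq_sum_range, Polynomial.eval_eq_sum_range]
    simp [map_sum, MvPolynomial.smul_eval]
  have hmem : restrictSph k p ∈ Submodule.span ℝ (Set.range e) := by
    rw [hspan, mem_sphPoly_iff]
    refine ⟨p, ?_, rfl⟩
    rw [hp, Polynomial.aeval_eq_sum_range]
    refine MvPolynomial.totalDegree_finsetSum_le fun j hj => ?_
    refine (MvPolynomial.totalDegree_smul_le _ _).trans ?_
    rw [MvPolynomial.totalDegree_X_pow]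
    exact (Nat.lt_succ_iff.1 (Finset.mem_range.1 hj)).trans hr
  have h := integral_sum_mul_mul he hmem x₀
  rw [heval] at h
  have h1 : x₀.1 0 = 1 := by simp [hx₀]
  rw [h1] at h
  rw [← h, zonalMean]
  refine integral_congr_ae (Eventually.of_forall fun y => ?_)
  simp only [hZ, heval, Polynomial.eval_mul]
  congr 2
  simp [hx₀, EuclideanSpace.inner_single_left]

end SphereKernel

/-! ### Orthonormal bases of tensor products -/

section TensorBasis

variable {E₁ : Type*} [NormedAddCommGroup E₁] [NormedSpace ℝ E₁]
  {H₁ : Type*} [TopologicalSpace H₁] {I₁ : ModelWithCorners ℝ E₁ H₁}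
  {M₁ : Type*} [TopologicalSpace M₁] [ChartedSpace H₁ M₁]
  {E₂ : Type*} [NormedAddCommGroup E₂] [NormedSpace ℝ E₂]
  {H₂ : Type*} [TopologicalSpace H₂] {I₂ : ModelWithCorners ℝ E₂ H₂}
  {M₂ : Type*} [TopologicalSpace M₂] [ChartedSpace H₂ M₂]
  {N₁ N₂ : Type*}

theorem extMul_apply (u : Smooth I₁ M₁) (w : Smooth I₂ M₂) (p : M₁ × M₂) :
    extMul u w p = u p.1 * w p.2 := rfl

theorem span_range_extMul (u : N₁ → Smooth I₁ M₁) (w : N₂ → Smooth I₂ M₂) :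
    Submodule.span ℝ (Set.range fun n : N₁ × N₂ => extMul (u n.1) (w n.2)) =
      tensor (Submodule.span ℝ (Set.range u)) (Submodule.span ℝ (Set.range w)) := by
  rw [tensor, Submodule.map₂_span_span, Set.image2_range]

theorem integral_extMul_mul [MeasurableSpace M₁] [MeasurableSpace M₂]
    {vol₁ : Measure M₁} {vol₂ : Measure M₂} [SFinite vol₁] [SFinite vol₂]
    [DecidableEq N₁] [DecidableEq N₂] {u : N₁ → Smooth I₁ M₁} {w : N₂ → Smooth I₂ M₂}
    (hu : ∀ m n, ∫ p, u m p * u n p ∂vol₁ = if m = n then 1 else 0)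
    (hw : ∀ m n, ∫ p, w m p * w n p ∂vol₂ = if m = n then 1 else 0) (m n : N₁ × N₂) :
    ∫ p, extMul (u m.1) (w m.2) p * extMul (u n.1) (w n.2) p ∂(vol₁.prod vol₂) =
      if m = n then 1 else 0 := by
  have h : ∀ p : M₁ × M₂, extMul (u m.1) (w m.2) p * extMul (u n.1) (w n.2) p =
      (u m.1 p.1 * u n.1 p.1) * (w m.2 p.2 * w n.2 p.2) := fun p => by
    simp only [extMul_apply]; ring
  simp only [h]
  rw [integral_prod_mul (fun x => u m.1 x * u n.1 x) (fun y => w m.2 y * w n.2 y), hu, hw]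
  simp only [Prod.ext_iff, ite_and, mul_ite, mul_one, mul_zero]
  split_ifs <;> rfl

theorem pullback_prodCongr_extMul (g₁ : M₁ ≃ₘ^∞⟮I₁, I₁⟯ M₁) (g₂ : M₂ ≃ₘ^∞⟮I₂, I₂⟯ M₂)
    (u : Smooth I₁ M₁) (w : Smooth I₂ M₂) :
    pullback (g₁.prodCongr g₂) (extMul u w) = extMul (pullback g₁ u) (pullback g₂ w) := rfl

end TensorBasis

/-! ### The circle times the sphere -/

section ProductManifold

variable {k : ℕ}

theorem span_range_trigFun (ρ : ℕ) :
    Submodule.span ℝ (Set.range fun m : Finset.Icc (-(ρ : ℤ)) ρ => trigFun m) = trigPoly ρ := by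
  rw [trigPoly]
  congr 1
  ext f
  simp [Set.mem_image]

theorem finrank_span_of_orthonormal {E : Type*} [NormedAddCommGroup E] [NormedSpace ℝ E]
    {H : Type*} [TopologicalSpace H] {I : ModelWithCorners ℝ E H}
    {M : Type*} [MetricSpace M] [ChartedSpace H M] {N : Type*} [Fintype N] [DecidableEq N]
    [CompactSpace M] [MeasurableSpace M] [BorelSpace M]
    {vol : Measure M} [IsFiniteMeasure vol] [vol.IsOpenPosMeasure] {e : N → Smooth I M}
    (he : ∀ m n, ∫ p, e m p * e n p ∂vol = if m = n then 1 else 0) :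
    Module.finrank ℝ (Submodule.span ℝ (Set.range e)) = Fintype.card N := by
  have h := orthonormal_l2 he
  let _ := l2Norm (I := I) vol
  let _ := l2Inner (I := I) vol
  exact finrank_span_eq_card h.linearIndependent

theorem isometry_rotation (z : Circle) : Isometry (rotation z) :=
  Isometry.of_dist_eq fun x y => by
    change dist ((z * x : Circle) : ℂ) ((z * y : Circle) : ℂ) = dist (x : ℂ) (y : ℂ)
    rw [dist_eq_norm, dist_eq_norm, Circle.coe_mul, Circle.coe_mul,
      ← mul_sub, norm_mul, Circle.norm_coe, one_mul]

/-- The rotations of the factors act transitively on `S¹ × S^k`. -/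
theorem exists_diffeomorph_tensor (ρ ν : ℕ) (p₀ p : Circle × Sph k) :
    ∃ g : (Circle × Sph k) ≃ₘ^∞⟮(𝓡 1).prod (𝓡 k), (𝓡 1).prod (𝓡 k)⟯ (Circle × Sph k),
      g p₀ = p ∧ Isometry g ∧
      MeasurePreserving g (arcLength.prod (sphArea k)) (arcLength.prod (sphArea k)) ∧
      ∀ m : Finset.Icc (-(ρ : ℤ)) ρ, ∀ w ∈ sphPoly k ν,
        pullback g (extMul (trigFun m) w) ∈ tensor (trigPoly ρ) (sphPoly k ν) := by
  obtain ⟨g, hg, -⟩ := exists_isometry_map_pair (x := p₀.2.1) (x' := p.2.1) (y := 0) (y' := 0)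
    (by rw [norm_eq_of_mem_sphere, norm_eq_of_mem_sphere]) rfl (by simp)
  refine ⟨(rotation (p.1 * p₀.1⁻¹)).prodCongr (sphIsometry g), ?_, ?_, ?_, ?_⟩
  · exact Prod.ext (inv_mul_cancel_right p.1 p₀.1) (Subtype.ext hg)
  · exact Isometry.prodMap (isometry_rotation _) (isometry_sphIsometry g)
  · exact (measurePreserving_mul_left_circle _).prod (measurePreserving_sphIsometry g)
  · intro m w hw
    rw [pullback_prodCongr_extMul]
    exact Submodule.apply_mem_map₂ _
      (pullback_rotation_trigFun_mem _ (by simpa using Finset.mem_Icc.1 m.2))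
      (pullback_sphIsometry_mem g hw)

theorem extChartAt_prod_target (p : Circle × Sph k) :
    (extChartAt ((𝓡 1).prod (𝓡 k)) p).target = Set.univ := by
  have := Fact.mk (@finrank_euclideanSpace_fin ℝ _ (k + 1))
  rw [extChartAt_prod, PartialEquiv.prod_target, extChartAt_circle_target,
    extChartAt_sphere_target, Set.univ_prod_univ]

theorem extChartAt_prod_self (p : Circle × Sph k) :
    extChartAt ((𝓡 1).prod (𝓡 k)) p p = 0 := by
  have := Fact.mk (@finrank_euclideanSpace_fin ℝ _ (k + 1))
  rw [extChartAt_prod]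
  exact Prod.ext (extChartAt_circle_self p.1) (extChartAt_sphere_self p.2)

/-- The ratio `Z'(1) / Z(1)` for the reproducing kernel `Z` of the polynomials of degree at most
`ν` on `S^k`. -/
noncomputable def gradRatio (k ν : ℕ) : ℝ := ν * (ν + k) / (k + 2)

/-- The ratio `Z''(1) / Z'(1)` for the reproducing kernel `Z` of the polynomials of degree at most
`ν` on `S^k`. -/
noncomputable def hessRatio (k ν : ℕ) : ℝ := (ν - 1) * (ν + k + 1) / (k + 4)

/-- The normalized covariance of the Hessian of a random function in `T_ρ ⊗ V_ν`. -/
noncomputable def tensorCov (k ρ ν : ℕ) :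
    Matrix ((Fin 1 ⊕ Fin k) × (Fin 1 ⊕ Fin k)) ((Fin 1 ⊕ Fin k) × (Fin 1 ⊕ Fin k)) ℝ :=
  isoCov (hessRatio 1 ρ / gradRatio 1 ρ) (gradRatio 1 ρ)⁻¹
    (hessRatio k ν / gradRatio k ν) (gradRatio k ν)⁻¹

/-- The density of the critical points of a random function in `T_ρ ⊗ V_ν`. -/
noncomputable def tensorDensity (k ρ ν : ℕ) : ℝ≥0∞ :=
  ENNReal.ofReal ((√(2 * Real.pi))⁻¹ ^ (1 + k) * (√(gradRatio 1 ρ) * √(gradRatio k ν) ^ k)) *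
    gaussAbsDet (tensorCov k ρ ν)

theorem gradRatio_pos {ν : ℕ} (hν : 1 ≤ ν) : 0 < gradRatio k ν := by
  have : (0 : ℝ) < ν := by exact_mod_cast hν
  unfold gradRatio
  positivity

theorem finrank_tensor (k ρ ν : ℕ) :
    Module.finrank ℝ (tensor (trigPoly ρ) (sphPoly k ν)) =
      (2 * ρ + 1) * Module.finrank ℝ (sphPoly k ν) := by
  obtain ⟨w, hw, hspan⟩ := exists_orthonormal_family (sphArea k) (sphPoly k ν)
  have h := finrank_span_of_orthonormal (integral_extMul_mul
    (u := fun m : Finset.Icc (-(ρ : ℤ)) ρ => trigFun m)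
    (fun m n => by rw [integral_trigFun_mul]; simp only [Subtype.ext_iff]) hw)
  rw [span_range_extMul (fun m : Finset.Icc (-(ρ : ℤ)) ρ => trigFun m) w, span_range_trigFun,
    hspan] at h
  rw [h, Fintype.card_prod, Fintype.card_fin, Fintype.card_coe, Int.card_Icc]
  congr 1
  omega

/-- The function of `r` in the limit does not involve `ρ` or `ν`, so the quotient of expected count
and density is the same for all degrees. Semidefiniteness holds because `tensorCov` is the
covariance of an actual Gaussian matrix; it is needed again for the limiting covariance. -/
theorem expectedCrit_tensor (hk : 1 ≤ k) {ρ ν : ℕ} (hρ : 1 ≤ ρ) (hν : 1 ≤ ν)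
    (p₀ : Circle × Sph k) :
    (tensorCov k ρ ν).PosSemidef ∧ (tensorDensity k ρ ν ≠ 0 →
      (expectedCrit (arcLength.prod (sphArea k)) (tensor (trigPoly ρ) (sphPoly k ν)) ≠ 0 ∧
      expectedCrit (arcLength.prod (sphArea k)) (tensor (trigPoly ρ) (sphPoly k ν)) ≠ ⊤) ∧
      Tendsto (fun r => (arcLength.prod (sphArea k)) Set.univ *
        volume (chartParam ((𝓡 1).prod (𝓡 k)) p₀ (prodCoord 1 k) ⁻¹' Metric.closedBall p₀ r) /
        (arcLength.prod (sphArea k)) (Metric.closedBall p₀ r)) (𝓝[>] (0 : ℝ))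
        (𝓝 (expectedCrit (arcLength.prod (sphArea k)) (tensor (trigPoly ρ) (sphPoly k ν)) /
          tensorDensity k ρ ν))) := by
  have hfact := Fact.mk (@finrank_euclideanSpace_fin ℝ _ (k + 1))
  have hρ' : (1 : ℝ) ≤ ρ := by exact_mod_cast hρ
  obtain ⟨w, hw, hspan⟩ := exists_orthonormal_family (sphArea k) (sphPoly k ν)
  set u : Finset.Icc (-(ρ : ℤ)) ρ → Smooth (𝓡 1) Circle := fun m => trigFun m with hu_def
  have hu : ∀ m n, ∫ p, u m p * u n p ∂arcLength = if m = n then 1 else 0 := fun m n => by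
    rw [hu_def, integral_trigFun_mul]; simp only [Subtype.ext_iff]
  have hspan' : Submodule.span ℝ (Set.range fun n : Finset.Icc (-(ρ : ℤ)) ρ × _ =>
      extMul (u n.1) (w n.2)) = tensor (trigPoly ρ) (sphPoly k ν) := by
    rw [span_range_extMul, span_range_trigFun, hspan]
  have he := integral_extMul_mul hu hw
  obtain ⟨Z, hZdeg, hZ⟩ := exists_zonal_kernel hk hw hspan
  have hrep : ∀ r : Polynomial ℝ, r.natDegree ≤ ν → zonalMean k (Z * r) = r.eval 1 :=
    fun r hr => zonalMean_mul_of_kernel hw hspan hZ hr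
  obtain ⟨hy₁, hy₂⟩ := derivatives_of_reproducing hk hZdeg hrep
  have hy := eval_one_pos_of_reproducing hZdeg hrep
  rw [← gradRatio] at hy₁
  rw [← hessRatio] at hy₂
  have hz : 0 < (trigKernel ρ).eval 1 := by
    rw [trigKernel_eval_one]; positivity
  -- The explicit sums for the circle are the case `k = 1` of the ratios for spheres.
  have hz₁ : (trigKernel ρ).derivative.eval 1 = gradRatio 1 ρ * (trigKernel ρ).eval 1 := by
    rw [trigKernel_derivative_eval_one, trigKernel_eval_one, gradRatio]
    have := Real.pi_ne_zero
    push_cast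
    field_simp
    ring
  have hz₂ : (trigKernel ρ).derivative.derivative.eval 1 =
      hessRatio 1 ρ * (trigKernel ρ).derivative.eval 1 := by
    rw [trigKernel_derivative_derivative_eval_one, trigKernel_derivative_eval_one, hessRatio]
    have := Real.pi_ne_zero
    push_cast
    field_simp
    ring
  have hJ₁ := isotropicJet_circle p₀.1 (u := u) (sum_trigFun_mul ρ)
  have hJ₂ := isotropicJet_sphere p₀.2 hZ
  have hU : ∀ m, ContDiff ℝ ∞ fun a : Fin 1 → ℝ =>
      u m ((extChartAt (𝓡 1) p₀.1).symm (WithLp.toLp 2 a)) := fun m =>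
    contDiff_comp_chartParam (extChartAt_circle_target p₀.1)
      (EuclideanSpace.equiv (Fin 1) ℝ).symm (u m)
  have hW : ∀ l, ContDiff ℝ ∞ fun a : Fin k → ℝ =>
      w l ((extChartAt (𝓡 k) p₀.2).symm (WithLp.toLp 2 a)) := fun l =>
    contDiff_comp_chartParam (extChartAt_sphere_target p₀.2)
      (EuclideanSpace.equiv (Fin k) ℝ).symm (w l)
  have hcomp : ∀ n : Finset.Icc (-(ρ : ℤ)) ρ × _, (extMul (u n.1) (w n.2) : Circle × Sph k → ℝ) ∘
      chartParam ((𝓡 1).prod (𝓡 k)) p₀ (prodCoord 1 k) = prodFun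
        (fun a => u n.1 ((extChartAt (𝓡 1) p₀.1).symm (WithLp.toLp 2 a)))
        (fun a => w n.2 ((extChartAt (𝓡 k) p₀.2).symm (WithLp.toLp 2 a))) := fun n =>
    extMul_comp_chart p₀ (u n.1) (w n.2)
  rw [hz₂, hz₁] at hJ₁
  rw [hy₂, hy₁] at hJ₂
  have hG₁ := gradRatio_pos (k := 1) hρ
  have hG₂ := gradRatio_pos (k := k) hν
  set z := (trigKernel ρ).eval 1
  set y := Z.eval 1
  have hcov : isoCov (hessRatio 1 ρ * (gradRatio 1 ρ * z) * z / (gradRatio 1 ρ * z) ^ 2)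
      (z / (gradRatio 1 ρ * z)) (hessRatio k ν * (gradRatio k ν * y) * y / (gradRatio k ν * y) ^ 2)
      (y / (gradRatio k ν * y)) = tensorCov k ρ ν := by
    rw [tensorCov]
    congr 1 <;> field_simp
  have hdens := critDensity_prodFun hU hW hJ₁ hJ₂ hz (by positivity) hy (by positivity)
  have hpsd := covMatrix_prodFun hU hW hJ₁ hJ₂ hz (by positivity) hy (by positivity)
  rw [hcov] at hdens hpsd
  refine ⟨hpsd ▸ covMatrix_posSemidef _, fun hne => ?_⟩
  rw [mul_div_cancel_right₀ _ hz.ne', mul_div_cancel_right₀ _ hy.ne', Fintype.card_fin,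
    Fintype.card_fin, pow_one, ← tensorDensity] at hdens
  -- An empty basis would make the kernel zero, against `0 < Z.eval 1`.
  have : Nonempty (Finset.Icc (-(ρ : ℤ)) ρ × Fin (Module.finrank ℝ (sphPoly k ν))) := by
    rcases isEmpty_or_nonempty (Fin (Module.finrank ℝ (sphPoly k ν))) with h | h
    · have h0 := hZ p₀.2 p₀.2
      rw [Finset.univ_eq_empty, Finset.sum_empty, real_inner_self_eq_norm_sq,
        norm_eq_of_mem_sphere, one_pow] at h0
      exact absurd h0 hy.ne
    · exact ⟨⟨⟨0, by simp⟩, h.some⟩⟩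
  have hB := grad_grad_prodFun hU hW hJ₁ hJ₂
  have hBC := grad_hessVec_prodFun hU hW hJ₁ hJ₂
  simp only [← hcomp] at hB hBC hdens
  rw [expectedCrit_eq_meanCrit he _ hspan', ← hdens]
  refine tendsto_volume_ratio (extChartAt_prod_target p₀) (extChartAt_prod_self p₀) _ ?_ ?_ ?_ he
    ?_ ?_
  · rintro (i | i) <;> simp only [Sum.elim_inl, Sum.elim_inr] <;> positivity
  · exact hB
  · exact hBC
  · intro p
    obtain ⟨g, h1, h2, h3, h4⟩ := exists_diffeomorph_tensor ρ ν p₀ p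
    refine ⟨g, h1, h2, h3, fun n => ?_⟩
    rw [hspan']
    exact h4 _ _ (hspan.le (Submodule.subset_span ⟨n.2, rfl⟩))
  · rwa [hdens]

end ProductManifold

/-! ### Asymptotics in large degree -/

section Asymptotics

variable {k : ℕ}

theorem tendsto_inv_gradRatio (k : ℕ) : Tendsto (fun ν => (gradRatio k ν)⁻¹) atTop (𝓝 0) := by
  have h : Tendsto (fun ν : ℕ => ((k : ℝ) + 2) * ((ν : ℝ)⁻¹ * (ν : ℝ)⁻¹ / (1 + k * (ν : ℝ)⁻¹)))
      atTop (𝓝 ((k + 2) * (0 * 0 / (1 + k * 0)))) :=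
    ((tendsto_inv_atTop_nhds_zero_nat.mul tendsto_inv_atTop_nhds_zero_nat).div
      (tendsto_const_nhds.add (tendsto_inv_atTop_nhds_zero_nat.const_mul _)) (by simp)).const_mul _
  rw [zero_mul, zero_div, mul_zero] at h
  refine h.congr' ?_
  filter_upwards [eventually_ge_atTop 1] with ν hν
  have : (0 : ℝ) < ν := by exact_mod_cast hν
  rw [gradRatio]
  field_simp

theorem tendsto_hessRatio_div (k : ℕ) : Tendsto (fun ν => hessRatio k ν / gradRatio k ν) atTop
    (𝓝 ((k + 2) / (k + 4))) := by
  have h : Tendsto (fun ν : ℕ => ((k : ℝ) + 2) / (k + 4) *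
      ((1 - (ν : ℝ)⁻¹) * (1 + (k + 1) * (ν : ℝ)⁻¹) / (1 + k * (ν : ℝ)⁻¹)))
      atTop (𝓝 ((k + 2) / (k + 4) * ((1 - 0) * (1 + (k + 1) * 0) / (1 + k * 0)))) :=
    (((tendsto_const_nhds.sub tendsto_inv_atTop_nhds_zero_nat).mul
      (tendsto_const_nhds.add (tendsto_inv_atTop_nhds_zero_nat.const_mul _))).div
      (tendsto_const_nhds.add (tendsto_inv_atTop_nhds_zero_nat.const_mul _)) (by simp)).const_mul _
  simp only [sub_zero, mul_zero, add_zero, mul_one, div_one] at h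
  refine h.congr' ?_
  filter_upwards [eventually_ge_atTop 1] with ν hν
  have : (0 : ℝ) < ν := by exact_mod_cast hν
  rw [gradRatio, hessRatio]
  field_simp
  ring

theorem tendsto_add_mul_inv_sqrt_gradRatio (k j : ℕ) :
    Tendsto (fun ν : ℕ => ((ν + j : ℕ) : ℝ) * (√(gradRatio k ν))⁻¹) atTop (𝓝 (√(k + 2))) := by
  have h : Tendsto (fun ν : ℕ => √(((k : ℝ) + 2) *
      ((1 + j * (ν : ℝ)⁻¹) ^ 2 / (1 + k * (ν : ℝ)⁻¹))))
      atTop (𝓝 (√((k + 2) * ((1 + j * 0) ^ 2 / (1 + k * 0))))) :=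
    ((((tendsto_const_nhds.add (tendsto_inv_atTop_nhds_zero_nat.const_mul _)).pow 2).div
      (tendsto_const_nhds.add (tendsto_inv_atTop_nhds_zero_nat.const_mul _))
        (by simp)).const_mul _).sqrt
  simp only [mul_zero, add_zero, mul_one, div_one, one_pow] at h
  refine h.congr' ?_
  filter_upwards [eventually_ge_atTop 1] with ν hν
  have : (0 : ℝ) < ν := by exact_mod_cast hν
  rw [← Real.sqrt_inv, ← Real.sqrt_sq (show (0 : ℝ) ≤ (ν + j : ℕ) by positivity),
    ← Real.sqrt_mul (by positivity), gradRatio]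
  congr 1
  push_cast
  field_simp

/-- The Poisson-type limit of `n.choose k * p n ^ k` when `n * p n` converges; `p` is indexed by the
upper entry `n = ν + j`, hence the shift. -/
theorem tendsto_choose_mul_inv_sqrt_gradRatio (k j : ℕ) :
    Tendsto (fun ν : ℕ => ((ν + j).choose k : ℝ) * (√(gradRatio k ν))⁻¹ ^ k) atTop
      (𝓝 (√(k + 2) ^ k / k.factorial)) := by
  have h := ProbabilityTheory.tendsto_choose_mul_pow_atTop (r := √(k + 2)) k
    (p := fun n => (√(gradRatio k (n - j)))⁻¹) ?_
  · simpa [Function.comp_def] using h.comp (tendsto_add_atTop_nat j)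
  · rw [← tendsto_add_atTop_iff_nat j]
    simpa using tendsto_add_mul_inv_sqrt_gradRatio k j

/-- The dimension is a sum of two binomial coefficients with the same asymptotics, hence the factor
`2`. -/
theorem tendsto_finrank_sphPoly (hk : 1 ≤ k) :
    Tendsto (fun ν : ℕ => √(gradRatio k ν) ^ k / Module.finrank ℝ (sphPoly k ν)) atTop
      (𝓝 (k.factorial / (2 * √(k + 2) ^ k))) := by
  have h := ((tendsto_choose_mul_inv_sqrt_gradRatio k k).add
    (tendsto_choose_mul_inv_sqrt_gradRatio k (k - 1))).inv₀ (by positivity)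
  have he : (√((k : ℝ) + 2) ^ k / k.factorial + √(k + 2) ^ k / k.factorial)⁻¹ =
      k.factorial / (2 * √(k + 2) ^ k) := by
    field_simp
    norm_num
  rw [he] at h
  refine h.congr' ?_
  filter_upwards [eventually_ge_atTop 1] with ν hν
  obtain ⟨ν, rfl⟩ := Nat.exists_eq_add_of_le' hν
  rw [finrank_sphPoly_succ, show ν + 1 + k = k + (ν + 1) by ring,
    show ν + 1 + (k - 1) = k + ν by omega, ← add_mul, mul_inv, ← inv_pow, inv_inv]
  push_cast
  ring

theorem tendsto_sqrt_gradRatio_one :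
    Tendsto (fun ρ : ℕ => √(gradRatio 1 ρ) / (2 * ρ + 1)) atTop (𝓝 (1 / (2 * √3))) := by
  -- `2ρ + 1 = ρ + (ρ + 1)`, the shifts `0` and `1`.
  have h := ((tendsto_add_mul_inv_sqrt_gradRatio 1 0).add
    (tendsto_add_mul_inv_sqrt_gradRatio 1 1)).inv₀ (by positivity)
  have he : (√((1 : ℕ) + 2) + √((1 : ℕ) + 2))⁻¹ = 1 / (2 * √3) := by
    norm_num [← two_mul]
  rw [he] at h
  refine h.congr fun ρ => ?_
  rw [← add_mul, mul_inv, inv_inv]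
  push_cast
  ring

/-- Each parameter of `isoCov` depends on one of the two degrees only, so no relation between `ρ`
and `ν` is needed. -/
theorem tendsto_tensorCov (k : ℕ) :
    Tendsto (fun n : ℕ × ℕ => tensorCov k n.1 n.2) (atTop ×ˢ atTop)
      (𝓝 (isoCov ((1 + 2) / (1 + 4)) 0 ((k + 2) / (k + 4)) 0)) := by
  have h1 := (tendsto_hessRatio_div 1).prodMk_nhds (tendsto_inv_gradRatio 1)
  have h2 := (tendsto_hessRatio_div k).prodMk_nhds (tendsto_inv_gradRatio k)
  have h := (continuous_isoCov (ι₁ := Fin 1) (ι₂ := Fin k)).continuousAt.tendsto.comp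
    ((h1.comp tendsto_fst).prodMk_nhds (h2.comp tendsto_snd))
  simpa only [Nat.cast_one, Function.comp_def, tensorCov] using h

theorem posSemidef_of_tendsto {α τ : Type*} [Fintype τ] {l : Filter α} [l.NeBot]
    {u : α → Matrix τ τ ℝ} {C : Matrix τ τ ℝ} (hu : ∀ᶠ a in l, (u a).PosSemidef)
    (h : Tendsto u l (𝓝 C)) : C.PosSemidef := by
  refine Matrix.PosSemidef.of_dotProduct_mulVec_nonneg ?_ fun x => ?_
  · exact tendsto_nhds_unique ((continuous_id.matrix_conjTranspose.tendsto C).comp h)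
      (h.congr' (hu.mono fun a ha => ha.1.symm))
  · have hc : Continuous fun A : Matrix τ τ ℝ => star x ⬝ᵥ A.mulVec x := by fun_prop
    exact ge_of_tendsto ((hc.tendsto C).comp h) (hu.mono fun a ha => ha.dotProduct_mulVec_nonneg x)

end Asymptotics

/-! ### The limit of the normalized expectation -/

section Main

variable {k : ℕ}

theorem exists_tendsto_gaussAbsDet_tensorCov (hk : 1 ≤ k) : ∃ G : ℝ≥0∞, G ≠ 0 ∧ G ≠ ⊤ ∧
    Tendsto (fun n : ℕ × ℕ => gaussAbsDet (tensorCov k n.1 n.2)) (atTop ×ˢ atTop) (𝓝 G) := by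
  have : Nonempty (Fin k) := ⟨⟨0, hk⟩⟩
  have hpsd : ∀ᶠ n : ℕ × ℕ in atTop ×ˢ atTop, (tensorCov k n.1 n.2).PosSemidef := by
    filter_upwards [(eventually_ge_atTop 1).prod_mk (eventually_ge_atTop 1)] with n hn
    exact (expectedCrit_tensor hk hn.1 hn.2 (1, ⟨EuclideanSpace.single 0 1, by simp⟩)).1
  have hC := posSemidef_of_tendsto hpsd (tendsto_tensorCov k)
  exact ⟨_, (gaussAbsDet_isoCov_pos (by positivity) hC).ne', (gaussAbsDet_lt_top _).ne,
    tendsto_gaussAbsDet hC hpsd (tendsto_tensorCov k)⟩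

/-- The number of critical points of a random function in `T_ρ ⊗ V_ν` is a constant multiple of
their density at a point. -/
theorem exists_expectedCrit_eq_mul (hk : 1 ≤ k) : ∃ c : ℝ≥0∞, c ≠ 0 ∧ c ≠ ⊤ ∧
    ∀ᶠ n : ℕ × ℕ in atTop ×ˢ atTop,
      expectedCrit (arcLength.prod (sphArea k)) (tensor (trigPoly n.1) (sphPoly k n.2)) =
        c * tensorDensity k n.1 n.2 := by
  obtain ⟨G, hG, -, hlim⟩ := exists_tendsto_gaussAbsDet_tensorCov hk
  have hev : ∀ᶠ n : ℕ × ℕ in atTop ×ˢ atTop, (1 ≤ n.1 ∧ 1 ≤ n.2) ∧ tensorDensity k n.1 n.2 ≠ 0 := by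
    filter_upwards [(eventually_ge_atTop 1).prod_mk (eventually_ge_atTop 1),
      hlim.eventually_ne hG] with n hn hg
    refine ⟨hn, mul_ne_zero ?_ hg⟩
    have h1 := gradRatio_pos (k := 1) hn.1
    have h2 := gradRatio_pos (k := k) hn.2
    rw [ENNReal.ofReal_ne_zero_iff]
    positivity
  have htop : ∀ ρ ν, tensorDensity k ρ ν ≠ ⊤ := fun ρ ν =>
    ENNReal.mul_ne_top ENNReal.ofReal_ne_top (gaussAbsDet_lt_top _).ne
  have key := fun (n : ℕ × ℕ) (h : (1 ≤ n.1 ∧ 1 ≤ n.2) ∧ tensorDensity k n.1 n.2 ≠ 0) =>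
    (expectedCrit_tensor hk h.1.1 h.1.2 (1, ⟨EuclideanSpace.single 0 1, by simp⟩)).2 h.2
  -- The constant is read off from one pair `m`; uniqueness of the limit of volume ratios carries it
  -- to the others.
  obtain ⟨m, hm⟩ := hev.exists
  obtain ⟨⟨hm0, hmt⟩, hmlim⟩ := key m hm
  refine ⟨_, (ENNReal.div_pos hm0 (htop m.1 m.2)).ne', ENNReal.div_ne_top hmt hm.2, ?_⟩
  filter_upwards [hev] with n hn
  rw [tendsto_nhds_unique hmlim (key n hn).2, ENNReal.div_mul_cancel hn.2 (htop _ _)]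

/-- The factor `√(gradRatio 1 ρ)` is balanced by `2ρ + 1`, the factor `√(gradRatio k ν) ^ k` by the
dimension of `sphPoly`, and the mean determinant converges. -/
theorem tendsto_tensorDensity_div_finrank (hk : 1 ≤ k) : ∃ D : ℝ≥0∞, D ≠ 0 ∧ D ≠ ⊤ ∧
    Tendsto (fun n : ℕ × ℕ => tensorDensity k n.1 n.2 /
      (Module.finrank ℝ (tensor (trigPoly n.1) (sphPoly k n.2)) : ℝ≥0∞))
      (atTop ×ˢ atTop) (𝓝 D) := by
  obtain ⟨G, hG, hGt, hlim⟩ := exists_tendsto_gaussAbsDet_tensorCov hk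
  have hmul := (tendsto_sqrt_gradRatio_one.comp (tendsto_fst (g := atTop (α := ℕ)))).mul
    ((tendsto_finrank_sphPoly hk).comp (tendsto_snd (f := atTop (α := ℕ))))
  have hreal := ENNReal.tendsto_ofReal (hmul.const_mul ((√(2 * Real.pi))⁻¹ ^ (1 + k)))
  have hpos : 0 < (√(2 * Real.pi))⁻¹ ^ (1 + k) *
      (1 / (2 * √3) * (k.factorial / (2 * √((k : ℝ) + 2) ^ k))) := by
    positivity
  refine ⟨_, mul_ne_zero (ENNReal.ofReal_ne_zero_iff.2 hpos) hG,
    ENNReal.mul_ne_top ENNReal.ofReal_ne_top hGt, ?_⟩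
  refine (ENNReal.Tendsto.mul hreal (Or.inr hGt) hlim (Or.inr ENNReal.ofReal_ne_top)).congr' ?_
  filter_upwards [tendsto_snd.eventually (eventually_ge_atTop 1)] with n hn
  have hfin : 0 < Module.finrank ℝ (sphPoly k n.2) := by
    obtain ⟨ν, hν⟩ := Nat.exists_eq_add_of_le' hn
    rw [hν, finrank_sphPoly_succ]
    have := Nat.choose_pos (Nat.le_add_right k ν)
    omega
  have hfin' : (0 : ℝ) < Module.finrank ℝ (sphPoly k n.2) := by exact_mod_cast hfin
  rw [tensorDensity, finrank_tensor, ENNReal.mul_div_right_comm,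
    ← ENNReal.ofReal_natCast ((2 * n.1 + 1) * _), ← ENNReal.ofReal_div_of_pos
      (by positivity)]
  congr 2
  simp only [Function.comp]
  push_cast
  field_simp

end Main
end CriticalPoints

open CriticalPoints in
/-- On `S¹ × S^{d-1}` with the product of the round metrics, the expected number of critical points
of a random function in `T_ρ ⊗ V_ν(d)` is asymptotic to `K · dim (T_ρ ⊗ V_ν(d))` as `ρ, ν → ∞`,
with `K > 0` depending only on `d`. -/
theorem theorem5p4 (d : ℕ) (hd : 3 ≤ d) :
    ∃ K : ℝ, 0 < K ∧
      Tendsto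
        (fun n : ℕ × ℕ =>
          expectedCrit (arcLength.prod (sphArea (d - 1)))
              (tensor (trigPoly n.1) (sphPoly (d - 1) n.2)) /
            (Module.finrank ℝ (tensor (trigPoly n.1) (sphPoly (d - 1) n.2)) : ℝ≥0∞))
        (atTop ×ˢ atTop) (𝓝 (ENNReal.ofReal K)) := by
  have hk : 1 ≤ d - 1 := by omega
  obtain ⟨c, hc, hct, hcrit⟩ := exists_expectedCrit_eq_mul hk
  obtain ⟨D, hD, hDt, hlim⟩ := tendsto_tensorDensity_div_finrank hk
  refine ⟨(c * D).toReal, ENNReal.toReal_pos (mul_ne_zero hc hD) (ENNReal.mul_ne_top hct hDt), ?_⟩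
  rw [ENNReal.ofReal_toReal (ENNReal.mul_ne_top hct hDt)]
  refine (ENNReal.Tendsto.const_mul hlim (Or.inr hct)).congr' ?_
  filter_upwards [hcrit] with n hn
  rw [hn, mul_div_assoc]
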